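/- **Theorem.** Let $\Omega=(a,b)\times(c,d)\subset\mathbb R^2$ be a bounded rectangle with area $|\Omega|$, $\lambda\in\mathbb R\setminus\{0\}$, $T>0$, and let $u$ be a solution on $[0,T]$ of the logarithmic Schrödinger problem $$ \mathrm i\,\partial_t u+\Delta u=\lambda\,u\ln(|u|^2)\ \text{ in }\Omega,\ 0<t\le T,\qquad u=0\ \text{ on }\partial\Omega,\qquad u(\cdot,0)=u_0, $$ (with $u\ln(|u|^2):=0$ where $u=0$) such that $$ u\in C^3([0,T];L^\infty(\Omega))\cap C^2([0,T];W^{2,\infty}(\Omega))\cap C^0([0,T];W^{4,\infty}(\Omega)\cap H^1_0(\Omega)). $$ For positive integers $J,K,N$ put $h_x=\frac{b-a}J$, $h_y=\frac{d-c}K$, $h=\max\{h_x,h_y\}$, $h_{\min}=\min\{h_x,h_y\}$, $\tau=T/N$, $x_j=a+jh_x$, $y_k=c+kh_y$, $t_n=n\tau$, and let $f(z)=z\ln|z|$, $f(0)=0$. Let $u^n=(u^n_{j,k})_{0\le j\le J,\,0\le k\le K}$, $0\le n\le N$, be complex grid functions that vanish at the boundary nodes, with $u^0_{j,k}=u_0(x_j,y_k)$,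 which satisfy at all interior nodes ($1\le j\le J-1$, $1\le k\le K-1$) the linearized BDF2 scheme $$ \mathrm i\,\frac{3u^{n+1}_{j,k}-4u^n_{j,k}+u^{n-1}_{j,k}}{2\tau}+\delta_\nabla^2u^{n+1}_{j,k}=2\lambda f(2u^n_{j,k}-u^{n-1}_{j,k}),\quad 1\le n\le N-1, $$ $$ \mathrm i\,\frac{u^1_{j,k}-u^0_{j,k}}{\tau}+\delta_\nabla^2u^1_{j,k}=2\lambda f(u^0_{j,k}), $$ where $\delta_\nabla^2w_{j,k}=h_x^{-2}(w_{j+1,k}-2w_{j,k}+w_{j-1,k})+h_y^{-2}(w_{j,k+1}-2w_{j,k}+w_{j,k-1})$. Let $e^n_{j,k}=u(x_j,y_k,t_n)-u^n_{j,k}$, and $$ \|w\|^2=h_xh_y\sum_{j=1}^{J-1}\sum_{k=1}^{K-1}|w_{j,k}|^2,\qquad |w|_1^2=h_xh_y\sum_{j=0}^{J-1}\sum_{k=0}^{K-1}\Big(\Big|\tfrac{w_{j+1,k}-w_{j,k}}{h_x}\Big|^2+\Big|\tfrac{w_{j,k+1}-w_{j,k}}{h_y}\Big|^2\Big). $$ Then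 there is a constant $C_u>0$ that depends only on $|\lambda|$, $|\Omega|$, $T$ and a bound for the norms of $u$ in the three spaces above, such that for every $\kappa>0$ there are $h_0,\tau_0>0$ with the following property: whenever $h\le\kappa h_{\min}$, $0<h\le h_0$ and $0<\tau\le\tau_0$ (with no restriction relating $\tau$ and $h$), $$ \|e^n\|\le C_u\big(\tau^2|\ln\tau|+h^2\big),\qquad |e^n|_1\le C_u\,\tau^{-1/2}\big(\tau^2|\ln\tau|+h^2\big),\qquad n=0,1,\dots,N. $$ -/

import Mathlib

open MeasureTheory Set
open scoped ENNReal ContDiff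

noncomputable section

namespace LogSE

/-! ### Function spaces on a planar open set -/

/-- The open rectangle `(a, b) × (c, d)`. -/
def rect (a b c d : ℝ) : Set (ℝ × ℝ) := Ioo a b ×ˢ Ioo c d

/-- `φ ∈ C_c^∞(Ω)` (complex valued). -/
def IsTest (Ω : Set (ℝ × ℝ)) (φ : ℝ × ℝ → ℂ) : Prop :=
  ContDiff ℝ ∞ φ ∧ HasCompactSupport φ ∧ tsupport φ ⊆ Ω

/-- Classical partial derivative in the first variable. -/
def partialX (φ : ℝ × ℝ → ℂ) : ℝ × ℝ → ℂ := fun z => fderiv ℝ φ z (1, 0)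

/-- Classical partial derivative in the second variable. -/
def partialY (φ : ℝ × ℝ → ℂ) : ℝ × ℝ → ℂ := fun z => fderiv ℝ φ z (0, 1)

/-- The classical mixed derivative `∂_x^p ∂_y^q φ`. -/
def partialXY (p q : ℕ) (φ : ℝ × ℝ → ℂ) : ℝ × ℝ → ℂ := partialX^[p] (partialY^[q] φ)

/-- The Banach space `L^∞(Ω)` of complex valued functions. -/
abbrev LInf (Ω : Set (ℝ × ℝ)) : Type := Lp ℂ ∞ (volume.restrict Ω)

/-- `w` is the weak derivative `∂_x^p ∂_y^q v` on `Ω`. -/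
def IsWeakDeriv (Ω : Set (ℝ × ℝ)) (p q : ℕ) (v w : LInf Ω) : Prop :=
  ∀ φ : ℝ × ℝ → ℂ, IsTest Ω φ →
    ∫ z in Ω, v z * partialXY p q φ z = (-1) ^ (p + q) * ∫ z in Ω, w z * φ z

/-- The multi-indices `(p, q)` of order `p + q ≤ k`. -/
def multiIndices (k : ℕ) : Finset (ℕ × ℕ) :=
  (Finset.range (k + 1) ×ˢ Finset.range (k + 1)).filter (fun α => α.1 + α.2 ≤ k)

lemma mem_multiIndices {k p q : ℕ} (h : p + q ≤ k) : (p, q) ∈ multiIndices k := by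
  simp only [multiIndices, Finset.mem_filter, Finset.mem_product, Finset.mem_range]
  omega

lemma contDiff_partialX {φ : ℝ × ℝ → ℂ} (h : ContDiff ℝ ∞ φ) : ContDiff ℝ ∞ (partialX φ) :=
  (h.fderiv_right (m := ∞) le_rfl).clm_apply contDiff_const

lemma contDiff_partialY {φ : ℝ × ℝ → ℂ} (h : ContDiff ℝ ∞ φ) : ContDiff ℝ ∞ (partialY φ) :=
  (h.fderiv_right (m := ∞) le_rfl).clm_apply contDiff_const

lemma hasCompactSupport_partialX {φ : ℝ × ℝ → ℂ} (h : HasCompactSupport φ) :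
    HasCompactSupport (partialX φ) := h.fderiv_apply (𝕜 := ℝ) _

lemma hasCompactSupport_partialY {φ : ℝ × ℝ → ℂ} (h : HasCompactSupport φ) :
    HasCompactSupport (partialY φ) := h.fderiv_apply (𝕜 := ℝ) _

lemma partialXY_smooth (p q : ℕ) {φ : ℝ × ℝ → ℂ} (h : ContDiff ℝ ∞ φ)
    (hc : HasCompactSupport φ) :
    ContDiff ℝ ∞ (partialXY p q φ) ∧ HasCompactSupport (partialXY p q φ) := by
  have hY : ∀ q : ℕ, ContDiff ℝ ∞ (partialY^[q] φ) ∧ HasCompactSupport (partialY^[q] φ) := by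
    intro q
    induction q with
    | zero => exact ⟨h, hc⟩
    | succ q ih =>
      rw [Function.iterate_succ_apply']
      exact ⟨contDiff_partialY ih.1, hasCompactSupport_partialY ih.2⟩
  unfold partialXY
  induction p with
  | zero => exact hY q
  | succ p ih =>
    rw [Function.iterate_succ_apply']
    exact ⟨contDiff_partialX ih.1, hasCompactSupport_partialX ih.2⟩

lemma integrable_mul {Ω : Set (ℝ × ℝ)} (v : LInf Ω) {φ : ℝ × ℝ → ℂ} (h : ContDiff ℝ ∞ φ)
    (hc : HasCompactSupport φ) :
    Integrable (fun z => v z * φ z) (volume.restrict Ω) := by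
  have h1 : Integrable φ (volume.restrict Ω) :=
    (h.continuous.integrable_of_hasCompactSupport hc).restrict
  exact h1.mul_of_top_right (Lp.memLp v)

/-- The Banach space `W^{k,∞}(Ω)`. An element is the family `(D^α v)_{|α| ≤ k}` in `L^∞(Ω)` of the
weak derivatives of the function `v`, which is the entry of index `(0, 0)`. The norm is the one
induced by the product, i.e. `max_{|α| ≤ k} ‖D^α v‖_{L^∞(Ω)}`. -/
def WInf (k : ℕ) (Ω : Set (ℝ × ℝ)) : Submodule ℂ (↥(multiIndices k) → LInf Ω) where
  carrier := {V | ∀ α : ↥(multiIndices k),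
    IsWeakDeriv Ω α.1.1 α.1.2 (V ⟨(0, 0), mem_multiIndices (Nat.zero_le k)⟩) (V α)}
  zero_mem' := by
    intro α φ hφ
    have h0 : ∀ ψ : ℝ × ℝ → ℂ,
        ∫ z in Ω, (0 : LInf Ω) z * ψ z = 0 := by
      intro ψ
      refine integral_eq_zero_of_ae ?_
      filter_upwards [Lp.coeFn_zero ℂ ∞ (volume.restrict Ω)] with z hz
      rw [hz, Pi.zero_apply, zero_mul]
    simp only [Pi.zero_apply, h0, mul_zero]
  add_mem' := by
    intro V W hV hW α φ hφ
    have hadd : ∀ (v w : LInf Ω) (ψ : ℝ × ℝ → ℂ), ContDiff ℝ ∞ ψ → HasCompactSupport ψ →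
        ∫ z in Ω, (v + w) z * ψ z = (∫ z in Ω, v z * ψ z) + ∫ z in Ω, w z * ψ z := by
      intro v w ψ h1 h2
      rw [← integral_add (integrable_mul v h1 h2) (integrable_mul w h1 h2)]
      refine integral_congr_ae ?_
      filter_upwards [Lp.coeFn_add v w] with z hz
      rw [hz, Pi.add_apply, add_mul]
    obtain ⟨hp1, hp2⟩ := partialXY_smooth α.1.1 α.1.2 hφ.1 hφ.2.1
    rw [Pi.add_apply, Pi.add_apply, hadd _ _ _ hp1 hp2, hadd _ _ _ hφ.1 hφ.2.1, hV α φ hφ,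
      hW α φ hφ, mul_add]
  smul_mem' := by
    intro r V hV α φ hφ
    have hsmul : ∀ (v : LInf Ω) (ψ : ℝ × ℝ → ℂ),
        ∫ z in Ω, (r • v) z * ψ z = r * ∫ z in Ω, v z * ψ z := by
      intro v ψ
      rw [← integral_const_mul]
      refine integral_congr_ae ?_
      filter_upwards [Lp.coeFn_smul r v] with z hz
      rw [hz, Pi.smul_apply, smul_eq_mul, mul_assoc]
    rw [Pi.smul_apply, Pi.smul_apply, hsmul, hsmul, hV α φ hφ]
    ring

/-- The weak derivative `∂_x^p ∂_y^q V ∈ L^∞(Ω)` of `V ∈ W^{k,∞}(Ω)`, for `p + q ≤ k`. -/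
def weakD {k : ℕ} {Ω : Set (ℝ × ℝ)} (V : WInf k Ω) (p q : ℕ) (h : p + q ≤ k) : LInf Ω :=
  (V : ↥(multiIndices k) → LInf Ω) ⟨(p, q), mem_multiIndices h⟩

/-- `V ∈ W^{4,∞}(Ω)` belongs to `H^1_0(Ω)`, the closure of `C_c^∞(Ω)` in the norm of `H^1(Ω)`. -/
def MemH10 {Ω : Set (ℝ × ℝ)} (V : WInf 4 Ω) : Prop :=
  ∀ ε : ℝ, 0 < ε → ∃ φ : ℝ × ℝ → ℂ, IsTest Ω φ ∧
    eLpNorm (fun z => weakD V 0 0 (by norm_num) z - φ z) 2 (volume.restrict Ω)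
      ≤ ENNReal.ofReal ε ∧
    eLpNorm (fun z => weakD V 1 0 (by norm_num) z - partialX φ z) 2 (volume.restrict Ω)
      ≤ ENNReal.ofReal ε ∧
    eLpNorm (fun z => weakD V 0 1 (by norm_num) z - partialY φ z) 2 (volume.restrict Ω)
      ≤ ENNReal.ofReal ε

/-- `V ∈ C^k([0, T]; X)` with norm `max_{m ≤ k} max_{0 ≤ t ≤ T} ‖V^{(m)}(t)‖_X ≤ M`. -/
def MemCk {X : Type} [NormedAddCommGroup X] [NormedSpace ℝ X]
    (k : ℕ) (T M : ℝ) (V : ℝ → X) : Prop :=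
  ContDiffOn ℝ k V (Icc 0 T) ∧
    ∀ m : ℕ, m ≤ k → ∀ t ∈ Icc (0 : ℝ) T, ‖iteratedDerivWithin m V (Icc 0 T) t‖ ≤ M

/-! ### The logarithmic Schrödinger equation -/

/-- `u` (time, then space) is a solution on `[0, T]` of
`i u_t + Δu = λ u ln(|u|²)` in `Ω`, `u = 0` on `∂Ω`, and it belongs to
`C³([0,T]; L^∞(Ω)) ∩ C²([0,T]; W^{2,∞}(Ω)) ∩ C⁰([0,T]; W^{4,∞}(Ω) ∩ H¹₀(Ω))` with the three norms
bounded by `M`. The function `u` itself is the continuous representative; `v₀`, `v₂`, `v₄` are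
the curves `t ↦ u(t)` in the three spaces. Since `Ω` will be bounded, a curve that is continuous
in `W^{4,∞}` is continuous in `H¹`, so only the membership in `H¹₀` has to be added. The time
derivative in the equation is the one of the curve in `L^∞(Ω)`, and `Δu` is formed from the weak
derivatives; both are represented by continuous functions, so that the equation almost everywhere
is the equation everywhere. -/
def IsRegularSolution (Ω : Set (ℝ × ℝ)) (T lam M : ℝ) (u : ℝ → ℝ × ℝ → ℂ) : Prop :=
  (∀ t ∈ Icc (0 : ℝ) T, ContinuousOn (u t) (closure Ω)) ∧
  (∀ t ∈ Icc (0 : ℝ) T, ∀ z ∈ frontier Ω, u t z = 0) ∧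
  ∃ (v₀ : ℝ → LInf Ω) (v₂ : ℝ → WInf 2 Ω) (v₄ : ℝ → WInf 4 Ω),
    (∀ t ∈ Icc (0 : ℝ) T, v₀ t =ᵐ[volume.restrict Ω] u t) ∧
    (∀ t ∈ Icc (0 : ℝ) T, weakD (v₂ t) 0 0 (by norm_num) = v₀ t) ∧
    (∀ t ∈ Icc (0 : ℝ) T, weakD (v₄ t) 0 0 (by norm_num) = v₀ t) ∧
    MemCk 3 T M v₀ ∧ MemCk 2 T M v₂ ∧ MemCk 0 T M v₄ ∧
    (∀ t ∈ Icc (0 : ℝ) T, MemH10 (v₄ t)) ∧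
    ∀ t ∈ Ioc (0 : ℝ) T, ∀ᵐ z ∂(volume.restrict Ω),
      Complex.I * derivWithin v₀ (Icc 0 T) t z
        + (weakD (v₄ t) 2 0 (by norm_num) z + weakD (v₄ t) 0 2 (by norm_num) z)
        = (lam : ℂ) * u t z * (Real.log (‖u t z‖ ^ 2) : ℂ)

/-! ### The linearized BDF2 finite difference scheme

Grid functions are maps `w : ℕ → ℕ → ℂ`, of which only the values `w j k` with `0 ≤ j ≤ J`,
`0 ≤ k ≤ K` matter. -/

/-- `f(z) = z ln|z|`, with `f(0) = 0`. -/
def f (z : ℂ) : ℂ := z * (Real.log ‖z‖ : ℂ)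

/-- `δ_∇² w = δ_x² w + δ_y² w` at an interior node (`1 ≤ j`, `1 ≤ k`). -/
def discreteLaplacian (hx hy : ℝ) (w : ℕ → ℕ → ℂ) (j k : ℕ) : ℂ :=
  (w (j + 1) k - 2 * w j k + w (j - 1) k) / (hx : ℂ) ^ 2
    + (w j (k + 1) - 2 * w j k + w j (k - 1)) / (hy : ℂ) ^ 2

/-- `w ∈ X_h^0`: the grid function vanishes at the boundary nodes. -/
def VanishesOnBoundary (J K : ℕ) (w : ℕ → ℕ → ℂ) : Prop :=
  ∀ j ≤ J, ∀ k ≤ K, (j = 0 ∨ j = J ∨ k = 0 ∨ k = K) → w j k = 0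

/-- The restriction of a function to the grid with nodes `(a + j hx, c + k hy)`. -/
def gridRestrict (a c hx hy : ℝ) (g : ℝ × ℝ → ℂ) (j k : ℕ) : ℂ :=
  g (a + j * hx, c + k * hy)

/-- `w 0, …, w N` is the numerical solution of the linearized BDF2 scheme with a first step by the
linearized BDF1 scheme, mesh sizes `hx`, `hy`, time step `τ`, and initial grid function `w₀`. -/
structure IsBDF2Solution (J K N : ℕ) (hx hy τ lam : ℝ) (w₀ : ℕ → ℕ → ℂ)
    (w : ℕ → ℕ → ℕ → ℂ) : Prop where
  boundary : ∀ n ≤ N, VanishesOnBoundary J K (w n)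
  initial : ∀ j ≤ J, ∀ k ≤ K, w 0 j k = w₀ j k
  first_step : ∀ j k : ℕ, 1 ≤ j → j < J → 1 ≤ k → k < K →
    Complex.I * ((w 1 j k - w 0 j k) / (τ : ℂ)) + discreteLaplacian hx hy (w 1) j k
      = 2 * (lam : ℂ) * f (w 0 j k)
  step : ∀ n : ℕ, 1 ≤ n → n < N → ∀ j k : ℕ, 1 ≤ j → j < J → 1 ≤ k → k < K →
    Complex.I * ((3 * w (n + 1) j k - 4 * w n j k + w (n - 1) j k) / (2 * (τ : ℂ)))
        + discreteLaplacian hx hy (w (n + 1)) j k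
      = 2 * (lam : ℂ) * f (2 * w n j k - w (n - 1) j k)

/-- The discrete `L²` norm `‖w‖` on `X_h^0`. -/
def l2Norm (J K : ℕ) (hx hy : ℝ) (w : ℕ → ℕ → ℂ) : ℝ :=
  Real.sqrt (hx * hy * ∑ j ∈ Finset.Ico 1 J, ∑ k ∈ Finset.Ico 1 K, ‖w j k‖ ^ 2)

/-- The discrete `H¹` seminorm `|w|₁` on `X_h^0`. -/
def h1Seminorm (J K : ℕ) (hx hy : ℝ) (w : ℕ → ℕ → ℂ) : ℝ :=
  Real.sqrt
    (hx * hy * ∑ j ∈ Finset.range J, ∑ k ∈ Finset.range K, ‖(w (j + 1) k - w j k) / (hx : ℂ)‖ ^ 2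
    + hx * hy * ∑ j ∈ Finset.range J, ∑ k ∈ Finset.range K, ‖(w j (k + 1) - w j k) / (hy : ℂ)‖ ^ 2)

end LogSE

end

/-! The obstacle is that `f` is not Lipschitz near 0: its difference quotients grow like |ln|z||.
Two substitutes are used. The Cazenave–Haraux inequality `abs_im_conj_mul_f_sub_le` has no
logarithm, but needs the difference of `f` paired with the matching difference of arguments. The
cut-off bound `norm_f_sub_le_of_norm_le` works for any pairing, at the price of a factor |ln ε|, a
small additive term and a quadratic term.

Stability. Test the error equation with e^{n+1} and write e^{n+1} = ê + δ with ê = 2e^n − e^{n−1},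
the error in the argument of the nonlinearity. In the imaginary part the Laplacian drops out. The ê
part of the nonlinear difference F is handled by Cazenave–Haraux. The δ part is absorbed by the
dissipation ‖δ‖² in the G-identity `two_mul_re_inner_bdf2`, which carries no factor τ; this leaves
τ²‖F‖². With ε = τ², ‖F‖ is of order (1 + |ln τ|)‖ê‖ + τ²|ln τ|, and since τ ln²τ is bounded, the
Gronwall rate contains no logarithm (`bdf2_energy_le`, `bdf2_step_bounds`).

Bootstrap. The numerical solution has no a priori bound, so F also contains |ê|², and its discrete
L² norm has to be bounded by ‖ê‖. Let η = τ²|ln τ| + h². The real part of the same tested equation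
gives |e|₁² ≤ Cη²/τ. If h² ≤ τ, then η ≤ 2τ and the discrete Ladyzhenskaya inequality suffices; if τ
≤ h², then η ≤ 2h² and the inverse estimate suffices. Hence no relation between τ and h is needed.
The argument is closed by `gronwall_bootstrap`.

Consistency. The fourth space derivatives of u exist only weakly in L^∞. The second differences are
therefore tested against φ, and s ↦ ∫ u φ(· − s v) is expanded by Taylor's formula; continuity turns
the tested bound into a bound at every node. In time, Taylor's formula is applied to the curve in
L^∞. The BDF1 step is of lower order, but its residual enters multiplied by τ and e⁰ = 0. -/

namespace LogSE

/-! ### The logarithmic nonlinearity -/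

/-- This is ln s ≤ s − 1 at s = y/x. The weight is the smaller of the two moduli, which compensates
the singularity of the logarithm. -/
lemma abs_log_sub_log_mul_le {x y : ℝ} (hx : 0 < x) (hxy : x ≤ y) :
    x * |Real.log x - Real.log y| ≤ y - x := by
  have hy : 0 < y := hx.trans_le hxy
  have h1 : Real.log y - Real.log x ≤ y / x - 1 := by
    rw [← Real.log_div hy.ne' hx.ne']
    exact Real.log_le_sub_one_of_pos (div_pos hy hx)
  have h2 : Real.log x ≤ Real.log y := Real.log_le_log hx hxy
  rw [abs_sub_comm, abs_of_nonneg (sub_nonneg.2 h2)]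
  calc x * (Real.log y - Real.log x) ≤ x * (y / x - 1) := by gcongr
    _ = y - x := by field_simp

lemma norm_f (z : ℂ) : ‖f z‖ = ‖z‖ * |Real.log ‖z‖| := by
  rw [f, norm_mul, Complex.norm_real, Real.norm_eq_abs]

lemma norm_f_le {ε : ℝ} (hε : 0 < ε) {z : ℂ} (hz : ‖z‖ ≤ ε) :
    ‖f z‖ ≤ ε * (1 + |Real.log ε|) := by
  rw [norm_f]
  rcases (norm_nonneg z).eq_or_lt with h0 | h0
  · rw [← h0, zero_mul]
    positivity
  · have h1 := abs_log_sub_log_mul_le h0 hz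
    have h2 : |Real.log ‖z‖| ≤ |Real.log ‖z‖ - Real.log ε| + |Real.log ε| := by
      simpa using abs_add_le (Real.log ‖z‖ - Real.log ε) (Real.log ε)
    have h3 := abs_nonneg (Real.log ε)
    nlinarith

/-- The logarithm is frozen at the point of larger modulus. The remainder z₁(ln|z₁| − ln|z₂|) is
weighted by the smaller modulus and costs only |z₁ − z₂|. -/
lemma norm_f_sub_le_of_le {z₁ z₂ : ℂ} (h : ‖z₁‖ ≤ ‖z₂‖) :
    ‖f z₁ - f z₂‖ ≤ ‖z₁ - z₂‖ * (1 + |Real.log ‖z₂‖|) := by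
  rcases eq_or_ne z₁ 0 with rfl | h1
  · simp only [f, zero_mul, zero_sub, norm_neg, norm_mul, Complex.norm_real, Real.norm_eq_abs]
    nlinarith [norm_nonneg z₂, abs_nonneg (Real.log ‖z₂‖)]
  · have h1' : 0 < ‖z₁‖ := norm_pos_iff.2 h1
    have e : f z₁ - f z₂ = (z₁ - z₂) * (Real.log ‖z₂‖ : ℂ)
        + z₁ * ((Real.log ‖z₁‖ - Real.log ‖z₂‖ : ℝ) : ℂ) := by
      simp only [f]; push_cast; ring
    rw [e]
    refine (norm_add_le _ _).trans ?_
    rw [norm_mul, norm_mul, Complex.norm_real, Complex.norm_real, Real.norm_eq_abs,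
      Real.norm_eq_abs]
    have h2 := abs_log_sub_log_mul_le h1' h
    have h3 : ‖z₂‖ - ‖z₁‖ ≤ ‖z₁ - z₂‖ := by
      rw [norm_sub_rev]; exact norm_sub_norm_le _ _
    nlinarith

/-- Only z₁ is assumed bounded: in the error analysis it comes from the exact solution, while z₂ is
a numerical value without a priori bound. This is the origin of the quadratic term. If both moduli
are below ε, each value of `f` is small by itself; otherwise the larger modulus lies between ε and R
+ |z₁ − z₂|. -/
lemma norm_f_sub_le_of_norm_le {R ε : ℝ} (hε : 0 < ε) {z₁ z₂ : ℂ}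
    (hR : ‖z₁‖ ≤ R) :
    ‖f z₁ - f z₂‖ ≤ ‖z₁ - z₂‖ * (1 + |Real.log ε| + R + ‖z₁ - z₂‖)
      + 2 * ε * (1 + |Real.log ε|) := by
  have hR0 : 0 ≤ R := (norm_nonneg _).trans hR
  have key : ‖f z₁ - f z₂‖ ≤ ‖z₁ - z₂‖ * (1 + |Real.log (max ‖z₁‖ ‖z₂‖)|) := by
    rcases le_total ‖z₁‖ ‖z₂‖ with h | h
    · rw [max_eq_right h]; exact norm_f_sub_le_of_le h
    · rw [max_eq_left h, norm_sub_rev, norm_sub_rev z₁]; exact norm_f_sub_le_of_le h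
  have hl := abs_nonneg (Real.log ε)
  have hd := norm_nonneg (z₁ - z₂)
  rcases le_total (max ‖z₁‖ ‖z₂‖) ε with h | h
  · have h1 := norm_f_le hε ((le_max_left _ _).trans h)
    have h2 := norm_f_le hε ((le_max_right _ _).trans h)
    have h3 := norm_sub_le (f z₁) (f z₂)
    have : 0 ≤ ‖z₁ - z₂‖ * (1 + |Real.log ε| + R + ‖z₁ - z₂‖) := by positivity
    linarith
  · have hmax : max ‖z₁‖ ‖z₂‖ ≤ R + ‖z₁ - z₂‖ := by
      refine max_le (by linarith) ?_
      have := norm_sub_norm_le z₂ z₁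
      rw [norm_sub_rev] at this
      linarith
    have hlog : |Real.log (max ‖z₁‖ ‖z₂‖)| ≤ |Real.log ε| + (R + ‖z₁ - z₂‖) := by
      refine abs_le.2 ⟨?_, ?_⟩
      · have := Real.log_le_log hε h
        have := neg_abs_le (Real.log ε)
        linarith
      · have := Real.log_le_sub_one_of_pos (hε.trans_le h)
        linarith
    have : ‖z₁ - z₂‖ * (1 + |Real.log (max ‖z₁‖ ‖z₂‖)|)
        ≤ ‖z₁ - z₂‖ * (1 + |Real.log ε| + R + ‖z₁ - z₂‖) := by
      refine mul_le_mul_of_nonneg_left ?_ hd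
      linarith
    have : 0 ≤ 2 * ε * (1 + |Real.log ε|) := by positivity
    linarith

/-- The one-sided Lipschitz bound of Cazenave and Haraux. -/
lemma abs_im_conj_mul_f_sub_le (z₁ z₂ : ℂ) :
    |((starRingEnd ℂ) (z₁ - z₂) * (f z₁ - f z₂)).im| ≤ ‖z₁ - z₂‖ ^ 2 := by
  wlog h : ‖z₁‖ ≤ ‖z₂‖ generalizing z₁ z₂
  · have := this z₂ z₁ (le_of_not_ge h)
    rw [norm_sub_rev, ← neg_sub z₁ z₂, ← neg_sub (f z₁), map_neg, neg_mul_neg] at this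
    exact this
  rcases eq_or_ne z₁ 0 with rfl | h1
  · simp only [f, zero_mul, zero_sub, map_neg, neg_mul_neg, ← mul_assoc, Complex.conj_mul']
    rw [← Complex.ofReal_pow, ← Complex.ofReal_mul, Complex.ofReal_im, abs_zero]
    positivity
  have h1' : 0 < ‖z₁‖ := norm_pos_iff.2 h1
  -- The part (z₁ − z₂) ln|z₂| of the difference pairs with the conjugate of z₁ − z₂ to a real
  -- number, so the dangerous logarithm disappears from the imaginary part.
  have e : ((starRingEnd ℂ) (z₁ - z₂) * (f z₁ - f z₂)).im
      = (Real.log ‖z₁‖ - Real.log ‖z₂‖) * ((starRingEnd ℂ) (z₁ - z₂) * z₁).im := by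
    simp only [f, map_sub, Complex.mul_im, Complex.sub_re, Complex.sub_im, Complex.mul_re,
      Complex.ofReal_re, Complex.ofReal_im, Complex.conj_re, Complex.conj_im]
    ring
  rw [e, abs_mul]
  have h2 : |((starRingEnd ℂ) (z₁ - z₂) * z₁).im| ≤ ‖z₁ - z₂‖ * ‖z₁‖ := by
    refine (Complex.abs_im_le_norm _).trans ?_
    rw [norm_mul, Complex.norm_conj]
  have h3 := abs_log_sub_log_mul_le h1' h
  have h4 : ‖z₂‖ - ‖z₁‖ ≤ ‖z₁ - z₂‖ := by
    rw [norm_sub_rev]; exact norm_sub_norm_le _ _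
  calc _ ≤ |Real.log ‖z₁‖ - Real.log ‖z₂‖| * (‖z₁ - z₂‖ * ‖z₁‖) := by gcongr
    _ = ‖z₁ - z₂‖ * (‖z₁‖ * |Real.log ‖z₁‖ - Real.log ‖z₂‖|) := by ring
    _ ≤ ‖z₁ - z₂‖ * ‖z₁ - z₂‖ := by gcongr; linarith
    _ = _ := by ring

lemma continuous_f : Continuous f := by
  rw [continuous_iff_continuousAt]
  intro z
  rcases eq_or_ne z 0 with rfl | hz
  · have h0 : f 0 = 0 := by simp [f]
    rw [ContinuousAt, h0, tendsto_zero_iff_norm_tendsto_zero]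
    simp only [norm_f]
    have h := (Real.continuous_mul_log.comp (continuous_norm (E := ℂ))).abs.tendsto 0
    simpa [Function.comp_def, abs_mul] using h
  · have : ContinuousAt (fun z : ℂ => Real.log ‖z‖) z :=
      continuous_norm.continuousAt.log (norm_ne_zero_iff.2 hz)
    exact continuousAt_id.mul (Complex.continuous_ofReal.continuousAt.comp this)

/-! ### Taylor expansions along a chain of derivatives -/

section Taylor

variable {E : Type*} [NormedAddCommGroup E] [NormedSpace ℝ E] {s : Set ℝ} {x₀ B : ℝ}

/-- The mean value inequality on the segment from x₀ to x, with the derivative bounded by its worst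
value at x. The factor 1/(n+1) that integration would gain is given up. -/
lemma norm_sub_le_pow_of_deriv (hs : Convex ℝ s) (hx₀ : x₀ ∈ s) (hB : 0 ≤ B) (n : ℕ)
    {F F' : ℝ → E} (hF : ∀ x ∈ s, HasDerivWithinAt F (F' x) s x)
    (hF' : ∀ x ∈ s, ‖F' x‖ ≤ B * |x - x₀| ^ n) {x : ℝ} (hx : x ∈ s) :
    ‖F x - F x₀‖ ≤ B * |x - x₀| ^ (n + 1) := by
  have hsub : uIcc x₀ x ⊆ s := hs.ordConnected.uIcc_subset hx₀ hx
  have := (convex_uIcc x₀ x).norm_image_sub_le_of_norm_hasDerivWithin_le (f := F) (f' := F')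
    (C := B * |x - x₀| ^ n) (fun y hy => (hF y (hsub hy)).mono hsub)
    (fun y hy => (hF' y (hsub hy)).trans (by
      gcongr B * ?_ ^ n
      exact abs_sub_left_of_mem_uIcc hy)) left_mem_uIcc right_mem_uIcc
  rwa [Real.norm_eq_abs, mul_assoc, ← pow_succ] at this

lemma hasDerivWithinAt_sub_pow_div (n : ℕ) (y : ℝ) :
    HasDerivWithinAt (fun x => (x - x₀) ^ (n + 1) / (n + 1).factorial)
      ((y - x₀) ^ n / n.factorial) s y := by
  have h := ((((hasDerivAt_id y).sub_const x₀).fun_pow (n + 1)).div_const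
    ((n + 1).factorial : ℝ)).hasDerivWithinAt (s := s)
  refine h.congr_deriv ?_
  rw [Nat.factorial_succ]
  simp only [Nat.add_one_sub_one, id_eq, Nat.cast_mul, mul_one]
  rw [mul_div_mul_left _ _ (by positivity)]

variable {F₀ F₁ F₂ F₃ F₄ : ℝ → E}

lemma norm_taylor_one_le (hs : Convex ℝ s) (hx₀ : x₀ ∈ s) (hB : 0 ≤ B)
    (h₀ : ∀ x ∈ s, HasDerivWithinAt F₀ (F₁ x) s x) (hb : ∀ x ∈ s, ‖F₁ x‖ ≤ B)
    {x : ℝ} (hx : x ∈ s) : ‖F₀ x - F₀ x₀‖ ≤ B * |x - x₀| := by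
  simpa using norm_sub_le_pow_of_deriv hs hx₀ hB 0 h₀ (by simpa using hb) hx

/-- The derivative of a Taylor remainder of F₀ is the remainder of F₁ of one order less, so each
order follows from the preceding one. Derivatives within `s` suffice, which covers the endpoints of
a time interval. -/
lemma norm_taylor_two_le (hs : Convex ℝ s) (hx₀ : x₀ ∈ s) (hB : 0 ≤ B)
    (h₀ : ∀ x ∈ s, HasDerivWithinAt F₀ (F₁ x) s x)
    (h₁ : ∀ x ∈ s, HasDerivWithinAt F₁ (F₂ x) s x) (hb : ∀ x ∈ s, ‖F₂ x‖ ≤ B)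
    {x : ℝ} (hx : x ∈ s) :
    ‖F₀ x - F₀ x₀ - (x - x₀) • F₁ x₀‖ ≤ B * |x - x₀| ^ 2 := by
  have h := norm_sub_le_pow_of_deriv hs hx₀ hB 1 (F := fun x => F₀ x - (x - x₀) • F₁ x₀)
    (F' := fun x => F₁ x - F₁ x₀) (fun y hy => by
      simpa using (h₀ y hy).fun_sub ((hasDerivWithinAt_sub_pow_div 0 y).smul_const (F₁ x₀)))
    (fun y hy => by simpa using norm_taylor_one_le hs hx₀ hB h₁ hb hy) hx
  convert h using 2
  simp only [sub_self, zero_smul]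
  abel

lemma norm_taylor_three_le (hs : Convex ℝ s) (hx₀ : x₀ ∈ s) (hB : 0 ≤ B)
    (h₀ : ∀ x ∈ s, HasDerivWithinAt F₀ (F₁ x) s x)
    (h₁ : ∀ x ∈ s, HasDerivWithinAt F₁ (F₂ x) s x)
    (h₂ : ∀ x ∈ s, HasDerivWithinAt F₂ (F₃ x) s x) (hb : ∀ x ∈ s, ‖F₃ x‖ ≤ B)
    {x : ℝ} (hx : x ∈ s) :
    ‖F₀ x - F₀ x₀ - (x - x₀) • F₁ x₀ - ((x - x₀) ^ 2 / 2) • F₂ x₀‖ ≤ B * |x - x₀| ^ 3 := by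
  have h := norm_sub_le_pow_of_deriv hs hx₀ hB 2
    (F := fun x => F₀ x - (x - x₀) • F₁ x₀ - ((x - x₀) ^ 2 / 2) • F₂ x₀)
    (F' := fun x => F₁ x - F₁ x₀ - (x - x₀) • F₂ x₀) (fun y hy => by
      simpa [Nat.factorial] using
        ((h₀ y hy).fun_sub ((hasDerivWithinAt_sub_pow_div 0 y).smul_const (F₁ x₀))).fun_sub
        ((hasDerivWithinAt_sub_pow_div 1 y).smul_const (F₂ x₀)))
    (fun y hy => norm_taylor_two_le hs hx₀ hB h₁ h₂ hb hy) hx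
  convert h using 2
  simp only [sub_self, zero_smul, ne_eq, OfNat.ofNat_ne_zero, not_false_eq_true, zero_pow,
    zero_div]
  abel

lemma norm_taylor_four_le (hs : Convex ℝ s) (hx₀ : x₀ ∈ s) (hB : 0 ≤ B)
    (h₀ : ∀ x ∈ s, HasDerivWithinAt F₀ (F₁ x) s x)
    (h₁ : ∀ x ∈ s, HasDerivWithinAt F₁ (F₂ x) s x)
    (h₂ : ∀ x ∈ s, HasDerivWithinAt F₂ (F₃ x) s x)
    (h₃ : ∀ x ∈ s, HasDerivWithinAt F₃ (F₄ x) s x) (hb : ∀ x ∈ s, ‖F₄ x‖ ≤ B)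
    {x : ℝ} (hx : x ∈ s) :
    ‖F₀ x - F₀ x₀ - (x - x₀) • F₁ x₀ - ((x - x₀) ^ 2 / 2) • F₂ x₀
      - ((x - x₀) ^ 3 / 6) • F₃ x₀‖ ≤ B * |x - x₀| ^ 4 := by
  have h := norm_sub_le_pow_of_deriv hs hx₀ hB 3
    (F := fun x => F₀ x - (x - x₀) • F₁ x₀ - ((x - x₀) ^ 2 / 2) • F₂ x₀
      - ((x - x₀) ^ 3 / 6) • F₃ x₀)
    (F' := fun x => F₁ x - F₁ x₀ - (x - x₀) • F₂ x₀ - ((x - x₀) ^ 2 / 2) • F₃ x₀)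
    (fun y hy => by
      simpa [Nat.factorial] using
        (((h₀ y hy).fun_sub ((hasDerivWithinAt_sub_pow_div 0 y).smul_const (F₁ x₀))).fun_sub
        ((hasDerivWithinAt_sub_pow_div 1 y).smul_const (F₂ x₀))).fun_sub
        ((hasDerivWithinAt_sub_pow_div 2 y).smul_const (F₃ x₀)))
    (fun y hy => norm_taylor_three_le hs hx₀ hB h₁ h₂ h₃ hb hy) hx
  convert h using 2
  simp only [sub_self, zero_smul, ne_eq, OfNat.ofNat_ne_zero, not_false_eq_true, zero_pow,
    zero_div]
  abel

end Taylor

/-! ### Testing against translated functions -/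

/-- The derivative of `φ` in the direction `v`. -/
noncomputable def dirDeriv (v : ℝ × ℝ) (φ : ℝ × ℝ → ℂ) : ℝ × ℝ → ℂ := fun z => fderiv ℝ φ z v

lemma dirDeriv_smooth (v : ℝ × ℝ) {φ : ℝ × ℝ → ℂ} (h : ContDiff ℝ ∞ φ)
    (hc : HasCompactSupport φ) (m : ℕ) :
    ContDiff ℝ ∞ ((dirDeriv v)^[m] φ) ∧ HasCompactSupport ((dirDeriv v)^[m] φ) := by
  induction m with
  | zero => exact ⟨h, hc⟩
  | succ m ih =>
    rw [Function.iterate_succ_apply']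
    exact ⟨(ih.1.fderiv_right (m := ∞) le_rfl).clm_apply contDiff_const,
      ih.2.fderiv_apply (𝕜 := ℝ) _⟩

lemma dirDeriv_iterate_comp_sub (v a : ℝ × ℝ) (φ : ℝ × ℝ → ℂ) (m : ℕ) :
    (dirDeriv v)^[m] (fun z => φ (z - a)) = fun z => (dirDeriv v)^[m] φ (z - a) := by
  induction m with
  | zero => rfl
  | succ m ih =>
    rw [Function.iterate_succ_apply', ih, Function.iterate_succ_apply']
    funext z
    simp only [dirDeriv, fderiv_comp_sub]

/-- The translation acts on the smooth factor, so the integral is differentiable in s although w is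
merely bounded. -/
lemma hasDerivAt_integral_mul_translate {μ : Measure (ℝ × ℝ)} [IsFiniteMeasure μ]
    {w : ℝ × ℝ → ℂ} (hw : MemLp w ∞ μ) {ψ : ℝ × ℝ → ℂ} (hψ : ContDiff ℝ ∞ ψ)
    (hc : HasCompactSupport ψ) (v : ℝ × ℝ) (s : ℝ) :
    HasDerivAt (fun s : ℝ => ∫ z, w z * ψ (z - s • v) ∂μ)
      (∫ z, w z * (-dirDeriv v ψ (z - s • v)) ∂μ) s := by
  have hwi : Integrable w μ := hw.integrable le_top
  obtain ⟨h1, h2⟩ := dirDeriv_smooth v hψ hc 1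
  rw [Function.iterate_one] at h1 h2
  obtain ⟨C, hC⟩ := h2.exists_bound_of_continuous h1.continuous
  obtain ⟨C', hC'⟩ := hc.exists_bound_of_continuous hψ.continuous
  have hcont : ∀ s : ℝ, Continuous fun z : ℝ × ℝ => ψ (z - s • v) := fun s =>
    hψ.continuous.comp (continuous_id.sub continuous_const)
  have hcont' : Continuous fun z : ℝ × ℝ => -dirDeriv v ψ (z - s • v) :=
    (h1.continuous.comp (continuous_id.sub continuous_const)).neg
  refine (hasDerivAt_integral_of_dominated_loc_of_deriv_le (s := univ)
    (F := fun (s : ℝ) z => w z * ψ (z - s • v))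
    (F' := fun (s : ℝ) z => w z * (-dirDeriv v ψ (z - s • v)))
    (bound := fun z => ‖w z‖ * C) Filter.univ_mem ?_ ?_ ?_ ?_ ?_ ?_).2
  · exact Filter.Eventually.of_forall fun s =>
      hwi.aestronglyMeasurable.mul (hcont s).aestronglyMeasurable
  · exact hwi.mul_bdd (c := C') (hcont s).aestronglyMeasurable
      (Filter.Eventually.of_forall fun z => hC' _)
  · exact hwi.aestronglyMeasurable.mul hcont'.aestronglyMeasurable
  · refine Filter.Eventually.of_forall fun z s _ => ?_
    rw [norm_mul, norm_neg]
    exact mul_le_mul_of_nonneg_left (hC _) (norm_nonneg _)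
  · exact hwi.norm.mul_const C
  · refine Filter.Eventually.of_forall fun z s _ => ?_
    have hd : HasFDerivAt ψ (fderiv ℝ ψ (z - s • v)) (z - s • v) :=
      (hψ.differentiable (by simp)).differentiableAt.hasFDerivAt
    have hl : HasDerivAt (fun s : ℝ => z - s • v) (-v) s := by
      simpa using ((hasDerivAt_id s).smul_const v).const_sub z
    have := (hd.comp_hasDerivAt s hl).const_mul (w z)
    simpa [dirDeriv] using this

lemma integrable_mul_of_tsupport_subset {S : Set (ℝ × ℝ)} (hS : IsOpen S) {g φ : ℝ × ℝ → ℂ}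
    (hg : ContinuousOn g S) (hφ : IsTest S φ) : Integrable (fun z => g z * φ z) := by
  have hc : HasCompactSupport (fun z => g z * φ z) := hφ.2.1.mul_left
  have hcont : Continuous (fun z => g z * φ z) :=
    (hg.mul hφ.1.continuous.continuousOn).continuous_of_tsupport_subset hS
      ((tsupport_mul_subset_right).trans hφ.2.2)
  exact hcont.integrable_of_hasCompactSupport hc

/-- L¹–L^∞ duality localized at a point: a nonnegative bump concentrated near z₀ satisfies |∫φ| =
∫|φ|, and g is nearly constant on its support. -/
lemma norm_le_of_forall_isTest {S : Set (ℝ × ℝ)} (hS : IsOpen S) {g : ℝ × ℝ → ℂ} {B : ℝ}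
    (hg : ContinuousOn g S)
    (h : ∀ φ, IsTest S φ → ‖∫ z, g z * φ z‖ ≤ B * ∫ z, ‖φ z‖) {z₀ : ℝ × ℝ} (hz₀ : z₀ ∈ S) :
    ‖g z₀‖ ≤ B := by
  refine le_of_forall_pos_le_add fun ε hε => ?_
  have hev : ∀ᶠ z in nhds z₀, z ∈ S ∧ ‖g z - g z₀‖ ≤ ε := by
    have h1 := (hg.continuousAt (hS.mem_nhds hz₀)).eventually (Metric.closedBall_mem_nhds _ hε)
    filter_upwards [hS.mem_nhds hz₀, h1] with z h2 h3
    exact ⟨h2, by simpa [dist_eq_norm] using h3⟩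
  obtain ⟨δ, hδ, hball⟩ := Metric.eventually_nhds_iff_ball.1 hev
  let b : ContDiffBump z₀ := ⟨δ / 4, δ / 2, by positivity, by linarith⟩
  let φ : ℝ × ℝ → ℂ := fun z => ((b z : ℝ) : ℂ)
  have hsm : ContDiff ℝ ∞ φ := Complex.ofRealCLM.contDiff.comp b.contDiff
  have hbc : tsupport b ⊆ Metric.ball z₀ δ := by
    rw [b.tsupport_eq]
    exact Metric.closedBall_subset_ball (by change δ / 2 < δ; linarith)
  have hts : tsupport φ ⊆ tsupport b := closure_mono fun z hz hb => hz (by simp [φ, hb])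
  have hcs : HasCompactSupport φ :=
    b.hasCompactSupport.comp_left (g := fun x : ℝ => (x : ℂ)) (by simp)
  have htest : IsTest S φ := ⟨hsm, hcs, fun z hz => (hball z (hbc (hts hz))).1⟩
  have hint := integrable_mul_of_tsupport_subset hS hg htest
  have hφi : Integrable φ := hsm.continuous.integrable_of_hasCompactSupport hcs
  have hpos : 0 < ∫ z, ‖φ z‖ := by
    have : (fun z => ‖φ z‖) = b := by
      funext z
      simp [φ, abs_of_nonneg b.nonneg]
    rw [this]
    exact b.integral_pos
  have hnorm : ‖∫ z, φ z‖ = ∫ z, ‖φ z‖ := by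
    have e1 : ∫ z, φ z = ((∫ z, b z : ℝ) : ℂ) := integral_ofReal
    have e2 : (fun z => ‖φ z‖) = b := by
      funext z
      simp [φ, abs_of_nonneg b.nonneg]
    rw [e1, e2, Complex.norm_real, Real.norm_eq_abs, abs_of_pos b.integral_pos]
  have e : g z₀ * ∫ z, φ z = (∫ z, g z * φ z) - ∫ z, (g z - g z₀) * φ z := by
    simp_rw [sub_mul]
    rw [integral_sub hint (hφi.const_mul _), integral_const_mul]
    ring
  have h2 : ‖∫ z, (g z - g z₀) * φ z‖ ≤ ε * ∫ z, ‖φ z‖ := by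
    rw [← integral_const_mul]
    refine norm_integral_le_of_norm_le (hφi.norm.const_mul _) (Filter.Eventually.of_forall ?_)
    intro z
    rw [norm_mul]
    by_cases hz : z ∈ tsupport φ
    · exact mul_le_mul_of_nonneg_right (hball z (hbc (hts hz))).2 (norm_nonneg _)
    · simp [image_eq_zero_of_notMem_tsupport hz]
  have h3 : ‖g z₀‖ * ∫ z, ‖φ z‖ ≤ (B + ε) * ∫ z, ‖φ z‖ := by
    rw [← hnorm, ← norm_mul, e, hnorm, add_mul]
    exact (norm_sub_le _ _).trans (add_le_add (h φ htest) h2)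
  exact le_of_mul_le_mul_right h3 hpos

lemma tsupport_comp_sub (φ : ℝ × ℝ → ℂ) (a : ℝ × ℝ) {z : ℝ × ℝ}
    (hz : z ∈ tsupport fun z => φ (z - a)) : z - a ∈ tsupport φ := by
  have := tsupport_comp_subset_preimage φ (f := fun z : ℝ × ℝ => z - a) (by fun_prop)
  exact this hz

lemma isTest_comp_sub {S Ω : Set (ℝ × ℝ)} {φ : ℝ × ℝ → ℂ} (hφ : IsTest S φ) (a : ℝ × ℝ)
    (h : ∀ z ∈ S, z + a ∈ Ω) : IsTest Ω fun z => φ (z - a) := by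
  refine ⟨hφ.1.comp (contDiff_id.sub contDiff_const), ?_, fun z hz => ?_⟩
  · exact hφ.2.1.comp_homeomorph (Homeomorph.subRight a)
  · have := h _ (hφ.2.2 (tsupport_comp_sub φ a hz))
    rwa [sub_add_cancel] at this

/-- Consistency of the second difference quotient in the direction `v` with the second weak
derivative in that direction. -/
lemma norm_integral_second_difference_le {Ω S : Set (ℝ × ℝ)} (hΩ : volume Ω < ⊤)
    (v : ℝ × ℝ) (w : ℕ → ℝ × ℝ → ℂ) (hw : ∀ m ≤ 4, MemLp (w m) ∞ (volume.restrict Ω))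
    (hweak : ∀ m ≤ 4, ∀ φ, IsTest Ω φ →
      ∫ z in Ω, w 0 z * (dirDeriv v)^[m] φ z = (-1) ^ m * ∫ z in Ω, w m z * φ z)
    {B h : ℝ} (hB : ∀ᵐ z ∂volume.restrict Ω, ‖w 4 z‖ ≤ B) (hB0 : 0 ≤ B) (hh : 0 ≤ h)
    (hS : ∀ z ∈ S, ∀ s : ℝ, |s| ≤ h → z + s • v ∈ Ω) {φ : ℝ × ℝ → ℂ} (hφ : IsTest S φ) :
    ‖(∫ z in Ω, w 0 z * φ (z - h • v)) + (∫ z in Ω, w 0 z * φ (z - (-h) • v))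
      - 2 * (∫ z in Ω, w 0 z * φ z) - (h : ℂ) ^ 2 * ∫ z in Ω, w 2 z * φ z‖
      ≤ 2 * B * h ^ 4 * ∫ z, ‖φ z‖ := by
  have : IsFiniteMeasure (volume.restrict Ω) := ⟨by simpa using hΩ⟩
  set I := ∫ z, ‖φ z‖ with hI
  -- With all derivatives on φ, F m is differentiable with derivative F (m + 1) everywhere. For m ≤
  -- 4 and |s| ≤ h the translated φ is still a test function on Ω, and the derivatives move to w.
  let F : ℕ → ℝ → ℂ := fun m s => (-1) ^ m * ∫ z in Ω, w 0 z * (dirDeriv v)^[m] φ (z - s • v)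
  have hF : ∀ m, ∀ s : ℝ, HasDerivAt (F m) (F (m + 1) s) s := by
    intro m s
    obtain ⟨h1, h2⟩ := dirDeriv_smooth v hφ.1 hφ.2.1 m
    have := (hasDerivAt_integral_mul_translate (hw 0 (by norm_num)) h1 h2 v s).const_mul
      ((-1 : ℂ) ^ m)
    refine this.congr_deriv ?_
    simp only [F, Function.iterate_succ_apply', mul_neg, integral_neg, pow_succ]
    ring
  have htest : ∀ s : ℝ, |s| ≤ h → IsTest Ω fun z => φ (z - s • v) := fun s hs =>
    isTest_comp_sub hφ _ fun z hz => hS z hz s hs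
  have hFw : ∀ m ≤ 4, ∀ s : ℝ, |s| ≤ h → F m s = ∫ z in Ω, w m z * φ (z - s • v) := by
    intro m hm s hs
    have := hweak m hm _ (htest s hs)
    rw [dirDeriv_iterate_comp_sub] at this
    simp only [F]
    rw [this, ← mul_assoc, ← mul_pow]
    norm_num
  have hφi : Integrable fun z => ‖φ z‖ :=
    (hφ.1.continuous.integrable_of_hasCompactSupport hφ.2.1).norm
  have hF4 : ∀ s ∈ Icc (-h) h, ‖F 4 s‖ ≤ B * I := by
    intro s hs
    rw [hFw 4 le_rfl s (abs_le.2 hs)]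
    have hi : Integrable fun z => ‖φ (z - s • v)‖ := hφi.comp_sub_right (s • v)
    calc ‖∫ z in Ω, w 4 z * φ (z - s • v)‖ ≤ ∫ z in Ω, B * ‖φ (z - s • v)‖ := by
          refine norm_integral_le_of_norm_le (hi.restrict.const_mul _) ?_
          filter_upwards [hB] with z hz
          rw [norm_mul]
          gcongr
      _ = B * ∫ z in Ω, ‖φ (z - s • v)‖ := integral_const_mul _ _
      _ ≤ B * ∫ z, ‖φ (z - s • v)‖ := by
          exact mul_le_mul_of_nonneg_left
            (setIntegral_le_integral hi (Filter.Eventually.of_forall fun z => norm_nonneg _)) hB0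
      _ = B * I := by rw [integral_sub_right_eq_self (fun z => ‖φ z‖)]
  have hI0 : 0 ≤ I := integral_nonneg fun z => norm_nonneg _
  -- Fourth order expansion about 0, used at h and at −h; the odd terms cancel in the sum and leave
  -- two remainders B h⁴ ∫|φ|.
  have taylor : ∀ x ∈ Icc (-h) h, _ := fun x hx =>
    norm_taylor_four_le (convex_Icc (-h) h) (x₀ := 0) (by constructor <;> linarith)
      (mul_nonneg hB0 hI0) (fun x _ => (hF 0 x).hasDerivWithinAt)
      (fun x _ => (hF 1 x).hasDerivWithinAt) (fun x _ => (hF 2 x).hasDerivWithinAt)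
      (fun x _ => (hF 3 x).hasDerivWithinAt) hF4 hx
  have t1 := taylor h (by constructor <;> linarith)
  have t2 := taylor (-h) (by constructor <;> linarith)
  have e0 : F 0 0 = ∫ z in Ω, w 0 z * φ z := by
    rw [hFw 0 (by norm_num) 0 (by simpa using hh)]; simp
  have e2 : F 2 0 = ∫ z in Ω, w 2 z * φ z := by
    rw [hFw 2 (by norm_num) 0 (by simpa using hh)]; simp
  rw [← e0, ← e2, ← hFw 0 (by norm_num) h (by rw [abs_of_nonneg hh]),
    ← hFw 0 (by norm_num) (-h) (by rw [abs_neg, abs_of_nonneg hh])]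
  rw [sub_zero, abs_of_nonneg hh] at t1
  rw [sub_zero, abs_neg, abs_of_nonneg hh] at t2
  calc _ = ‖(F 0 h - F 0 0 - h • F 1 0 - (h ^ 2 / 2) • F 2 0 - (h ^ 3 / 6) • F 3 0)
      + (F 0 (-h) - F 0 0 - (-h) • F 1 0 - ((-h) ^ 2 / 2) • F 2 0 - ((-h) ^ 3 / 6) • F 3 0)‖ := by
        congr 1
        simp only [Complex.real_smul]
        push_cast
        ring
    _ ≤ _ := (norm_add_le _ _).trans (add_le_add t1 t2)
    _ = _ := by ring

/-! ### From bounds in `L^∞` to pointwise bounds -/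

lemma ae_norm_le_of_norm_le {Ω : Set (ℝ × ℝ)} {v : LInf Ω} {B : ℝ} (h : ‖v‖ ≤ B) :
    ∀ᵐ z ∂volume.restrict Ω, ‖v z‖ ≤ B := by
  have h1 := ae_le_eLpNormEssSup (f := v) (μ := volume.restrict Ω)
  filter_upwards [h1] with z hz
  refine le_trans ?_ h
  rw [Lp.norm_def, ← eLpNorm_exponent_top] at *
  have := ENNReal.toReal_mono (Lp.eLpNorm_ne_top v) hz
  simpa using this

/-- A set of full measure is dense, so an almost everywhere bound for a continuous function holds
throughout the closure. -/
lemma norm_le_of_continuousOn_closure {Ω : Set (ℝ × ℝ)} (hΩ : IsOpen Ω) {v : LInf Ω} {B : ℝ}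
    (h : ‖v‖ ≤ B) {g : ℝ × ℝ → ℂ} (hg : ContinuousOn g (closure Ω))
    (hv : v =ᵐ[volume.restrict Ω] g) {z : ℝ × ℝ} (hz : z ∈ closure Ω) : ‖g z‖ ≤ B := by
  have h1 : ∀ᵐ z ∂volume, z ∈ Ω → ‖g z‖ ≤ B := by
    rw [← ae_restrict_iff' hΩ.measurableSet]
    filter_upwards [ae_norm_le_of_norm_le h, hv] with z h1 h2
    rwa [← h2]
  have hd : Dense {z | z ∈ Ω → ‖g z‖ ≤ B} := Measure.dense_of_ae h1
  have hcl : closure Ω = closure (Ω ∩ {z | z ∈ Ω → ‖g z‖ ≤ B}) :=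
    (closure_minimal (hd.open_subset_closure_inter hΩ) isClosed_closure).antisymm
      (closure_mono inter_subset_left)
  rw [hcl] at hz hg
  exact le_on_closure (f := fun z => ‖g z‖) (g := fun _ => B) (fun z hz => hz.2 hz.1)
    hg.norm continuousOn_const hz

/-! ### Consistency of the five point Laplacian -/

lemma isWeakDeriv_weakD {Ω : Set (ℝ × ℝ)} {k : ℕ} (V : WInf k Ω) (p q : ℕ) (h : p + q ≤ k) :
    IsWeakDeriv Ω p q (weakD V 0 0 (Nat.zero_le k)) (weakD V p q h) :=
  V.2 ⟨(p, q), mem_multiIndices h⟩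

lemma norm_weakD_le {Ω : Set (ℝ × ℝ)} {k : ℕ} (V : WInf k Ω) (p q : ℕ) (h : p + q ≤ k) :
    ‖weakD V p q h‖ ≤ ‖V‖ :=
  norm_le_pi_norm (V : ↥(multiIndices k) → LInf Ω) ⟨(p, q), mem_multiIndices h⟩

section Laplacian

variable {Ω S : Set (ℝ × ℝ)} {V : WInf 4 Ω} {B h : ℝ} {φ : ℝ × ℝ → ℂ}

lemma norm_integral_second_difference_weakD_le_x (hΩ : volume Ω < ⊤) (hV : ‖V‖ ≤ B) (hh : 0 ≤ h)
    (hS : ∀ z ∈ S, ∀ s : ℝ, |s| ≤ h → z + s • ((1, 0) : ℝ × ℝ) ∈ Ω) (hφ : IsTest S φ) :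
    ‖(∫ z in Ω, weakD V 0 0 (by norm_num) z * φ (z - h • ((1, 0) : ℝ × ℝ)))
      + (∫ z in Ω, weakD V 0 0 (by norm_num) z * φ (z - (-h) • ((1, 0) : ℝ × ℝ)))
      - 2 * (∫ z in Ω, weakD V 0 0 (by norm_num) z * φ z)
      - (h : ℂ) ^ 2 * ∫ z in Ω, weakD V 2 0 (by norm_num) z * φ z‖
      ≤ 2 * B * h ^ 4 * ∫ z, ‖φ z‖ := by
  let w : ℕ → ℝ × ℝ → ℂ := fun m => if hm : m ≤ 4 then weakD V m 0 hm else 0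
  refine norm_integral_second_difference_le hΩ (1, 0) w (fun m hm => ?_) (fun m hm ψ hψ => ?_)
    (ae_norm_le_of_norm_le ((norm_weakD_le V 4 0 le_rfl).trans hV)) ((norm_nonneg _).trans hV)
    hh hS hφ
  · simp only [w, hm, dif_pos]
    exact Lp.memLp _
  · simp only [w, hm, dif_pos, Nat.zero_le]
    exact isWeakDeriv_weakD V m 0 hm ψ hψ

lemma norm_integral_second_difference_weakD_le_y (hΩ : volume Ω < ⊤) (hV : ‖V‖ ≤ B) (hh : 0 ≤ h)
    (hS : ∀ z ∈ S, ∀ s : ℝ, |s| ≤ h → z + s • ((0, 1) : ℝ × ℝ) ∈ Ω) (hφ : IsTest S φ) :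
    ‖(∫ z in Ω, weakD V 0 0 (by norm_num) z * φ (z - h • ((0, 1) : ℝ × ℝ)))
      + (∫ z in Ω, weakD V 0 0 (by norm_num) z * φ (z - (-h) • ((0, 1) : ℝ × ℝ)))
      - 2 * (∫ z in Ω, weakD V 0 0 (by norm_num) z * φ z)
      - (h : ℂ) ^ 2 * ∫ z in Ω, weakD V 0 2 (by norm_num) z * φ z‖
      ≤ 2 * B * h ^ 4 * ∫ z, ‖φ z‖ := by
  let w : ℕ → ℝ × ℝ → ℂ := fun m => if hm : m ≤ 4 then weakD V 0 m (by omega) else 0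
  refine norm_integral_second_difference_le hΩ (0, 1) w (fun m hm => ?_) (fun m hm ψ hψ => ?_)
    (ae_norm_le_of_norm_le ((norm_weakD_le V 0 4 le_rfl).trans hV)) ((norm_nonneg _).trans hV)
    hh hS hφ
  · simp only [w, hm, dif_pos]
    exact Lp.memLp _
  · simp only [w, hm, dif_pos, Nat.zero_le]
    have := isWeakDeriv_weakD V 0 m (by omega) ψ hψ
    have h4 : (-1 : ℂ) ^ (0 + m) = (-1) ^ m := by rw [zero_add]
    rw [h4] at this
    exact this

lemma integral_translate_mul_eq {U : ℝ × ℝ → ℂ} {v : LInf Ω}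
    (hv : v =ᵐ[volume.restrict Ω] U) (hφ : IsTest S φ) (a : ℝ × ℝ) (hS : ∀ z ∈ S, z + a ∈ Ω) :
    ∫ z, U (z + a) * φ z = ∫ z in Ω, v z * φ (z - a) := by
  have h1 : ∫ z, U (z + a) * φ z = ∫ z, U z * φ (z - a) := by
    rw [← integral_sub_right_eq_self (fun z => U (z + a) * φ z) a]
    simp only [sub_add_cancel]
  rw [h1, ← setIntegral_eq_integral_of_forall_compl_eq_zero (s := Ω) (fun z hz => ?_)]
  · refine integral_congr_ae ?_
    filter_upwards [hv] with z hz
    rw [hz]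
  · have : z ∉ tsupport fun z => φ (z - a) := fun h =>
      hz ((isTest_comp_sub hφ a hS).2.2 h)
    rw [image_eq_zero_of_notMem_tsupport (f := fun z => φ (z - a)) this, mul_zero]

/-- The residual of a semidiscrete equation, on an open set `S` whose points have their
neighbours in `Ω`. -/
lemma norm_residual_le (hΩf : volume Ω < ⊤) (hS : IsOpen S) (hV : ‖V‖ ≤ B)
    {U d g : ℝ × ℝ → ℂ} (hU : ContinuousOn U Ω) (hd : ContinuousOn d Ω) (hg : ContinuousOn g Ω)
    (hVU : weakD V 0 0 (by norm_num) =ᵐ[volume.restrict Ω] U)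
    {v' : LInf Ω} {Bt : ℝ} (hdv : ∀ᵐ z ∂volume.restrict Ω, ‖d z - v' z‖ ≤ Bt)
    (heq : ∀ᵐ z ∂volume.restrict Ω, Complex.I * v' z
      + (weakD V 2 0 (by norm_num) z + weakD V 0 2 (by norm_num) z) = g z)
    {hx hy : ℝ} (hx0 : 0 < hx) (hy0 : 0 < hy)
    (hSx : ∀ z ∈ S, ∀ s : ℝ, |s| ≤ hx → z + s • ((1, 0) : ℝ × ℝ) ∈ Ω)
    (hSy : ∀ z ∈ S, ∀ s : ℝ, |s| ≤ hy → z + s • ((0, 1) : ℝ × ℝ) ∈ Ω)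
    {z : ℝ × ℝ} (hz : z ∈ S) :
    ‖Complex.I * d z
      + ((U (z + hx • ((1, 0) : ℝ × ℝ)) - 2 * U z + U (z + (-hx) • ((1, 0) : ℝ × ℝ))) / (hx : ℂ) ^ 2
        + (U (z + hy • ((0, 1) : ℝ × ℝ)) - 2 * U z + U (z + (-hy) • ((0, 1) : ℝ × ℝ))) / (hy : ℂ) ^ 2)
      - g z‖ ≤ Bt + 2 * B * hx ^ 2 + 2 * B * hy ^ 2 := by
  have hSΩ : S ⊆ Ω := fun z hz => by simpa using hSx z hz 0 (by simpa using hx0.le)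
  have hshift : ∀ a : ℝ × ℝ, (∀ z ∈ S, z + a ∈ Ω) → ContinuousOn (fun z => U (z + a)) S :=
    fun a ha => hU.comp (by fun_prop) ha
  have hxp : ∀ z ∈ S, z + hx • ((1, 0) : ℝ × ℝ) ∈ Ω := fun z hz =>
    hSx z hz hx (by rw [abs_of_pos hx0])
  have hxm : ∀ z ∈ S, z + (-hx) • ((1, 0) : ℝ × ℝ) ∈ Ω := fun z hz =>
    hSx z hz (-hx) (by rw [abs_neg, abs_of_pos hx0])
  have hyp : ∀ z ∈ S, z + hy • ((0, 1) : ℝ × ℝ) ∈ Ω := fun z hz =>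
    hSy z hz hy (by rw [abs_of_pos hy0])
  have hym : ∀ z ∈ S, z + (-hy) • ((0, 1) : ℝ × ℝ) ∈ Ω := fun z hz =>
    hSy z hz (-hy) (by rw [abs_neg, abs_of_pos hy0])
  have cxp := hshift _ hxp
  have cxm := hshift _ hxm
  have cyp := hshift _ hyp
  have cym := hshift _ hym
  have cU := hU.mono hSΩ
  have cd := hd.mono hSΩ
  have cg := hg.mono hSΩ
  -- The equation holds almost everywhere and the fourth derivatives are weak, so the residual is
  -- estimated after testing. It is continuous, and this returns a pointwise bound.
  refine norm_le_of_forall_isTest hS (g := fun z => Complex.I * d z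
      + ((U (z + hx • ((1, 0) : ℝ × ℝ)) - 2 * U z + U (z + (-hx) • ((1, 0) : ℝ × ℝ))) / (hx : ℂ) ^ 2
        + (U (z + hy • ((0, 1) : ℝ × ℝ)) - 2 * U z + U (z + (-hy) • ((0, 1) : ℝ × ℝ)))
          / (hy : ℂ) ^ 2) - g z) ?_ (fun φ hφ => ?_) hz
  · exact ((continuousOn_const.mul cd).add
      ((((cxp.sub (continuousOn_const.mul cU)).add cxm).div_const _).add
      (((cyp.sub (continuousOn_const.mul cU)).add cym).div_const _))).sub cg
  have hφi : Integrable φ := hφ.1.continuous.integrable_of_hasCompactSupport hφ.2.1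
  have ixp := integrable_mul_of_tsupport_subset hS cxp hφ
  have ixm := integrable_mul_of_tsupport_subset hS cxm hφ
  have iyp := integrable_mul_of_tsupport_subset hS cyp hφ
  have iym := integrable_mul_of_tsupport_subset hS cym hφ
  have iU := integrable_mul_of_tsupport_subset hS cU hφ
  have id := integrable_mul_of_tsupport_subset hS cd hφ
  have ig := integrable_mul_of_tsupport_subset hS cg hφ
  have i2 : Integrable fun z => 2 * (U z * φ z) := iU.const_mul 2
  have jx : Integrable fun z => U (z + hx • ((1, 0) : ℝ × ℝ)) * φ z - 2 * (U z * φ z) :=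
    ixp.sub i2
  have jy : Integrable fun z => U (z + hy • ((0, 1) : ℝ × ℝ)) * φ z - 2 * (U z * φ z) :=
    iyp.sub i2
  have kx : Integrable fun z => (U (z + hx • ((1, 0) : ℝ × ℝ)) * φ z - 2 * (U z * φ z)
      + U (z + (-hx) • ((1, 0) : ℝ × ℝ)) * φ z) / (hx : ℂ) ^ 2 := (jx.add ixm).div_const _
  have ky : Integrable fun z => (U (z + hy • ((0, 1) : ℝ × ℝ)) * φ z - 2 * (U z * φ z)
      + U (z + (-hy) • ((0, 1) : ℝ × ℝ)) * φ z) / (hy : ℂ) ^ 2 := (jy.add iym).div_const _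
  have kxy : Integrable fun z => (U (z + hx • ((1, 0) : ℝ × ℝ)) * φ z - 2 * (U z * φ z)
      + U (z + (-hx) • ((1, 0) : ℝ × ℝ)) * φ z) / (hx : ℂ) ^ 2
      + (U (z + hy • ((0, 1) : ℝ × ℝ)) * φ z - 2 * (U z * φ z)
      + U (z + (-hy) • ((0, 1) : ℝ × ℝ)) * φ z) / (hy : ℂ) ^ 2 := kx.add ky
  have jd : Integrable fun z => Complex.I * (d z * φ z) := id.const_mul _
  have kd : Integrable fun z => Complex.I * (d z * φ z)
      + ((U (z + hx • ((1, 0) : ℝ × ℝ)) * φ z - 2 * (U z * φ z)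
      + U (z + (-hx) • ((1, 0) : ℝ × ℝ)) * φ z) / (hx : ℂ) ^ 2
      + (U (z + hy • ((0, 1) : ℝ × ℝ)) * φ z - 2 * (U z * φ z)
      + U (z + (-hy) • ((0, 1) : ℝ × ℝ)) * φ z) / (hy : ℂ) ^ 2) := jd.add kxy
  have expand : ∫ z, (Complex.I * d z
      + ((U (z + hx • ((1, 0) : ℝ × ℝ)) - 2 * U z + U (z + (-hx) • ((1, 0) : ℝ × ℝ))) / (hx : ℂ) ^ 2
        + (U (z + hy • ((0, 1) : ℝ × ℝ)) - 2 * U z + U (z + (-hy) • ((0, 1) : ℝ × ℝ)))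
          / (hy : ℂ) ^ 2) - g z) * φ z
      = Complex.I * (∫ z, d z * φ z)
        + (((∫ z, U (z + hx • ((1, 0) : ℝ × ℝ)) * φ z) - 2 * (∫ z, U z * φ z)
          + ∫ z, U (z + (-hx) • ((1, 0) : ℝ × ℝ)) * φ z) / (hx : ℂ) ^ 2
        + ((∫ z, U (z + hy • ((0, 1) : ℝ × ℝ)) * φ z) - 2 * (∫ z, U z * φ z)
          + ∫ z, U (z + (-hy) • ((0, 1) : ℝ × ℝ)) * φ z) / (hy : ℂ) ^ 2)
        - ∫ z, g z * φ z := by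
    rw [← integral_const_mul, ← integral_const_mul, ← integral_sub ixp i2, ← integral_add jx ixm,
      ← integral_sub iyp i2, ← integral_add jy iym, ← integral_div, ← integral_div,
      ← integral_add kx ky, ← integral_add jd kxy, ← integral_sub kd ig]
    congr 1
    funext z
    ring
  have hzero : ∀ z ∉ Ω, φ z = 0 := fun z hz =>
    image_eq_zero_of_notMem_tsupport fun h => hz (hSΩ (hφ.2.2 h))
  have hset : ∀ p : ℝ × ℝ → ℂ, ∫ z, p z * φ z = ∫ z in Ω, p z * φ z := fun p =>
    (setIntegral_eq_integral_of_forall_compl_eq_zero fun z hz => by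
      rw [hzero z hz, mul_zero]).symm
  have iv : ∀ v : LInf Ω, Integrable (fun z => v z * φ z) (volume.restrict Ω) := fun v =>
    integrable_mul v hφ.1 hφ.2.1
  have hgφ : ∫ z, g z * φ z = Complex.I * (∫ z in Ω, v' z * φ z)
      + ((∫ z in Ω, weakD V 2 0 (by norm_num) z * φ z)
        + ∫ z in Ω, weakD V 0 2 (by norm_num) z * φ z) := by
    have i1 : Integrable (fun z => Complex.I * (v' z * φ z)) (volume.restrict Ω) :=
      (iv v').const_mul _
    have i3 : Integrable (fun z => weakD V 2 0 (by norm_num) z * φ z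
        + weakD V 0 2 (by norm_num) z * φ z) (volume.restrict Ω) := (iv _).add (iv _)
    rw [hset, ← integral_const_mul, ← integral_add (iv _) (iv _), ← integral_add i1 i3]
    refine integral_congr_ae ?_
    filter_upwards [heq] with z hz
    rw [← hz]
    ring
  have hU0 : ∫ z, U z * φ z = ∫ z in Ω, weakD V 0 0 (by norm_num) z * φ z := by
    have := integral_translate_mul_eq hVU hφ 0 fun z hz => by rw [add_zero]; exact hSΩ hz
    simpa using this
  have hdd : ‖(∫ z, d z * φ z) - ∫ z in Ω, v' z * φ z‖ ≤ Bt * ∫ z, ‖φ z‖ := by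
    rw [hset, ← integral_sub id.restrict (iv _), ← integral_const_mul]
    have hB : ∫ z, Bt * ‖φ z‖ = ∫ z in Ω, Bt * ‖φ z‖ :=
      (setIntegral_eq_integral_of_forall_compl_eq_zero fun z hz => by
        rw [hzero z hz, norm_zero, mul_zero]).symm
    rw [hB]
    refine norm_integral_le_of_norm_le (hφi.norm.restrict.const_mul _) ?_
    filter_upwards [hdv] with z hz
    rw [← sub_mul, norm_mul]
    gcongr
  have bx := norm_integral_second_difference_weakD_le_x hΩf hV hx0.le hSx hφ
  have bY := norm_integral_second_difference_weakD_le_y hΩf hV hy0.le hSy hφ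
  rw [expand, hgφ, integral_translate_mul_eq hVU hφ _ hxp,
    integral_translate_mul_eq hVU hφ _ hxm, integral_translate_mul_eq hVU hφ _ hyp,
    integral_translate_mul_eq hVU hφ _ hym, hU0]
  generalize (∫ z in Ω, weakD V 0 0 (by norm_num) z * φ (z - hx • ((1, 0) : ℝ × ℝ))) = x₁ at *
  generalize (∫ z in Ω, weakD V 0 0 (by norm_num) z * φ (z - (-hx) • ((1, 0) : ℝ × ℝ))) = x₂ at *
  generalize (∫ z in Ω, weakD V 0 0 (by norm_num) z * φ (z - hy • ((0, 1) : ℝ × ℝ))) = y₁ at *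
  generalize (∫ z in Ω, weakD V 0 0 (by norm_num) z * φ (z - (-hy) • ((0, 1) : ℝ × ℝ))) = y₂ at *
  generalize (∫ z in Ω, weakD V 0 0 (by norm_num) z * φ z) = x₀ at *
  generalize (∫ z in Ω, weakD V 2 0 (by norm_num) z * φ z) = xx at *
  generalize (∫ z in Ω, weakD V 0 2 (by norm_num) z * φ z) = yy at *
  generalize (∫ z in Ω, v' z * φ z) = dv at *
  generalize (∫ z, d z * φ z) = dd at *
  generalize (∫ z, ‖φ z‖) = I at *
  have hxc : (hx : ℂ) ≠ 0 := by exact_mod_cast hx0.ne'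
  have hyc : (hy : ℂ) ≠ 0 := by exact_mod_cast hy0.ne'
  have e : Complex.I * dd + ((x₁ - 2 * x₀ + x₂) / (hx : ℂ) ^ 2 + (y₁ - 2 * x₀ + y₂) / (hy : ℂ) ^ 2)
      - (Complex.I * dv + (xx + yy))
      = Complex.I * (dd - dv) + (x₁ + x₂ - 2 * x₀ - (hx : ℂ) ^ 2 * xx) / (hx : ℂ) ^ 2
        + (y₁ + y₂ - 2 * x₀ - (hy : ℂ) ^ 2 * yy) / (hy : ℂ) ^ 2 := by
    field_simp
    ring
  have nx : ‖(x₁ + x₂ - 2 * x₀ - (hx : ℂ) ^ 2 * xx) / (hx : ℂ) ^ 2‖ ≤ 2 * B * hx ^ 2 * I := by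
    rw [norm_div, norm_pow, Complex.norm_real, Real.norm_eq_abs, sq_abs, div_le_iff₀ (by positivity)]
    calc _ ≤ _ := bx
      _ = _ := by ring
  have ny : ‖(y₁ + y₂ - 2 * x₀ - (hy : ℂ) ^ 2 * yy) / (hy : ℂ) ^ 2‖ ≤ 2 * B * hy ^ 2 * I := by
    rw [norm_div, norm_pow, Complex.norm_real, Real.norm_eq_abs, sq_abs, div_le_iff₀ (by positivity)]
    calc _ ≤ _ := bY
      _ = _ := by ring
  rw [e]
  have h1 := norm_add_le (Complex.I * (dd - dv)
    + (x₁ + x₂ - 2 * x₀ - (hx : ℂ) ^ 2 * xx) / (hx : ℂ) ^ 2)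
    ((y₁ + y₂ - 2 * x₀ - (hy : ℂ) ^ 2 * yy) / (hy : ℂ) ^ 2)
  have h2 := norm_add_le (Complex.I * (dd - dv))
    ((x₁ + x₂ - 2 * x₀ - (hx : ℂ) ^ 2 * xx) / (hx : ℂ) ^ 2)
  rw [norm_mul, Complex.norm_I, one_mul] at h2
  linarith

end Laplacian

/-! ### Consistency in time -/

section Time

variable {X : Type} [NormedAddCommGroup X] [NormedSpace ℝ X] {T M : ℝ} {v : ℝ → X}

lemma MemCk.hasDerivWithinAt {k : ℕ} (hT : 0 < T) (hv : MemCk k T M v) {m : ℕ} (hm : m < k) {t : ℝ}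
    (ht : t ∈ Icc 0 T) :
    HasDerivWithinAt (iteratedDerivWithin m v (Icc 0 T))
      (iteratedDerivWithin (m + 1) v (Icc 0 T) t) (Icc 0 T) t := by
  rw [iteratedDerivWithin_succ]
  exact (hv.1.differentiableOn_iteratedDerivWithin (by exact_mod_cast hm)
    (uniqueDiffOn_Icc hT) t ht).hasDerivWithinAt

variable (hT : 0 < T) (hM : 0 ≤ M) (hv : MemCk 3 T M v) {t τ : ℝ} (hτ : 0 < τ) (ht : t ≤ T)
include hT hM hv hτ ht

/-- The weights 3, −4, 1 reproduce the derivative of quadratic polynomials at t. Only the two third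
order remainders at t − τ and t − 2τ survive. -/
lemma norm_bdf2_sub_derivWithin_le (h0 : 0 ≤ t - 2 * τ) :
    ‖(3 / (2 * τ)) • v t + (-(4 / (2 * τ))) • v (t - τ) + (1 / (2 * τ)) • v (t - 2 * τ)
      - derivWithin v (Icc 0 T) t‖ ≤ 6 * M * τ ^ 2 := by
  have key : ∀ x ∈ Icc 0 T, _ := fun x hx =>
    norm_taylor_three_le (convex_Icc 0 T) (x₀ := t) ⟨by linarith, ht⟩ hM
      (fun x hx => hv.hasDerivWithinAt hT (m := 0) (by norm_num) hx)
      (fun x hx => hv.hasDerivWithinAt hT (m := 1) (by norm_num) hx)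
      (fun x hx => hv.hasDerivWithinAt hT (m := 2) (by norm_num) hx) (hv.2 3 le_rfl) hx
  have k1 := key (t - τ) ⟨by linarith, by linarith⟩
  have k2 := key (t - 2 * τ) ⟨h0, by linarith⟩
  simp only [iteratedDerivWithin_zero, zero_add, iteratedDerivWithin_one] at k1 k2
  have a1 : |t - τ - t| = τ := by rw [show t - τ - t = -τ by ring, abs_neg, abs_of_pos hτ]
  have a2 : |t - 2 * τ - t| = 2 * τ := by
    rw [show t - 2 * τ - t = -(2 * τ) by ring, abs_neg, abs_of_pos (by linarith)]
  rw [a1] at k1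
  rw [a2] at k2
  set r₁ := v (t - τ) - v t - (t - τ - t) • derivWithin v (Icc 0 T) t
    - ((t - τ - t) ^ 2 / 2) • iteratedDerivWithin (1 + 1) v (Icc 0 T) t with hr₁
  set r₂ := v (t - 2 * τ) - v t - (t - 2 * τ - t) • derivWithin v (Icc 0 T) t
    - ((t - 2 * τ - t) ^ 2 / 2) • iteratedDerivWithin (1 + 1) v (Icc 0 T) t with hr₂
  have e : (3 / (2 * τ)) • v t + (-(4 / (2 * τ))) • v (t - τ) + (1 / (2 * τ)) • v (t - 2 * τ)
      - derivWithin v (Icc 0 T) t = (-(4 / (2 * τ))) • r₁ + (1 / (2 * τ)) • r₂ := by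
    rw [hr₁, hr₂]
    match_scalars <;> field_simp <;> ring
  rw [e]
  refine (norm_add_le _ _).trans ?_
  rw [norm_smul, norm_smul, norm_neg, Real.norm_of_nonneg (by positivity),
    Real.norm_of_nonneg (by positivity)]
  calc 4 / (2 * τ) * ‖r₁‖ + 1 / (2 * τ) * ‖r₂‖
      ≤ 4 / (2 * τ) * (M * τ ^ 3) + 1 / (2 * τ) * (M * (2 * τ) ^ 3) := by gcongr
    _ = 6 * M * τ ^ 2 := by field_simp; ring

lemma norm_extrapolation_le (h0 : 0 ≤ t - 2 * τ) :
    ‖(1 : ℝ) • v t + (-2 : ℝ) • v (t - τ) + (1 : ℝ) • v (t - 2 * τ)‖ ≤ 6 * M * τ ^ 2 := by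
  have key : ∀ x ∈ Icc 0 T, _ := fun x hx =>
    norm_taylor_two_le (convex_Icc 0 T) (x₀ := t) ⟨by linarith, ht⟩ hM
      (fun x hx => hv.hasDerivWithinAt hT (m := 0) (by norm_num) hx)
      (fun x hx => hv.hasDerivWithinAt hT (m := 1) (by norm_num) hx) (hv.2 2 (by norm_num)) hx
  have k1 := key (t - τ) ⟨by linarith, by linarith⟩
  have k2 := key (t - 2 * τ) ⟨h0, by linarith⟩
  simp only [iteratedDerivWithin_zero, zero_add, iteratedDerivWithin_one] at k1 k2
  have a1 : |t - τ - t| = τ := by rw [show t - τ - t = -τ by ring, abs_neg, abs_of_pos hτ]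
  have a2 : |t - 2 * τ - t| = 2 * τ := by
    rw [show t - 2 * τ - t = -(2 * τ) by ring, abs_neg, abs_of_pos (by linarith)]
  rw [a1] at k1
  rw [a2] at k2
  set r₁ := v (t - τ) - v t - (t - τ - t) • derivWithin v (Icc 0 T) t with hr₁
  set r₂ := v (t - 2 * τ) - v t - (t - 2 * τ - t) • derivWithin v (Icc 0 T) t with hr₂
  have e : (1 : ℝ) • v t + (-2 : ℝ) • v (t - τ) + (1 : ℝ) • v (t - 2 * τ)
      = (-2 : ℝ) • r₁ + r₂ := by
    rw [hr₁, hr₂]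
    match_scalars <;> ring
  rw [e]
  refine (norm_add_le _ _).trans ?_
  rw [norm_smul, norm_neg, Real.norm_of_nonneg (by norm_num)]
  calc 2 * ‖r₁‖ + ‖r₂‖ ≤ 2 * (M * τ ^ 2) + M * (2 * τ) ^ 2 := by gcongr
    _ = 6 * M * τ ^ 2 := by ring

/-- The vacuous third summand gives BDF1 the three-term shape of BDF2, so that both use the same
consistency lemma on the grid. -/
lemma norm_bdf1_sub_derivWithin_le (h0 : 0 ≤ t - τ) :
    ‖(1 / τ) • v t + (-(1 / τ)) • v (t - τ) + (0 : ℝ) • v t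
      - derivWithin v (Icc 0 T) t‖ ≤ M * τ := by
  have k1 := norm_taylor_two_le (convex_Icc 0 T) (x₀ := t) ⟨by linarith, ht⟩ hM
      (fun x hx => hv.hasDerivWithinAt hT (m := 0) (by norm_num) hx)
      (fun x hx => hv.hasDerivWithinAt hT (m := 1) (by norm_num) hx) (hv.2 2 (by norm_num))
      (x := t - τ) ⟨h0, by linarith⟩
  simp only [iteratedDerivWithin_zero, zero_add, iteratedDerivWithin_one] at k1
  have a1 : |t - τ - t| = τ := by rw [show t - τ - t = -τ by ring, abs_neg, abs_of_pos hτ]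
  rw [a1] at k1
  set r₁ := v (t - τ) - v t - (t - τ - t) • derivWithin v (Icc 0 T) t with hr₁
  have e : (1 / τ) • v t + (-(1 / τ)) • v (t - τ) + (0 : ℝ) • v t
      - derivWithin v (Icc 0 T) t = (-(1 / τ)) • r₁ := by
    rw [hr₁]
    match_scalars <;> field_simp <;> ring
  rw [e, norm_smul, norm_neg, Real.norm_of_nonneg (by positivity)]
  calc 1 / τ * ‖r₁‖ ≤ 1 / τ * (M * τ ^ 2) := by gcongr
    _ = M * τ := by field_simp

lemma norm_backward_difference_le (h0 : 0 ≤ t - τ) :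
    ‖(1 : ℝ) • v t + (-1 : ℝ) • v (t - τ) + (0 : ℝ) • v t‖ ≤ M * τ := by
  have k1 := norm_taylor_one_le (convex_Icc 0 T) (x₀ := t) ⟨by linarith, ht⟩ hM
      (fun x hx => hv.hasDerivWithinAt hT (m := 0) (by norm_num) hx) (hv.2 1 (by norm_num))
      (x := t - τ) ⟨h0, by linarith⟩
  simp only [iteratedDerivWithin_zero] at k1
  have a1 : |t - τ - t| = τ := by rw [show t - τ - t = -τ by ring, abs_neg, abs_of_pos hτ]
  rw [a1, norm_sub_rev] at k1
  have e : (1 : ℝ) • v t + (-1 : ℝ) • v (t - τ) + (0 : ℝ) • v t = v t - v (t - τ) := by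
    match_scalars <;> ring
  rwa [e]

end Time

/-! ### Consistency on the grid -/

lemma closure_rect {a b c d : ℝ} (hab : a < b) (hcd : c < d) :
    closure (rect a b c d) = Icc a b ×ˢ Icc c d := by
  rw [rect, closure_prod_eq, closure_Ioo hab.ne, closure_Ioo hcd.ne]

lemma isOpen_rect (a b c d : ℝ) : IsOpen (rect a b c d) := isOpen_Ioo.prod isOpen_Ioo

lemma volume_rect_lt_top (a b c d : ℝ) : volume (rect a b c d) < ⊤ := by
  rw [rect, Measure.volume_eq_prod, Measure.prod_prod]
  exact ENNReal.mul_lt_top (by simp) (by simp)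

lemma node_mem {a b hx : ℝ} {J j : ℕ} (hab : a < b) (hxJ : hx = (b - a) / J)
    (hj1 : 1 ≤ j) (hjJ : j < J) : a + j * hx ∈ Icc (a + hx) (b - hx) := by
  have hJ0 : (0 : ℝ) < J := by exact_mod_cast (by omega : 0 < J)
  have hx0 : 0 < hx := hxJ ▸ div_pos (by linarith) hJ0
  have e : (J : ℝ) * hx = b - a := by rw [hxJ]; field_simp
  have h1 : (1 : ℝ) ≤ j := by exact_mod_cast hj1
  have h2 : (j : ℝ) + 1 ≤ J := by exact_mod_cast hjJ
  constructor <;> nlinarith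

lemma node_mem_Icc {a b hx : ℝ} {J j : ℕ} (hab : a < b) (hJ : 0 < J) (hxJ : hx = (b - a) / J)
    (hjJ : j ≤ J) : a + j * hx ∈ Icc a b := by
  have hJ0 : (0 : ℝ) < J := by exact_mod_cast hJ
  have hx0 : 0 < hx := hxJ ▸ div_pos (by linarith) hJ0
  have e : (J : ℝ) * hx = b - a := by rw [hxJ]; field_simp
  have h2 : (j : ℝ) ≤ J := by exact_mod_cast hjJ
  have h3 : (0 : ℝ) ≤ j := Nat.cast_nonneg j
  constructor <;> nlinarith

lemma step_lt {a b hx : ℝ} {J : ℕ} (hab : a < b) (hJ : 3 ≤ J) (hxJ : hx = (b - a) / J) :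
    a + hx < b - hx := by
  have hJ0 : (3 : ℝ) ≤ J := by exact_mod_cast hJ
  have hx0 : 0 < hx := hxJ ▸ div_pos (by linarith) (by linarith)
  have e : (J : ℝ) * hx = b - a := by rw [hxJ]; field_simp
  nlinarith

/-- The outermost interior nodes have neighbours on ∂Ω and lie on the boundary of the shrunken
rectangle S, so the bound inside S is carried to its closure by continuity. At least three cells per
direction make S nonempty. -/
lemma norm_grid_residual_le {a b c d hx hy B Bt : ℝ} {J K : ℕ} (hab : a < b) (hcd : c < d)
    (hJ : 3 ≤ J) (hK : 3 ≤ K) (hxJ : hx = (b - a) / J) (hyK : hy = (d - c) / K)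
    {V : WInf 4 (rect a b c d)} (hV : ‖V‖ ≤ B) {U D g : ℝ × ℝ → ℂ}
    (hU : ContinuousOn U (closure (rect a b c d))) (hD : ContinuousOn D (closure (rect a b c d)))
    (hg : ContinuousOn g (closure (rect a b c d)))
    (hVU : weakD V 0 0 (by norm_num) =ᵐ[volume.restrict (rect a b c d)] U)
    {v' : LInf (rect a b c d)} (hDv : ∀ᵐ z ∂volume.restrict (rect a b c d), ‖D z - v' z‖ ≤ Bt)
    (heq : ∀ᵐ z ∂volume.restrict (rect a b c d), Complex.I * v' z
      + (weakD V 2 0 (by norm_num) z + weakD V 0 2 (by norm_num) z) = g z)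
    {j k : ℕ} (hj1 : 1 ≤ j) (hjJ : j < J) (hk1 : 1 ≤ k) (hkK : k < K) :
    ‖Complex.I * gridRestrict a c hx hy D j k
      + discreteLaplacian hx hy (gridRestrict a c hx hy U) j k
      - gridRestrict a c hx hy g j k‖ ≤ Bt + 2 * B * hx ^ 2 + 2 * B * hy ^ 2 := by
  have hx0 : 0 < hx := by
    rw [hxJ]; exact div_pos (by linarith) (by exact_mod_cast (by omega : 0 < J))
  have hy0 : 0 < hy := by
    rw [hyK]; exact div_pos (by linarith) (by exact_mod_cast (by omega : 0 < K))
  have hxs := step_lt hab hJ hxJ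
  have hys := step_lt hcd hK hyK
  set Ω := rect a b c d with hΩ
  set S := rect (a + hx) (b - hx) (c + hy) (d - hy) with hSdef
  have hclΩ : closure Ω = Icc a b ×ˢ Icc c d := closure_rect hab hcd
  have hclS : closure S = Icc (a + hx) (b - hx) ×ˢ Icc (c + hy) (d - hy) := closure_rect hxs hys
  have hSx : ∀ z ∈ S, ∀ s : ℝ, |s| ≤ hx → z + s • ((1, 0) : ℝ × ℝ) ∈ Ω := by
    rintro ⟨x, y⟩ ⟨⟨h1, h2⟩, ⟨h3, h4⟩⟩ s hs
    obtain ⟨h5, h6⟩ := abs_le.1 hs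
    simp only at h1 h2 h3 h4
    refine ⟨⟨?_, ?_⟩, ⟨?_, ?_⟩⟩ <;> simp <;> linarith
  have hSy : ∀ z ∈ S, ∀ s : ℝ, |s| ≤ hy → z + s • ((0, 1) : ℝ × ℝ) ∈ Ω := by
    rintro ⟨x, y⟩ ⟨⟨h1, h2⟩, ⟨h3, h4⟩⟩ s hs
    obtain ⟨h5, h6⟩ := abs_le.1 hs
    simp only at h1 h2 h3 h4
    refine ⟨⟨?_, ?_⟩, ⟨?_, ?_⟩⟩ <;> simp <;> linarith
  have hclx : ∀ s : ℝ, |s| ≤ hx → MapsTo (fun z : ℝ × ℝ => z + s • ((1, 0) : ℝ × ℝ))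
      (closure S) (closure Ω) := fun s hs =>
    MapsTo.closure (fun z hz => hSx z hz s hs) (by fun_prop)
  have hcly : ∀ s : ℝ, |s| ≤ hy → MapsTo (fun z : ℝ × ℝ => z + s • ((0, 1) : ℝ × ℝ))
      (closure S) (closure Ω) := fun s hs =>
    MapsTo.closure (fun z hz => hSy z hz s hs) (by fun_prop)
  have hsub : closure S ⊆ closure Ω := fun z hz => by
    simpa using hclx 0 (by simpa using hx0.le) hz
  have cx : ∀ s : ℝ, |s| ≤ hx →
      ContinuousOn (fun z => U (z + s • ((1, 0) : ℝ × ℝ))) (closure S) := fun s hs =>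
    hU.comp (by fun_prop) (hclx s hs)
  have cy : ∀ s : ℝ, |s| ≤ hy →
      ContinuousOn (fun z => U (z + s • ((0, 1) : ℝ × ℝ))) (closure S) := fun s hs =>
    hU.comp (by fun_prop) (hcly s hs)
  have cU := hU.mono hsub
  have hcont : ContinuousOn (fun z => Complex.I * D z
      + ((U (z + hx • ((1, 0) : ℝ × ℝ)) - 2 * U z + U (z + (-hx) • ((1, 0) : ℝ × ℝ))) / (hx : ℂ) ^ 2
        + (U (z + hy • ((0, 1) : ℝ × ℝ)) - 2 * U z + U (z + (-hy) • ((0, 1) : ℝ × ℝ)))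
          / (hy : ℂ) ^ 2) - g z) (closure S) :=
    ((continuousOn_const.mul (hD.mono hsub)).add
      (((((cx hx (by rw [abs_of_pos hx0])).sub (continuousOn_const.mul cU)).add
        (cx (-hx) (by rw [abs_neg, abs_of_pos hx0]))).div_const _).add
      ((((cy hy (by rw [abs_of_pos hy0])).sub (continuousOn_const.mul cU)).add
        (cy (-hy) (by rw [abs_neg, abs_of_pos hy0]))).div_const _))).sub (hg.mono hsub)
  have hnode : ((a + j * hx, c + k * hy) : ℝ × ℝ) ∈ closure S := by
    rw [hclS]
    exact ⟨node_mem hab hxJ hj1 hjJ, node_mem hcd hyK hk1 hkK⟩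
  have key := le_on_closure (fun z hz => norm_residual_le
    (volume_rect_lt_top a b c d) (isOpen_rect _ _ _ _) hV (hU.mono subset_closure)
    (hD.mono subset_closure) (hg.mono subset_closure) hVU hDv heq hx0 hy0 hSx hSy hz)
    hcont.norm continuousOn_const hnode
  refine le_trans (le_of_eq (congrArg norm ?_)) key
  obtain ⟨j, rfl⟩ : ∃ i, j = i + 1 := ⟨j - 1, by omega⟩
  obtain ⟨k, rfl⟩ : ∃ i, k = i + 1 := ⟨k - 1, by omega⟩
  simp only [discreteLaplacian, gridRestrict, Prod.smul_mk, Prod.mk_add_mk, smul_eq_mul, mul_one,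
    mul_zero, add_zero, Nat.add_sub_cancel]
  push_cast
  ring_nf

/-! ### Pointwise bounds and local truncation errors of the exact solution -/

section Solution

variable {a b c d T lam M : ℝ} {u : ℝ → ℝ × ℝ → ℂ}

lemma ae_three_term {Ω : Set (ℝ × ℝ)} {v : ℝ → LInf Ω} {t₀ t₁ t₂ : ℝ}
    (h₀ : v t₀ =ᵐ[volume.restrict Ω] u t₀) (h₁ : v t₁ =ᵐ[volume.restrict Ω] u t₁)
    (h₂ : v t₂ =ᵐ[volume.restrict Ω] u t₂) (α₀ α₁ α₂ : ℝ) :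
    (α₀ • v t₀ + α₁ • v t₁ + α₂ • v t₂ : LInf Ω) =ᵐ[volume.restrict Ω]
      fun z => (α₀ : ℂ) * u t₀ z + (α₁ : ℂ) * u t₁ z + (α₂ : ℂ) * u t₂ z := by
  filter_upwards [h₀, h₁, h₂, Lp.coeFn_add (α₀ • v t₀ + α₁ • v t₁) (α₂ • v t₂),
    Lp.coeFn_add (α₀ • v t₀) (α₁ • v t₁), Lp.coeFn_smul α₀ (v t₀), Lp.coeFn_smul α₁ (v t₁),
    Lp.coeFn_smul α₂ (v t₂)] with z e₀ e₁ e₂ e₃ e₄ e₅ e₆ e₇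
  rw [e₃, Pi.add_apply, e₄, Pi.add_apply, e₅, e₆, e₇]
  simp only [Pi.smul_apply, Complex.real_smul, e₀, e₁, e₂]

lemma continuousOn_three_term {s : Set (ℝ × ℝ)} {t₀ t₁ t₂ : ℝ} (h₀ : ContinuousOn (u t₀) s)
    (h₁ : ContinuousOn (u t₁) s) (h₂ : ContinuousOn (u t₂) s) (α₀ α₁ α₂ : ℝ) :
    ContinuousOn (fun z => (α₀ : ℂ) * u t₀ z + (α₁ : ℂ) * u t₁ z + (α₂ : ℂ) * u t₂ z) s :=
  ((continuousOn_const.mul h₀).add (continuousOn_const.mul h₁)).add (continuousOn_const.mul h₂)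

lemma IsRegularSolution.norm_le (hu : IsRegularSolution (rect a b c d) T lam M u) {t : ℝ}
    (ht : t ∈ Icc 0 T) {z : ℝ × ℝ} (hz : z ∈ closure (rect a b c d)) : ‖u t z‖ ≤ M := by
  obtain ⟨hc, -, v₀, v₂, v₄, h0, -, -, hv₀, -⟩ := hu
  have := hv₀.2 0 (by norm_num) t ht
  rw [iteratedDerivWithin_zero] at this
  exact norm_le_of_continuousOn_closure (isOpen_rect a b c d) this (hc t ht) (h0 t ht) hz

lemma two_mul_f (z : ℂ) :
    2 * (lam : ℂ) * f z = (lam : ℂ) * z * (Real.log (‖z‖ ^ 2) : ℂ) := by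
  rw [f, Real.log_pow]
  push_cast
  ring

/-- Residual of the exact solution in a semidiscrete equation whose difference quotient in time
approximates the time derivative up to `Bt`. -/
lemma IsRegularSolution.norm_grid_residual_le
    (hu : IsRegularSolution (rect a b c d) T lam M u) (hab : a < b) (hcd : c < d)
    {hx hy : ℝ} {J K : ℕ} (hJ : 3 ≤ J) (hK : 3 ≤ K) (hxJ : hx = (b - a) / J)
    (hyK : hy = (d - c) / K) {t₀ t₁ t₂ : ℝ} (h₀ : t₀ ∈ Ioc 0 T) (h₁ : t₁ ∈ Icc 0 T)
    (h₂ : t₂ ∈ Icc 0 T) {α₀ α₁ α₂ Bt : ℝ}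
    (hBt : ∀ {X : Type} [NormedAddCommGroup X] [NormedSpace ℝ X] (v : ℝ → X), MemCk 3 T M v →
      ‖α₀ • v t₀ + α₁ • v t₁ + α₂ • v t₂ - derivWithin v (Icc 0 T) t₀‖ ≤ Bt)
    {j k : ℕ} (hj1 : 1 ≤ j) (hjJ : j < J) (hk1 : 1 ≤ k) (hkK : k < K) :
    ‖Complex.I * (α₀ * gridRestrict a c hx hy (u t₀) j k + α₁ * gridRestrict a c hx hy (u t₁) j k
        + α₂ * gridRestrict a c hx hy (u t₂) j k)
      + discreteLaplacian hx hy (gridRestrict a c hx hy (u t₀)) j k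
      - 2 * (lam : ℂ) * f (gridRestrict a c hx hy (u t₀) j k)‖
      ≤ Bt + 2 * M * hx ^ 2 + 2 * M * hy ^ 2 := by
  obtain ⟨hc, -, v₀, v₂, v₄, hv, -, h40, hv₀, -, hv₄, -, heq⟩ := hu
  have h₀' : t₀ ∈ Icc 0 T := ⟨h₀.1.le, h₀.2⟩
  have hV := hv₄.2 0 le_rfl t₀ h₀'
  rw [iteratedDerivWithin_zero] at hV
  have hae := ae_three_term (hv t₀ h₀') (hv t₁ h₁) (hv t₂ h₂) α₀ α₁ α₂
  refine LogSE.norm_grid_residual_le hab hcd hJ hK hxJ hyK hV (v' := derivWithin v₀ (Icc 0 T) t₀)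
    (D := fun z => (α₀ : ℂ) * u t₀ z + (α₁ : ℂ) * u t₁ z + (α₂ : ℂ) * u t₂ z)
    (g := fun z => 2 * (lam : ℂ) * f (u t₀ z)) (hc t₀ h₀')
    (continuousOn_three_term (hc t₀ h₀') (hc t₁ h₁) (hc t₂ h₂) α₀ α₁ α₂)
    (continuousOn_const.mul (continuous_f.comp_continuousOn (hc t₀ h₀')))
    (by rw [h40 t₀ h₀']; exact hv t₀ h₀') ?_ ?_ hj1 hjJ hk1 hkK
  · filter_upwards [hae, ae_norm_le_of_norm_le (hBt v₀ hv₀),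
      Lp.coeFn_sub (α₀ • v₀ t₀ + α₁ • v₀ t₁ + α₂ • v₀ t₂) (derivWithin v₀ (Icc 0 T) t₀)]
      with z h1 h2 h3
    rwa [h3, Pi.sub_apply, h1] at h2
  · filter_upwards [heq t₀ h₀] with z hz
    rw [hz, two_mul_f]

/-- The curve in L^∞ is hidden by an existential quantifier. The hypothesis `hBt` therefore asks for
the time estimate on all C³ curves with the same bound. -/
lemma IsRegularSolution.norm_three_term_le (hu : IsRegularSolution (rect a b c d) T lam M u)
    {t₀ t₁ t₂ : ℝ} (h₀ : t₀ ∈ Icc 0 T) (h₁ : t₁ ∈ Icc 0 T)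
    (h₂ : t₂ ∈ Icc 0 T) {α₀ α₁ α₂ Bt : ℝ}
    (hBt : ∀ {X : Type} [NormedAddCommGroup X] [NormedSpace ℝ X] (v : ℝ → X), MemCk 3 T M v →
      ‖α₀ • v t₀ + α₁ • v t₁ + α₂ • v t₂‖ ≤ Bt) {z : ℝ × ℝ} (hz : z ∈ closure (rect a b c d)) :
    ‖α₀ * u t₀ z + α₁ * u t₁ z + α₂ * u t₂ z‖ ≤ Bt := by
  obtain ⟨hc, -, v₀, v₂, v₄, hv, -, -, hv₀, -⟩ := hu
  exact norm_le_of_continuousOn_closure (isOpen_rect a b c d) (hBt v₀ hv₀)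
    (continuousOn_three_term (hc t₀ h₀) (hc t₁ h₁) (hc t₂ h₂) α₀ α₁ α₂)
    (ae_three_term (hv t₀ h₀) (hv t₁ h₁) (hv t₂ h₂) α₀ α₁ α₂) hz

variable (hT : 0 < T) (hM : 1 ≤ M) (hu : IsRegularSolution (rect a b c d) T lam M u)
  (hab : a < b) (hcd : c < d) {hx hy h τ t : ℝ} {J K : ℕ} (hJ : 3 ≤ J) (hK : 3 ≤ K)
  (hxJ : hx = (b - a) / J) (hyK : hy = (d - c) / K) (hh : h = max hx hy)
  (hτ : 0 < τ) (hτ1 : τ ≤ 1) (hl : 1 ≤ |Real.log τ|) (htT : t ≤ T)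
  {j k : ℕ} (hj1 : 1 ≤ j) (hjJ : j < J) (hk1 : 1 ≤ k) (hkK : k < K)
include hT hM hu hab hcd hJ hK hxJ hyK hh hτ hτ1 hl htT hj1 hjJ hk1 hkK

/-- Local truncation error of the linearized BDF2 scheme. -/
lemma norm_bdf2_truncation_le (h0 : 0 ≤ t - 2 * τ) :
    ‖Complex.I * ((3 * gridRestrict a c hx hy (u t) j k
        - 4 * gridRestrict a c hx hy (u (t - τ)) j k
        + gridRestrict a c hx hy (u (t - 2 * τ)) j k) / (2 * (τ : ℂ)))
      + discreteLaplacian hx hy (gridRestrict a c hx hy (u t)) j k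
      - 2 * (lam : ℂ) * f (2 * gridRestrict a c hx hy (u (t - τ)) j k
        - gridRestrict a c hx hy (u (t - 2 * τ)) j k)‖
      ≤ (6 * M + 132 * |lam| * M ^ 2) * (τ ^ 2 * |Real.log τ| + h ^ 2) := by
  have hM0 : 0 ≤ M := by linarith
  have h₀ : t ∈ Ioc 0 T := ⟨by linarith, htT⟩
  have h₀' : t ∈ Icc 0 T := ⟨by linarith, htT⟩
  have h₁ : t - τ ∈ Icc 0 T := ⟨by linarith, by linarith⟩
  have h₂ : t - 2 * τ ∈ Icc 0 T := ⟨by linarith, by linarith⟩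
  have r1 := hu.norm_grid_residual_le hab hcd hJ hK hxJ hyK h₀ h₁ h₂
    (fun v hv => norm_bdf2_sub_derivWithin_le hT hM0 hv hτ htT h0) hj1 hjJ hk1 hkK
  have hz : ((a + j * hx, c + k * hy) : ℝ × ℝ) ∈ closure (rect a b c d) := by
    rw [closure_rect hab hcd]
    exact ⟨node_mem_Icc hab (by omega) hxJ hjJ.le, node_mem_Icc hcd (by omega) hyK hkK.le⟩
  have r2 : ‖gridRestrict a c hx hy (u t) j k
      - (2 * gridRestrict a c hx hy (u (t - τ)) j k - gridRestrict a c hx hy (u (t - 2 * τ)) j k)‖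
      ≤ 6 * M * τ ^ 2 := by
    refine le_trans (le_of_eq (congrArg norm ?_)) (hu.norm_three_term_le h₀' h₁ h₂
      (fun v hv => norm_extrapolation_le hT hM0 hv hτ htT h0) hz)
    simp only [gridRestrict]
    push_cast
    ring
  -- The cut-off ε = τ² matches the extrapolation error, so the exchange of f(u(t)) for f at the
  -- extrapolated value costs only τ²|ln τ|.
  have r3 := norm_f_sub_le_of_norm_le (pow_pos hτ 2) (hu.norm_le h₀' hz)
    (z₂ := 2 * gridRestrict a c hx hy (u (t - τ)) j k
      - gridRestrict a c hx hy (u (t - 2 * τ)) j k)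
  change ‖f (gridRestrict a c hx hy (u t) j k) - _‖
    ≤ ‖gridRestrict a c hx hy (u t) j k - _‖ * (_ + ‖gridRestrict a c hx hy (u t) j k - _‖)
      + _ at r3
  rw [Real.log_pow, abs_mul] at r3
  simp only [Nat.cast_ofNat, Nat.abs_ofNat] at r3
  have hτM : ((τ : ℝ) : ℂ) ≠ 0 := by exact_mod_cast hτ.ne'
  generalize gridRestrict a c hx hy (u (t - τ)) j k = u₁ at *
  generalize gridRestrict a c hx hy (u (t - 2 * τ)) j k = u₂ at *
  generalize gridRestrict a c hx hy (u t) j k = u₀ at *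
  generalize discreteLaplacian hx hy (gridRestrict a c hx hy (u t)) j k = L at *
  set δ := ‖u₀ - (2 * u₁ - u₂)‖
  set l := |Real.log τ|
  have hδ0 : 0 ≤ δ := norm_nonneg _
  have hτ2 : τ ^ 2 ≤ 1 := by nlinarith
  have r4 : ‖f u₀ - f (2 * u₁ - u₂)‖ ≤ 66 * M ^ 2 * (τ ^ 2 * l) := by
    have s1 : δ * (1 + 2 * l + M + δ) ≤ (6 * M * τ ^ 2) * (l * (3 + 7 * M)) := by
      have : 1 + 2 * l + M + δ ≤ l * (3 + 7 * M) := by nlinarith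
      gcongr
    have s2 : 2 * τ ^ 2 * (1 + 2 * l) ≤ 2 * τ ^ 2 * (3 * l) := by gcongr; linarith
    have s3 : 0 ≤ τ ^ 2 * l := by positivity
    have s4 : 18 * M + 42 * M ^ 2 + 6 ≤ 66 * M ^ 2 := by nlinarith
    nlinarith
  have e : Complex.I * ((3 * u₀ - 4 * u₁ + u₂) / (2 * (τ : ℂ))) + L
      - 2 * (lam : ℂ) * f (2 * u₁ - u₂)
      = (Complex.I * (((3 / (2 * τ) : ℝ) : ℂ) * u₀ + ((-(4 / (2 * τ)) : ℝ) : ℂ) * u₁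
        + ((1 / (2 * τ) : ℝ) : ℂ) * u₂) + L - 2 * (lam : ℂ) * f u₀)
        + 2 * (lam : ℂ) * (f u₀ - f (2 * u₁ - u₂)) := by
    push_cast
    field_simp
    ring
  rw [e]
  have hhx : hx ^ 2 ≤ h ^ 2 := by
    have : 0 < hx := hxJ ▸ div_pos (by linarith) (by exact_mod_cast (by omega : 0 < J))
    have := hh ▸ le_max_left hx hy
    gcongr
  have hhy : hy ^ 2 ≤ h ^ 2 := by
    have : 0 < hy := hyK ▸ div_pos (by linarith) (by exact_mod_cast (by omega : 0 < K))
    have := hh ▸ le_max_right hx hy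
    gcongr
  calc _ ≤ (6 * M * τ ^ 2 + 2 * M * hx ^ 2 + 2 * M * hy ^ 2)
        + 2 * |lam| * (66 * M ^ 2 * (τ ^ 2 * l)) := by
        refine (norm_add_le _ _).trans (add_le_add r1 ?_)
        rw [norm_mul, norm_mul, Complex.norm_real, Real.norm_eq_abs]
        norm_num
        gcongr
    _ ≤ (6 * M * (τ ^ 2 * l) + 2 * M * h ^ 2 + 2 * M * h ^ 2)
        + 2 * |lam| * (66 * M ^ 2 * (τ ^ 2 * l)) := by
        have : τ ^ 2 ≤ τ ^ 2 * l := by nlinarith [sq_nonneg τ]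
        gcongr
    _ ≤ _ := by
        have s1 : 0 ≤ M * h ^ 2 := by positivity
        have s2 : 0 ≤ |lam| * M ^ 2 * h ^ 2 := by positivity
        nlinarith

/-- Local truncation error of the linearized BDF1 scheme. -/
lemma norm_bdf1_truncation_le (h0 : 0 ≤ t - τ) :
    τ * ‖Complex.I * ((gridRestrict a c hx hy (u t) j k
        - gridRestrict a c hx hy (u (t - τ)) j k) / (τ : ℂ))
      + discreteLaplacian hx hy (gridRestrict a c hx hy (u t)) j k
      - 2 * (lam : ℂ) * f (gridRestrict a c hx hy (u (t - τ)) j k)‖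
      ≤ (6 * M + 132 * |lam| * M ^ 2) * (τ ^ 2 * |Real.log τ| + h ^ 2) := by
  have hM0 : 0 ≤ M := by linarith
  have h₀ : t ∈ Ioc 0 T := ⟨by linarith, htT⟩
  have h₀' : t ∈ Icc 0 T := ⟨by linarith, htT⟩
  have h₁ : t - τ ∈ Icc 0 T := ⟨by linarith, by linarith⟩
  have r1 := hu.norm_grid_residual_le hab hcd hJ hK hxJ hyK h₀ h₁ h₀'
    (fun v hv => norm_bdf1_sub_derivWithin_le hT hM0 hv hτ htT h0) hj1 hjJ hk1 hkK
  have hz : ((a + j * hx, c + k * hy) : ℝ × ℝ) ∈ closure (rect a b c d) := by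
    rw [closure_rect hab hcd]
    exact ⟨node_mem_Icc hab (by omega) hxJ hjJ.le, node_mem_Icc hcd (by omega) hyK hkK.le⟩
  have r2 : ‖gridRestrict a c hx hy (u t) j k - gridRestrict a c hx hy (u (t - τ)) j k‖
      ≤ M * τ := by
    refine le_trans (le_of_eq (congrArg norm ?_)) (hu.norm_three_term_le h₀' h₁ h₀'
      (fun v hv => norm_backward_difference_le hT hM0 hv hτ htT h0) hz)
    simp only [gridRestrict]
    push_cast
    ring
  -- The cut-off ε = τ is enough here, because the residual of the first step is multiplied by
  -- another τ.
  have r3 := norm_f_sub_le_of_norm_le hτ (hu.norm_le h₀' hz)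
    (z₂ := gridRestrict a c hx hy (u (t - τ)) j k)
  change ‖f (gridRestrict a c hx hy (u t) j k) - _‖
    ≤ ‖gridRestrict a c hx hy (u t) j k - _‖ * (_ + ‖gridRestrict a c hx hy (u t) j k - _‖)
      + _ at r3
  have hτM : ((τ : ℝ) : ℂ) ≠ 0 := by exact_mod_cast hτ.ne'
  generalize gridRestrict a c hx hy (u (t - τ)) j k = u₁ at *
  generalize gridRestrict a c hx hy (u t) j k = u₀ at *
  generalize discreteLaplacian hx hy (gridRestrict a c hx hy (u t)) j k = L at *
  set δ := ‖u₀ - u₁‖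
  set l := |Real.log τ|
  have hδ0 : 0 ≤ δ := norm_nonneg _
  have r4 : ‖f u₀ - f u₁‖ ≤ 8 * M ^ 2 * (τ * l) := by
    have s1 : δ * (1 + l + M + δ) ≤ (M * τ) * (l * (2 + 2 * M)) := by
      have : 1 + l + M + δ ≤ l * (2 + 2 * M) := by nlinarith
      gcongr
    have s2 : 2 * τ * (1 + l) ≤ 2 * τ * (2 * l) := by gcongr; linarith
    have s3 : 0 ≤ τ * l := by positivity
    have s4 : 2 * M + 2 * M ^ 2 + 4 ≤ 8 * M ^ 2 := by nlinarith
    nlinarith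
  have e : Complex.I * ((u₀ - u₁) / (τ : ℂ)) + L - 2 * (lam : ℂ) * f u₁
      = (Complex.I * (((1 / τ : ℝ) : ℂ) * u₀ + ((-(1 / τ) : ℝ) : ℂ) * u₁
        + ((0 : ℝ) : ℂ) * u₀) + L - 2 * (lam : ℂ) * f u₀)
        + 2 * (lam : ℂ) * (f u₀ - f u₁) := by
    push_cast
    field_simp
    ring
  rw [e]
  have hhx : hx ^ 2 ≤ h ^ 2 := by
    have : 0 < hx := hxJ ▸ div_pos (by linarith) (by exact_mod_cast (by omega : 0 < J))
    have := hh ▸ le_max_left hx hy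
    gcongr
  have hhy : hy ^ 2 ≤ h ^ 2 := by
    have : 0 < hy := hyK ▸ div_pos (by linarith) (by exact_mod_cast (by omega : 0 < K))
    have := hh ▸ le_max_right hx hy
    gcongr
  calc _ ≤ τ * ((M * τ + 2 * M * hx ^ 2 + 2 * M * hy ^ 2)
        + 2 * |lam| * (8 * M ^ 2 * (τ * l))) := by
        refine mul_le_mul_of_nonneg_left ((norm_add_le _ _).trans (add_le_add r1 ?_)) hτ.le
        rw [norm_mul, norm_mul, Complex.norm_real, Real.norm_eq_abs]
        norm_num
        gcongr
    _ ≤ τ * ((M * (τ * l) + 2 * M * h ^ 2 + 2 * M * h ^ 2)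
        + 2 * |lam| * (8 * M ^ 2 * (τ * l))) := by
        have : τ ≤ τ * l := by nlinarith
        gcongr
    _ = (M + 16 * |lam| * M ^ 2) * (τ ^ 2 * l) + τ * (4 * M * h ^ 2) := by ring
    _ ≤ (M + 16 * |lam| * M ^ 2) * (τ ^ 2 * l) + 1 * (4 * M * h ^ 2) := by gcongr
    _ ≤ _ := by
        have s1 : 0 ≤ M * h ^ 2 := by positivity
        have s2 : 0 ≤ |lam| * M ^ 2 * h ^ 2 := by positivity
        have s3 : 0 ≤ |lam| * M ^ 2 * (τ ^ 2 * l) := by positivity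
        have s4 : 0 ≤ M * (τ ^ 2 * l) := by positivity
        nlinarith

end Solution

/-! ### Grid functions as vectors of a Hilbert space -/

/-- The interior nodes. -/
abbrev interiorNodes (J K : ℕ) : Finset (ℕ × ℕ) := Finset.Ico 1 J ×ˢ Finset.Ico 1 K

/-- The interior values of a grid function, scaled such that the Euclidean norm is the discrete
`L²` norm. -/
noncomputable def gridVec (J K : ℕ) (hx hy : ℝ) :
    (ℕ → ℕ → ℂ) →ₗ[ℂ] EuclideanSpace ℂ ↥(interiorNodes J K) where
  toFun w := WithLp.toLp 2 fun p => (Real.sqrt (hx * hy) : ℂ) * w p.1.1 p.1.2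
  map_add' v w := by ext p; simp [mul_add]
  map_smul' r w := by ext p; simp [mul_left_comm]

/-- The square of the discrete `H¹` seminorm. -/
noncomputable def h1Sq (J K : ℕ) (hx hy : ℝ) (w : ℕ → ℕ → ℂ) : ℝ :=
  hx * hy * ∑ j ∈ Finset.range J, ∑ k ∈ Finset.range K, ‖(w (j + 1) k - w j k) / (hx : ℂ)‖ ^ 2
    + hx * hy * ∑ j ∈ Finset.range J, ∑ k ∈ Finset.range K, ‖(w j (k + 1) - w j k) / (hy : ℂ)‖ ^ 2

section Grid

variable {J K : ℕ} {hx hy : ℝ} {v w : ℕ → ℕ → ℂ}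

lemma gridVec_apply (p : ↥(interiorNodes J K)) :
    gridVec J K hx hy w p = (Real.sqrt (hx * hy) : ℂ) * w p.1.1 p.1.2 := rfl

lemma mem_interiorNodes {j k : ℕ} :
    (j, k) ∈ interiorNodes J K ↔ (1 ≤ j ∧ j < J) ∧ 1 ≤ k ∧ k < K := by
  simp [interiorNodes]

lemma gridVec_congr (h : ∀ j k, 1 ≤ j → j < J → 1 ≤ k → k < K → v j k = w j k) :
    gridVec J K hx hy v = gridVec J K hx hy w := by
  ext ⟨⟨j, k⟩, hp⟩
  obtain ⟨⟨h1, h2⟩, h3, h4⟩ := mem_interiorNodes.1 hp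
  rw [gridVec_apply, gridVec_apply, h j k h1 h2 h3 h4]

lemma norm_gridVec_eq_zero (h : ∀ j ≤ J, ∀ k ≤ K, w j k = 0) : ‖gridVec J K hx hy w‖ = 0 := by
  rw [norm_eq_zero, ← map_zero (gridVec J K hx hy)]
  exact gridVec_congr fun j k _ h2 _ h4 => h j h2.le k h4.le

lemma h1Sq_eq_zero (h : ∀ j ≤ J, ∀ k ≤ K, w j k = 0) : h1Sq J K hx hy w = 0 := by
  unfold h1Sq
  rw [Finset.sum_eq_zero, Finset.sum_eq_zero]
  · ring
  all_goals
    refine fun j hj => Finset.sum_eq_zero fun k hk => ?_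
    have h1 := Finset.mem_range.1 hj
    have h2 := Finset.mem_range.1 hk
    rw [h j h1.le k h2.le]
  · rw [h j h1.le (k + 1) h2]; simp
  · rw [h (j + 1) h1 k h2.le]; simp

lemma h1Seminorm_eq : h1Seminorm J K hx hy w = Real.sqrt (h1Sq J K hx hy w) := rfl

lemma inner_gridVec (hx0 : 0 < hx) (hy0 : 0 < hy) :
    inner ℂ (gridVec J K hx hy v) (gridVec J K hx hy w)
      = (hx * hy : ℝ) * ∑ p ∈ interiorNodes J K, (starRingEnd ℂ) (v p.1 p.2) * w p.1 p.2 := by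
  rw [PiLp.inner_apply, ← Finset.sum_coe_sort (interiorNodes J K), Finset.mul_sum]
  refine Finset.sum_congr rfl fun p _ => ?_
  rw [gridVec_apply, gridVec_apply, RCLike.inner_apply, map_mul, Complex.conj_ofReal]
  have : ((hx * hy : ℝ) : ℂ) = (Real.sqrt (hx * hy) : ℂ) * (Real.sqrt (hx * hy) : ℂ) := by
    rw [← Complex.ofReal_mul, Real.mul_self_sqrt (by positivity)]
  rw [this]
  ring

lemma norm_gridVec_sq (hx0 : 0 < hx) (hy0 : 0 < hy) :
    ‖gridVec J K hx hy w‖ ^ 2 = hx * hy * ∑ p ∈ interiorNodes J K, ‖w p.1 p.2‖ ^ 2 := by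
  rw [EuclideanSpace.norm_sq_eq,
    ← Finset.sum_coe_sort (interiorNodes J K) (fun p => ‖w p.1 p.2‖ ^ 2), Finset.mul_sum]
  refine Finset.sum_congr rfl fun p _ => ?_
  rw [gridVec_apply, norm_mul, mul_pow, Complex.norm_real, Real.norm_eq_abs, sq_abs,
    Real.sq_sqrt (by positivity)]

lemma l2Norm_eq (hx0 : 0 < hx) (hy0 : 0 < hy) :
    l2Norm J K hx hy w = ‖gridVec J K hx hy w‖ := by
  rw [l2Norm, ← Finset.sum_product', ← norm_gridVec_sq hx0 hy0, Real.sqrt_sq (norm_nonneg _)]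

lemma norm_gridVec_le_of_norm_le (hx0 : 0 < hx) (hy0 : 0 < hy)
    (h : ∀ j k, 1 ≤ j → j < J → 1 ≤ k → k < K → ‖v j k‖ ≤ ‖w j k‖) :
    ‖gridVec J K hx hy v‖ ≤ ‖gridVec J K hx hy w‖ := by
  rw [← sq_le_sq₀ (norm_nonneg _) (norm_nonneg _), norm_gridVec_sq hx0 hy0,
    norm_gridVec_sq hx0 hy0]
  gcongr with p hp
  obtain ⟨⟨h1, h2⟩, h3, h4⟩ := mem_interiorNodes.1 hp
  exact h _ _ h1 h2 h3 h4

lemma norm_gridVec_const_le (hx0 : 0 < hx) (hy0 : 0 < hy) {β : ℝ} (hβ : 0 ≤ β) :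
    ‖gridVec J K hx hy fun _ _ => (β : ℂ)‖ ≤ β * Real.sqrt ((J * hx) * (K * hy)) := by
  rw [← sq_le_sq₀ (norm_nonneg _) (by positivity), norm_gridVec_sq hx0 hy0, mul_pow,
    Real.sq_sqrt (by positivity)]
  simp only [Complex.norm_real, Real.norm_eq_abs, sq_abs, Finset.sum_const, nsmul_eq_mul,
    Finset.card_product, Nat.card_Ico]
  push_cast
  have h1 : ((J - 1 : ℕ) : ℝ) ≤ J := by exact_mod_cast Nat.sub_le _ _
  have h2 : ((K - 1 : ℕ) : ℝ) ≤ K := by exact_mod_cast Nat.sub_le _ _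
  calc hx * hy * (((J - 1 : ℕ) : ℝ) * ((K - 1 : ℕ) : ℝ) * β ^ 2) ≤ hx * hy * (J * K * β ^ 2) := by
        gcongr
    _ = _ := by ring

lemma abs_im_inner_gridVec_le (hx0 : 0 < hx) (hy0 : 0 < hy)
    (h : ∀ j k, |((starRingEnd ℂ) (v j k) * w j k).im| ≤ ‖v j k‖ ^ 2) :
    |(inner ℂ (gridVec J K hx hy v) (gridVec J K hx hy w)).im| ≤ ‖gridVec J K hx hy v‖ ^ 2 := by
  rw [inner_gridVec hx0 hy0, norm_gridVec_sq hx0 hy0, Complex.im_ofReal_mul, abs_mul,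
    abs_of_pos (by positivity), Complex.im_sum]
  gcongr
  exact (Finset.abs_sum_le_sum_abs _ _).trans (Finset.sum_le_sum fun p _ => h _ _)

/-! ### Summation by parts -/

/-- The boundary terms are kept so that induction on n applies; they vanish for grid functions that
are zero at both ends. -/
lemma sum_conj_mul_second_difference (z : ℕ → ℂ) (n : ℕ) :
    ∑ j ∈ Finset.Ico 1 (n + 1), (starRingEnd ℂ) (z j) * (z (j + 1) - 2 * z j + z (j - 1))
      = (starRingEnd ℂ) (z (n + 1)) * (z (n + 1) - z n) - (starRingEnd ℂ) (z 0) * (z 1 - z 0)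
        - ((∑ j ∈ Finset.range (n + 1), ‖z (j + 1) - z j‖ ^ 2 : ℝ) : ℂ) := by
  have hsq : ∀ x : ℂ, ((‖x‖ ^ 2 : ℝ) : ℂ) = (starRingEnd ℂ) x * x := fun x => by
    rw [Complex.conj_mul', Complex.ofReal_pow]
  induction n with
  | zero =>
    rw [Finset.sum_range_one, hsq]
    simp
    ring
  | succ n ih =>
    rw [Finset.sum_Ico_succ_top (by omega), ih, Finset.sum_range_succ _ (n + 1), Complex.ofReal_add,
      hsq, Nat.add_sub_cancel, map_sub]
    ring

lemma sum_conj_mul_second_difference_of_eq_zero {z : ℕ → ℂ} {n : ℕ} (hn : 0 < n) (h0 : z 0 = 0)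
    (h1 : z n = 0) :
    ∑ j ∈ Finset.Ico 1 n, (starRingEnd ℂ) (z j) * (z (j + 1) - 2 * z j + z (j - 1))
      = -((∑ j ∈ Finset.range n, ‖z (j + 1) - z j‖ ^ 2 : ℝ) : ℂ) := by
  obtain ⟨n, rfl⟩ : ∃ i, n = i + 1 := ⟨n - 1, by omega⟩
  rw [sum_conj_mul_second_difference, h0, h1]
  simp

lemma sum_range_eq_sum_Ico_one {M : Type*} [AddCommMonoid M] {F : ℕ → M} {n : ℕ} (hn : 0 < n)
    (h0 : F 0 = 0) : ∑ j ∈ Finset.range n, F j = ∑ j ∈ Finset.Ico 1 n, F j := by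
  rw [Finset.range_eq_Ico, Finset.sum_eq_sum_Ico_succ_bot hn, h0, zero_add]

/-- Differences taken along a boundary line vanish, so each double sum runs over interior lines
only, as summation by parts requires. -/
lemma h1Sq_eq (hJ : 0 < J) (hK : 0 < K)
    (hw : VanishesOnBoundary J K w) :
    h1Sq J K hx hy w
      = hx * hy * ((∑ k ∈ Finset.Ico 1 K, ∑ j ∈ Finset.range J, ‖w (j + 1) k - w j k‖ ^ 2) / hx ^ 2)
      + hx * hy * ((∑ j ∈ Finset.Ico 1 J, ∑ k ∈ Finset.range K, ‖w j (k + 1) - w j k‖ ^ 2)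
        / hy ^ 2) := by
  have h1 : ∑ k ∈ Finset.range K, ∑ j ∈ Finset.range J, ‖w (j + 1) k - w j k‖ ^ 2
      = ∑ k ∈ Finset.Ico 1 K, ∑ j ∈ Finset.range J, ‖w (j + 1) k - w j k‖ ^ 2 := by
    refine sum_range_eq_sum_Ico_one hK (Finset.sum_eq_zero fun j hj => ?_)
    have := Finset.mem_range.1 hj
    rw [hw (j + 1) (by omega) 0 (by omega) (by simp), hw j (by omega) 0 (by omega) (by simp)]
    simp
  have h2 : ∑ j ∈ Finset.range J, ∑ k ∈ Finset.range K, ‖w j (k + 1) - w j k‖ ^ 2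
      = ∑ j ∈ Finset.Ico 1 J, ∑ k ∈ Finset.range K, ‖w j (k + 1) - w j k‖ ^ 2 := by
    refine sum_range_eq_sum_Ico_one hJ (Finset.sum_eq_zero fun k hk => ?_)
    have := Finset.mem_range.1 hk
    rw [hw 0 (by omega) (k + 1) (by omega) (by simp), hw 0 (by omega) k (by omega) (by simp)]
    simp
  rw [h1Sq, ← h1, ← h2, Finset.sum_comm (s := Finset.range K)]
  simp only [norm_div, div_pow, Complex.norm_real, Real.norm_eq_abs, sq_abs, Finset.sum_div]

/-- Discrete Green formula. Because the value is real, the Laplacian disappears from one part of the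
tested equation and yields the H¹ seminorm in the other. -/
lemma inner_discreteLaplacian (hx0 : 0 < hx) (hy0 : 0 < hy) (hJ : 0 < J) (hK : 0 < K)
    (hw : VanishesOnBoundary J K w) :
    inner ℂ (gridVec J K hx hy w) (gridVec J K hx hy (discreteLaplacian hx hy w))
      = -((h1Sq J K hx hy w : ℝ) : ℂ) := by
  have hX : ∑ k ∈ Finset.Ico 1 K, ∑ j ∈ Finset.Ico 1 J,
      (starRingEnd ℂ) (w j k) * (w (j + 1) k - 2 * w j k + w (j - 1) k)
      = -((∑ k ∈ Finset.Ico 1 K, ∑ j ∈ Finset.range J, ‖w (j + 1) k - w j k‖ ^ 2 : ℝ) : ℂ) := by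
    rw [Complex.ofReal_sum, ← Finset.sum_neg_distrib]
    refine Finset.sum_congr rfl fun k hk => ?_
    have := Finset.mem_Ico.1 hk
    exact sum_conj_mul_second_difference_of_eq_zero (z := fun j => w j k) hJ
      (hw 0 (by omega) k (by omega) (by simp)) (hw J le_rfl k (by omega) (by simp))
  have hY : ∑ j ∈ Finset.Ico 1 J, ∑ k ∈ Finset.Ico 1 K,
      (starRingEnd ℂ) (w j k) * (w j (k + 1) - 2 * w j k + w j (k - 1))
      = -((∑ j ∈ Finset.Ico 1 J, ∑ k ∈ Finset.range K, ‖w j (k + 1) - w j k‖ ^ 2 : ℝ) : ℂ) := by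
    rw [Complex.ofReal_sum, ← Finset.sum_neg_distrib]
    refine Finset.sum_congr rfl fun j hj => ?_
    have := Finset.mem_Ico.1 hj
    exact sum_conj_mul_second_difference_of_eq_zero (z := fun k => w j k) hK
      (hw j (by omega) 0 (by omega) (by simp)) (hw j (by omega) K le_rfl (by simp))
  rw [inner_gridVec hx0 hy0, h1Sq_eq hJ hK hw]
  have e : ∑ p ∈ interiorNodes J K, (starRingEnd ℂ) (w p.1 p.2) * discreteLaplacian hx hy w p.1 p.2
      = (∑ k ∈ Finset.Ico 1 K, ∑ j ∈ Finset.Ico 1 J,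
          (starRingEnd ℂ) (w j k) * (w (j + 1) k - 2 * w j k + w (j - 1) k)) / (hx : ℂ) ^ 2
        + (∑ j ∈ Finset.Ico 1 J, ∑ k ∈ Finset.Ico 1 K,
          (starRingEnd ℂ) (w j k) * (w j (k + 1) - 2 * w j k + w j (k - 1))) / (hy : ℂ) ^ 2 := by
    rw [interiorNodes, Finset.sum_product, Finset.sum_comm (s := Finset.Ico 1 K), Finset.sum_div,
      Finset.sum_div, ← Finset.sum_add_distrib]
    refine Finset.sum_congr rfl fun j _ => ?_
    rw [Finset.sum_div, Finset.sum_div, ← Finset.sum_add_distrib]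
    refine Finset.sum_congr rfl fun k _ => ?_
    rw [discreteLaplacian]
    ring
  rw [e, hX, hY]
  push_cast
  ring

lemma h1Sq_extrapolation_le (hx0 : 0 < hx) (hy0 : 0 < hy) :
    h1Sq J K hx hy ((2 : ℂ) • v - w) ≤ 8 * h1Sq J K hx hy v + 2 * h1Sq J K hx hy w := by
  have hz : ∀ p q : ℂ, ‖2 * p - q‖ ^ 2 ≤ 8 * ‖p‖ ^ 2 + 2 * ‖q‖ ^ 2 := fun p q => by
    have := norm_sub_le (2 * p) q
    rw [norm_mul, Complex.norm_ofNat] at this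
    nlinarith [norm_nonneg (2 * p - q), norm_nonneg p, norm_nonneg q, sq_nonneg (2 * ‖p‖ - ‖q‖)]
  have key : ∀ (s : ℝ) (F G H : ℕ → ℕ → ℂ), 0 ≤ s → (∀ j k, H j k = 2 * F j k - G j k) →
      s * ∑ j ∈ Finset.range J, ∑ k ∈ Finset.range K, ‖H j k‖ ^ 2
      ≤ 8 * (s * ∑ j ∈ Finset.range J, ∑ k ∈ Finset.range K, ‖F j k‖ ^ 2)
        + 2 * (s * ∑ j ∈ Finset.range J, ∑ k ∈ Finset.range K, ‖G j k‖ ^ 2) := by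
    intro s F G H hs h
    have : ∑ j ∈ Finset.range J, ∑ k ∈ Finset.range K, ‖H j k‖ ^ 2
        ≤ 8 * (∑ j ∈ Finset.range J, ∑ k ∈ Finset.range K, ‖F j k‖ ^ 2)
        + 2 * (∑ j ∈ Finset.range J, ∑ k ∈ Finset.range K, ‖G j k‖ ^ 2) := by
      simp only [Finset.mul_sum, ← Finset.sum_add_distrib]
      gcongr with j _ k _
      rw [h]
      exact hz _ _
    nlinarith
  have h1 := key (hx * hy) (fun j k => (v (j + 1) k - v j k) / (hx : ℂ))
    (fun j k => (w (j + 1) k - w j k) / (hx : ℂ))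
    (fun j k => (((2 : ℂ) • v - w) (j + 1) k - ((2 : ℂ) • v - w) j k) / (hx : ℂ)) (by positivity)
    (fun j k => by simp; ring)
  have h2 := key (hx * hy) (fun j k => (v j (k + 1) - v j k) / (hy : ℂ))
    (fun j k => (w j (k + 1) - w j k) / (hy : ℂ))
    (fun j k => (((2 : ℂ) • v - w) j (k + 1) - ((2 : ℂ) • v - w) j k) / (hy : ℂ)) (by positivity)
    (fun j k => by simp; ring)
  unfold h1Sq
  linarith

/-! ### Discrete `L⁴` estimates -/

/-- The inverse estimate for the `L⁴` norm. -/
lemma norm_gridVec_norm_sq_le_of_inverse (hx0 : 0 < hx) (hy0 : 0 < hy) :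
    hx * hy * ‖gridVec J K hx hy fun j k => ((‖w j k‖ ^ 2 : ℝ) : ℂ)‖ ^ 2
      ≤ ‖gridVec J K hx hy w‖ ^ 4 := by
  have e : ‖gridVec J K hx hy w‖ ^ 4 = (‖gridVec J K hx hy w‖ ^ 2) ^ 2 := by ring
  rw [e, norm_gridVec_sq hx0 hy0, norm_gridVec_sq hx0 hy0, mul_pow, ← mul_assoc, ← sq]
  refine mul_le_mul_of_nonneg_left ?_ (by positivity)
  simp only [Complex.norm_real, norm_pow, norm_norm]
  rw [sq (∑ p ∈ interiorNodes J K, ‖w p.1 p.2‖ ^ 2), Finset.sum_mul]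
  refine Finset.sum_le_sum fun p hp => ?_
  rw [sq (‖w p.1 p.2‖ ^ 2)]
  gcongr
  exact Finset.single_le_sum (f := fun p : ℕ × ℕ => ‖w p.1 p.2‖ ^ 2)
    (fun p _ => by positivity) hp

/-- Telescoping of |z|² from the zero boundary value. The right side does not depend on j, so it
controls the maximum along a grid line. -/
lemma norm_sq_le_sum_difference {z : ℕ → ℂ} (h0 : z 0 = 0) {n j : ℕ} (hj : j ≤ n) :
    ‖z j‖ ^ 2 ≤ ∑ i ∈ Finset.range n, ‖z (i + 1) - z i‖ * (‖z (i + 1)‖ + ‖z i‖) := by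
  have h1 : ‖z j‖ ^ 2 ≤ ∑ i ∈ Finset.range j, ‖z (i + 1) - z i‖ * (‖z (i + 1)‖ + ‖z i‖) := by
    have e := Finset.sum_range_sub (fun i => ‖z i‖ ^ 2) j
    rw [h0, norm_zero, zero_pow two_ne_zero, sub_zero] at e
    rw [← e]
    refine Finset.sum_le_sum fun i _ => ?_
    have := norm_sub_norm_le (z (i + 1)) (z i)
    nlinarith [norm_nonneg (z (i + 1)), norm_nonneg (z i)]
  exact h1.trans (Finset.sum_le_sum_of_subset_of_nonneg (Finset.range_mono hj)
    fun i _ _ => by positivity)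

lemma sum_sq_norm_add_le {z : ℕ → ℂ} {n : ℕ} (h0 : z 0 = 0) (h1 : z n = 0) (hn : 0 < n) :
    ∑ i ∈ Finset.range n, (‖z (i + 1)‖ + ‖z i‖) ^ 2 ≤ 4 * ∑ i ∈ Finset.Ico 1 n, ‖z i‖ ^ 2 := by
  have e0 : ∑ i ∈ Finset.range n, ‖z i‖ ^ 2 = ∑ i ∈ Finset.Ico 1 n, ‖z i‖ ^ 2 :=
    sum_range_eq_sum_Ico_one hn (by simp [h0])
  have e1 : ∑ i ∈ Finset.range n, ‖z (i + 1)‖ ^ 2 = ∑ i ∈ Finset.Ico 1 n, ‖z i‖ ^ 2 := by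
    rw [← e0]
    have h2 := Finset.sum_range_succ (fun i => ‖z i‖ ^ 2) n
    have h3 := Finset.sum_range_succ' (fun i => ‖z i‖ ^ 2) n
    simp only [h0, h1, norm_zero, ne_eq, OfNat.ofNat_ne_zero, not_false_eq_true, zero_pow,
      add_zero] at h2 h3
    rw [← h2, h3]
  calc _ ≤ ∑ i ∈ Finset.range n, (2 * ‖z (i + 1)‖ ^ 2 + 2 * ‖z i‖ ^ 2) := by
        refine Finset.sum_le_sum fun i _ => ?_
        nlinarith [sq_nonneg (‖z (i + 1)‖ - ‖z i‖)]
    _ = _ := by rw [Finset.sum_add_distrib, ← Finset.mul_sum, ← Finset.mul_sum, e0, e1]; ring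

/-- A sum of the squared maxima along the lines, in the form needed for Ladyzhenskaya's
inequality. -/
lemma sq_sum_sum_difference_le {z : ℕ → ℕ → ℂ} {m n : ℕ} (hn : 0 < n)
    (h0 : ∀ k ∈ Finset.Ico 1 m, z k 0 = 0) (h1 : ∀ k ∈ Finset.Ico 1 m, z k n = 0) :
    (∑ k ∈ Finset.Ico 1 m, ∑ i ∈ Finset.range n,
        ‖z k (i + 1) - z k i‖ * (‖z k (i + 1)‖ + ‖z k i‖)) ^ 2
      ≤ (∑ k ∈ Finset.Ico 1 m, ∑ i ∈ Finset.range n, ‖z k (i + 1) - z k i‖ ^ 2)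
        * (4 * ∑ k ∈ Finset.Ico 1 m, ∑ i ∈ Finset.Ico 1 n, ‖z k i‖ ^ 2) := by
  have hCS := Finset.sum_mul_sq_le_sq_mul_sq (Finset.Ico 1 m ×ˢ Finset.range n)
    (fun p : ℕ × ℕ => ‖z p.1 (p.2 + 1) - z p.1 p.2‖)
    (fun p : ℕ × ℕ => ‖z p.1 (p.2 + 1)‖ + ‖z p.1 p.2‖)
  simp only [Finset.sum_product] at hCS
  refine hCS.trans (mul_le_mul_of_nonneg_left ?_ (by positivity))
  rw [Finset.mul_sum]
  exact Finset.sum_le_sum fun k hk => sum_sq_norm_add_le (h0 k hk) (h1 k hk) hn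

/-- The discrete Ladyzhenskaya inequality. -/
lemma norm_gridVec_norm_sq_le_of_h1Sq (hx0 : 0 < hx) (hy0 : 0 < hy) (hJ : 0 < J) (hK : 0 < K)
    (hw : VanishesOnBoundary J K w) :
    ‖gridVec J K hx hy fun j k => ((‖w j k‖ ^ 2 : ℝ) : ℂ)‖ ^ 2
      ≤ 2 * ‖gridVec J K hx hy w‖ ^ 2 * h1Sq J K hx hy w := by
  rw [norm_gridVec_sq hx0 hy0, norm_gridVec_sq hx0 hy0, h1Sq_eq hJ hK hw]
  have hX := sq_sum_sum_difference_le (z := fun k j => w j k) (m := K) (n := J) hJ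
    (fun k hk => hw 0 (by omega) k (Finset.mem_Ico.1 hk).2.le (by simp))
    (fun k hk => hw J le_rfl k (Finset.mem_Ico.1 hk).2.le (by simp))
  have hY := sq_sum_sum_difference_le (z := w) (m := J) (n := K) hK
    (fun j hj => hw j (Finset.mem_Ico.1 hj).2.le 0 (by omega) (by simp))
    (fun j hj => hw j (Finset.mem_Ico.1 hj).2.le K le_rfl (by simp))
  have hS : ∑ k ∈ Finset.Ico 1 K, ∑ j ∈ Finset.Ico 1 J, ‖w j k‖ ^ 2
      = ∑ p ∈ interiorNodes J K, ‖w p.1 p.2‖ ^ 2 := by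
    rw [Finset.sum_comm, ← Finset.sum_product']
  have hS' : ∑ j ∈ Finset.Ico 1 J, ∑ k ∈ Finset.Ico 1 K, ‖w j k‖ ^ 2
      = ∑ p ∈ interiorNodes J K, ‖w p.1 p.2‖ ^ 2 := by
    rw [← Finset.sum_product']
  rw [hS] at hX
  rw [hS'] at hY
  -- One factor |w|² is bounded by its line in the x-direction, the other by its line in the
  -- y-direction; the double sum of the product then factorizes.
  have hQ : ∑ p ∈ interiorNodes J K, ‖(((‖w p.1 p.2‖ ^ 2 : ℝ)) : ℂ)‖ ^ 2
      ≤ (∑ k ∈ Finset.Ico 1 K, ∑ i ∈ Finset.range J,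
          ‖w (i + 1) k - w i k‖ * (‖w (i + 1) k‖ + ‖w i k‖))
        * ∑ j ∈ Finset.Ico 1 J, ∑ i ∈ Finset.range K,
          ‖w j (i + 1) - w j i‖ * (‖w j (i + 1)‖ + ‖w j i‖) := by
    rw [Finset.sum_mul_sum, Finset.sum_comm, ← Finset.sum_product']
    refine Finset.sum_le_sum fun p hp => ?_
    obtain ⟨⟨h1, h2⟩, h3, h4⟩ := mem_interiorNodes.1 hp
    rw [Complex.norm_real, norm_pow, norm_norm, sq]
    exact mul_le_mul
      (norm_sq_le_sum_difference (z := fun j => w j p.2)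
        (hw 0 (by omega) p.2 h4.le (by simp)) h2.le)
      (norm_sq_le_sum_difference (z := fun k => w p.1 k)
        (hw p.1 h2.le 0 (by omega) (by simp)) h4.le) (by positivity) (by positivity)
  set S := ∑ p ∈ interiorNodes J K, ‖w p.1 p.2‖ ^ 2
  set P := ∑ k ∈ Finset.Ico 1 K, ∑ j ∈ Finset.range J, ‖w (j + 1) k - w j k‖ ^ 2
  set Q := ∑ j ∈ Finset.Ico 1 J, ∑ k ∈ Finset.range K, ‖w j (k + 1) - w j k‖ ^ 2
  set α := ∑ k ∈ Finset.Ico 1 K, ∑ i ∈ Finset.range J,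
          ‖w (i + 1) k - w i k‖ * (‖w (i + 1) k‖ + ‖w i k‖)
  set β := ∑ j ∈ Finset.Ico 1 J, ∑ i ∈ Finset.range K,
          ‖w j (i + 1) - w j i‖ * (‖w j (i + 1)‖ + ‖w j i‖)
  -- Scaling by the mesh sizes before the arithmetic-geometric inequality produces the weights of
  -- the H¹ seminorm without comparing hx and hy.
  have h1 : 2 * (α / hx) * (β / hy) ≤ (α / hx) ^ 2 + (β / hy) ^ 2 := two_mul_le_add_sq _ _
  rw [div_pow, div_pow] at h1
  have h2 : α ^ 2 / hx ^ 2 ≤ P * (4 * S) / hx ^ 2 := by gcongr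
  have h3 : β ^ 2 / hy ^ 2 ≤ Q * (4 * S) / hy ^ 2 := by gcongr
  have e1 : α * β = hx * hy * ((α / hx) * (β / hy)) := by field_simp
  calc hx * hy * _ ≤ hx * hy * (α * β) := by gcongr
    _ = (hx * hy) ^ 2 * ((α / hx) * (β / hy)) := by rw [e1]; ring
    _ ≤ (hx * hy) ^ 2 * ((P * (4 * S) / hx ^ 2 + Q * (4 * S) / hy ^ 2) / 2) := by
        gcongr
        linarith
    _ = _ := by ring

end Grid

/-! ### Energy estimates -/

section Energy

variable {H : Type*} [NormedAddCommGroup H] [InnerProductSpace ℂ H] {e₀ e₁ e₂ L r F : H}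
  {τ lam q : ℝ}

/-- The `G`-stability identity of BDF2. -/
lemma two_mul_re_inner_bdf2 (e₀ e₁ e₂ : H) :
    2 * (inner ℂ e₂ ((3 : ℂ) • e₂ - (4 : ℂ) • e₁ + e₀)).re
      = (‖e₂‖ ^ 2 + ‖(2 : ℂ) • e₂ - e₁‖ ^ 2) - (‖e₁‖ ^ 2 + ‖(2 : ℂ) • e₁ - e₀‖ ^ 2)
        + ‖e₂ - ((2 : ℂ) • e₁ - e₀)‖ ^ 2 := by
  have h1 := norm_sub_sq (𝕜 := ℂ) ((2 : ℂ) • e₂) e₁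
  have h2 := norm_sub_sq (𝕜 := ℂ) e₂ ((2 : ℂ) • e₁ - e₀)
  have h3 : (inner ℂ e₂ e₂ : ℂ).re = ‖e₂‖ ^ 2 := inner_self_eq_norm_sq (𝕜 := ℂ) e₂
  rw [norm_smul, inner_smul_left] at h1
  rw [inner_sub_right, inner_smul_right] at h2
  rw [inner_add_right, inner_sub_right, inner_smul_right, inner_smul_right]
  simp only [RCLike.re_to_complex, Complex.mul_re, Complex.sub_re, Complex.add_re, map_ofNat,
    Complex.re_ofNat, Complex.im_ofNat, zero_mul, sub_zero, Complex.norm_ofNat] at h1 h2 ⊢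
  rw [h1, h2, h3]
  ring

/-- The imaginary and the real part of the error equation, tested with `e₂`. -/
lemma inner_error_equation {D R : H} (heq : Complex.I • D + L = R)
    (hq : inner ℂ e₂ L = -(q : ℂ)) :
    (inner ℂ e₂ D).re = (inner ℂ e₂ R).im ∧ q = -(inner ℂ e₂ D).im - (inner ℂ e₂ R).re := by
  have h : inner ℂ e₂ R = Complex.I * inner ℂ e₂ D + -(q : ℂ) := by
    rw [← heq, inner_add_right, inner_smul_right, hq]
  rw [h]
  constructor <;> simp

lemma abs_im_inner_le (x y : H) : |(inner ℂ x y).im| ≤ ‖x‖ * ‖y‖ :=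
  (Complex.abs_im_le_norm _).trans (norm_inner_le_norm x y)

lemma abs_re_inner_le (x y : H) : |(inner ℂ x y).re| ≤ ‖x‖ * ‖y‖ :=
  (Complex.abs_re_le_norm _).trans (norm_inner_le_norm x y)

variable (hτ : 0 < τ)
  (heq : Complex.I • ((1 / (2 * τ) : ℝ) : ℂ) • ((3 : ℂ) • e₂ - (4 : ℂ) • e₁ + e₀) + L
    = r + ((2 * lam : ℝ) : ℂ) • F)
  (hq : inner ℂ e₂ L = -(q : ℂ))
include hτ heq hq

/-- Only the component ê of e₂ is paired with F through the one-sided bound `hF`. The rest, δ = e₂ −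
ê, is absorbed by the ‖δ‖² of the G-identity, and so ‖F‖² appears with the weight τ² rather than τ.
-/
lemma bdf2_energy_le (hτ1 : τ ≤ 1)
    (hF : |(inner ℂ ((2 : ℂ) • e₁ - e₀) F).im| ≤ ‖(2 : ℂ) • e₁ - e₀‖ ^ 2) :
    ‖e₂‖ ^ 2 + ‖(2 : ℂ) • e₂ - e₁‖ ^ 2 ≤ ‖e₁‖ ^ 2 + ‖(2 : ℂ) • e₁ - e₀‖ ^ 2
      + τ * ((2 + 8 * |lam|) * ‖(2 : ℂ) • e₁ - e₀‖ ^ 2 + 10 * ‖r‖ ^ 2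
        + 32 * |lam| ^ 2 * (τ * ‖F‖ ^ 2)) := by
  have h1 := (inner_error_equation heq hq).1
  have hG := two_mul_re_inner_bdf2 e₀ e₁ e₂
  rw [inner_smul_right, Complex.re_ofReal_mul, inner_add_right (y := r), inner_smul_right,
    Complex.add_im, Complex.im_ofReal_mul] at h1
  set ê := (2 : ℂ) • e₁ - e₀ with hê
  set δ := e₂ - ê with hδ
  have he₂ : e₂ = ê + δ := by rw [hδ]; abel
  have h2 : (inner ℂ e₂ F).im = (inner ℂ ê F).im + (inner ℂ δ F).im := by
    rw [he₂, inner_add_left, Complex.add_im]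
  have h3 : (inner ℂ e₂ r).im ≤ (‖ê‖ + ‖δ‖) * ‖r‖ := by
    refine (le_abs_self _).trans ((abs_im_inner_le _ _).trans ?_)
    gcongr
    rw [he₂]
    exact norm_add_le _ _
  have h4 : lam * (inner ℂ e₂ F).im ≤ |lam| * (‖ê‖ ^ 2 + ‖δ‖ * ‖F‖) := by
    refine (le_abs_self _).trans ?_
    rw [abs_mul]
    gcongr
    rw [h2]
    exact (abs_add_le _ _).trans (add_le_add hF (abs_im_inner_le _ _))
  have h5 : (inner ℂ e₂ ((3 : ℂ) • e₂ - (4 : ℂ) • e₁ + e₀)).re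
      = 2 * τ * ((inner ℂ e₂ r).im + 2 * (lam * (inner ℂ e₂ F).im)) := by
    rw [mul_assoc] at h1
    rw [← h1]
    field_simp
  have h6 : 2 * (inner ℂ e₂ ((3 : ℂ) • e₂ - (4 : ℂ) • e₁ + e₀)).re
      ≤ 4 * τ * ((‖ê‖ + ‖δ‖) * ‖r‖ + 2 * (|lam| * (‖ê‖ ^ 2 + ‖δ‖ * ‖F‖))) := by
    rw [h5]
    calc _ = 4 * τ * ((inner ℂ e₂ r).im + 2 * (lam * (inner ℂ e₂ F).im)) := by ring
      _ ≤ _ := by gcongr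
  -- Young's inequality spends one half of ‖δ‖² here and the other half in `y3`.
  have y1 : 4 * τ * (‖δ‖ * ‖r‖) ≤ ‖δ‖ ^ 2 / 2 + 8 * (τ * ‖r‖ ^ 2) := by
    have : τ * τ * ‖r‖ ^ 2 ≤ 1 * τ * ‖r‖ ^ 2 := by gcongr
    nlinarith [sq_nonneg (‖δ‖ - 4 * τ * ‖r‖)]
  have y2 : 4 * τ * (‖ê‖ * ‖r‖) ≤ 2 * (τ * ‖ê‖ ^ 2) + 2 * (τ * ‖r‖ ^ 2) := by
    nlinarith [mul_nonneg hτ.le (sq_nonneg (‖ê‖ - ‖r‖))]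
  have y3 : 8 * τ * (|lam| * (‖δ‖ * ‖F‖))
      ≤ ‖δ‖ ^ 2 / 2 + 32 * |lam| ^ 2 * τ ^ 2 * ‖F‖ ^ 2 := by
    nlinarith [sq_nonneg (‖δ‖ - 8 * |lam| * τ * ‖F‖)]
  nlinarith

/-- The real part of the tested equation. The time difference is not dissipative there and is
estimated by brute force, which costs the factor 1/τ. -/
lemma bdf2_h1_le :
    q ≤ ‖e₂‖ * ((3 * ‖e₂‖ + 2 * ‖e₁‖ + ‖(2 : ℂ) • e₁ - e₀‖) / (2 * τ)
      + ‖r‖ + 2 * |lam| * ‖F‖) := by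
  have h1 := (inner_error_equation heq hq).2
  set D := ((1 / (2 * τ) : ℝ) : ℂ) • ((3 : ℂ) • e₂ - (4 : ℂ) • e₁ + e₀) with hD
  have h2 := neg_le_of_abs_le (abs_im_inner_le e₂ D)
  have h3 := neg_le_of_abs_le (abs_re_inner_le e₂ (r + ((2 * lam : ℝ) : ℂ) • F))
  have h4 : ‖r + ((2 * lam : ℝ) : ℂ) • F‖ ≤ ‖r‖ + 2 * |lam| * ‖F‖ := by
    refine (norm_add_le _ _).trans ?_
    rw [norm_smul, Complex.norm_real, Real.norm_eq_abs, abs_mul, abs_two]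
  have h5 : ‖D‖ ≤ (3 * ‖e₂‖ + 2 * ‖e₁‖ + ‖(2 : ℂ) • e₁ - e₀‖) / (2 * τ) := by
    -- Regrouped so that only norms controlled by the energies at the two levels occur.
    have e : (3 : ℂ) • e₂ - (4 : ℂ) • e₁ + e₀
        = (3 : ℂ) • e₂ - (2 : ℂ) • e₁ - ((2 : ℂ) • e₁ - e₀) := by module
    rw [hD, e, norm_smul, Complex.norm_real, Real.norm_of_nonneg (by positivity), one_div,
      inv_mul_eq_div]
    gcongr
    refine (norm_sub_le _ _).trans (add_le_add_left ((norm_sub_le _ _).trans (le_of_eq ?_)) _)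
    rw [norm_smul, norm_smul, Complex.norm_ofNat, Complex.norm_ofNat]
  have h6 : q ≤ ‖e₂‖ * ‖D‖ + ‖e₂‖ * ‖r + ((2 * lam : ℝ) : ℂ) • F‖ := by linarith
  refine h6.trans ?_
  rw [← mul_add, add_assoc]
  gcongr

omit heq in
-- The initial error is zero, so the first step contains no nonlinear difference and only the
-- residual remains.
lemma bdf1_energy_le (heq : Complex.I • ((1 / τ : ℝ) : ℂ) • e₂ + L = r) :
    ‖e₂‖ ≤ τ * ‖r‖ ∧ q ≤ (τ * ‖r‖) ^ 2 / τ := by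
  obtain ⟨h1, h2⟩ := inner_error_equation heq hq
  have h3 : (inner ℂ e₂ e₂ : ℂ) = ((‖e₂‖ ^ 2 : ℝ) : ℂ) := by
    rw [inner_self_eq_norm_sq_to_K]; simp
  rw [inner_smul_right, h3, ← Complex.ofReal_mul, Complex.ofReal_re] at h1
  rw [inner_smul_right, h3, ← Complex.ofReal_mul, Complex.ofReal_im] at h2
  have h4 := le_of_abs_le (abs_im_inner_le e₂ r)
  have h5 := neg_le_of_abs_le (abs_re_inner_le e₂ r)
  have h6 : ‖e₂‖ ≤ τ * ‖r‖ := by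
    rcases (norm_nonneg e₂).eq_or_lt with h0 | h0
    · rw [← h0]; positivity
    · refine le_of_mul_le_mul_left (a := ‖e₂‖) ?_ h0
      have : ‖e₂‖ ^ 2 = τ * (1 / τ * ‖e₂‖ ^ 2) := by field_simp
      rw [← sq, this, h1]
      nlinarith
  refine ⟨h6, ?_⟩
  calc q ≤ ‖e₂‖ * ‖r‖ := by linarith
    _ ≤ τ * ‖r‖ * ‖r‖ := by gcongr
    _ = _ := by field_simp

end Energy

/-- A discrete Gronwall argument in which the recursion is available only below a threshold. -/
lemma gronwall_bootstrap {E q : ℕ → ℝ} {N : ℕ} {τ C X Y Q Emax : ℝ} (hτ : 0 ≤ τ) (hC : 0 ≤ C)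
    (hX : 0 ≤ X) (hY : 0 ≤ Y) (hmax : Real.exp (C * (N * τ)) * (Y + N * τ * X) ≤ Emax)
    (hE : E 1 ≤ Y) (hq₀ : q 0 ≤ Q) (hq₁ : q 1 ≤ Q)
    (step : ∀ n, 1 ≤ n → n < N → E n ≤ Emax → q (n - 1) ≤ Q → q n ≤ Q →
      E (n + 1) ≤ (1 + C * τ) * E n + τ * X ∧ (E (n + 1) ≤ Emax → q (n + 1) ≤ Q))
    {n : ℕ} (hn : 1 ≤ n) (hnN : n ≤ N) : E n ≤ Emax ∧ q n ≤ Q := by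
  have hle : ∀ n ≤ N, Real.exp (C * (n * τ)) * (Y + n * τ * X) ≤ Emax := fun n hn => by
    have : (n : ℝ) ≤ N := by exact_mod_cast hn
    refine le_trans ?_ hmax
    gcongr
  -- The extrapolation uses two time levels, so the induction carries `q` at n − 1 and at n,
  -- together with the sharp bound on E n.
  suffices h : E n ≤ Real.exp (C * (n * τ)) * (Y + n * τ * X) ∧ q (n - 1) ≤ Q ∧ q n ≤ Q from
    ⟨h.1.trans (hle n hnN), h.2.2⟩
  induction n, hn using Nat.le_induction with
  | base =>
    refine ⟨hE.trans ?_, hq₀, hq₁⟩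
    have h1 : 1 ≤ Real.exp (C * ((1 : ℕ) * τ)) := Real.one_le_exp (by positivity)
    have h2 : Y ≤ Y + (1 : ℕ) * τ * X := le_add_of_nonneg_right (by positivity)
    nlinarith
  | succ n hn ih =>
    obtain ⟨h1, h2, h3⟩ := ih (by omega)
    obtain ⟨h4, h5⟩ := step n hn (by omega) (h1.trans (hle n (by omega))) h2 h3
    have h6 : E (n + 1) ≤ Real.exp (C * ((n + 1 : ℕ) * τ)) * (Y + (n + 1 : ℕ) * τ * X) := by
      have e1 : Real.exp (C * ((n + 1 : ℕ) * τ)) = Real.exp (C * τ) * Real.exp (C * (n * τ)) := by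
        rw [← Real.exp_add]; push_cast; ring_nf
      have e2 : 1 + C * τ ≤ Real.exp (C * τ) := by
        linarith [Real.add_one_le_exp (C * τ)]
      have e3 : 1 ≤ Real.exp (C * ((n + 1 : ℕ) * τ)) := Real.one_le_exp (by positivity)
      calc E (n + 1) ≤ (1 + C * τ) * (Real.exp (C * (n * τ)) * (Y + n * τ * X)) + τ * X := by
            refine h4.trans ?_
            gcongr
        _ ≤ Real.exp (C * τ) * (Real.exp (C * (n * τ)) * (Y + n * τ * X))
            + Real.exp (C * ((n + 1 : ℕ) * τ)) * (τ * X) := by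
            refine add_le_add (by gcongr) (le_mul_of_one_le_left (by positivity) e3)
        _ = _ := by rw [e1]; push_cast; ring
    exact ⟨h6, h3, h5 (h6.trans (hle (n + 1) (by omega)))⟩

/-! ### Smallness of the time step -/

/-- Quantitative form of τ ln²τ → 0. With s = τ^{1/4} one has |ln τ| = −4 ln s ≤ 4/s, so s²(B + 2|ln
τ|) ≤ s(sB + 8) ≤ 9s ≤ 1 as soon as s ≤ 1/(B + 9). -/
lemma exists_small_step (B : ℝ) (hB : 0 ≤ B) :
    ∃ τ₀ : ℝ, 0 < τ₀ ∧ ∀ τ : ℝ, 0 < τ → τ ≤ τ₀ →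
      τ ≤ 1 ∧ 1 ≤ |Real.log τ| ∧ τ * (B + 2 * |Real.log τ|) ^ 2 ≤ 1 := by
  refine ⟨(1 / (B + 9)) ^ 4, by positivity, fun τ hτ hτ₀ => ?_⟩
  set s := Real.sqrt (Real.sqrt τ) with hs
  have hs0 : 0 < s := Real.sqrt_pos.2 (Real.sqrt_pos.2 hτ)
  have hτs : τ = s ^ 4 := by
    rw [hs, show (4 : ℕ) = 2 * 2 by norm_num, pow_mul, Real.sq_sqrt (Real.sqrt_nonneg _),
      Real.sq_sqrt hτ.le]
  have hsle : s ≤ 1 / (B + 9) := by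
    rw [hτs] at hτ₀
    exact le_of_pow_le_pow_left₀ (by norm_num) (by positivity) hτ₀
  have hsB : s * (B + 9) ≤ 1 := by rwa [le_div_iff₀ (by positivity)] at hsle
  have hs1 : s ≤ 1 / 9 := by nlinarith
  have hlog1 : Real.log s ≤ s - 1 := Real.log_le_sub_one_of_pos hs0
  have hlog2 : 1 - s⁻¹ ≤ Real.log s := Real.one_sub_inv_le_log_of_pos hs0
  have hl : |Real.log τ| = -(4 * Real.log s) := by
    rw [hτs, Real.log_pow, abs_of_nonpos]
    · norm_num
    · norm_num; linarith
  have hinv : s * s⁻¹ = 1 := mul_inv_cancel₀ hs0.ne'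
  have hinv0 : 0 < s⁻¹ := inv_pos.2 hs0
  refine ⟨?_, ?_, ?_⟩
  · rw [hτs]; exact pow_le_one₀ hs0.le (by linarith)
  · rw [hl]; linarith
  · have h1 : s * (B + 2 * |Real.log τ|) ≤ s * B + 8 := by
      rw [hl]
      nlinarith
    have h0 : 0 ≤ s * (B + 2 * |Real.log τ|) := by positivity
    have h2 : s * (s * (B + 2 * |Real.log τ|)) ≤ 1 := by
      have : s * B ≤ 1 := by nlinarith
      nlinarith
    calc τ * (B + 2 * |Real.log τ|) ^ 2 = (s * (s * (B + 2 * |Real.log τ|))) ^ 2 := by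
          rw [hτs]; ring
      _ ≤ 1 := pow_le_one₀ (by positivity) h2

/-! ### The nonlinear term and the error equation on the grid -/

section GridError

variable {J K : ℕ} {hx hy h τ lam : ℝ}

/-- The cut-off bound with ε = τ², summed over the grid. The assumption `hsq` turns the quadratic
term into one more multiple of ‖ê‖; it is supplied by the bootstrap. -/
lemma norm_gridVec_f_sub_le (hx0 : 0 < hx) (hy0 : 0 < hy) (hτ : 0 < τ) (hl : 1 ≤ |Real.log τ|)
    {R : ℝ} (hR0 : 0 ≤ R) {p p' ê : ℕ → ℕ → ℂ} (hê : ∀ j k, p j k - p' j k = ê j k)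
    (hR : ∀ j k, 1 ≤ j → j < J → 1 ≤ k → k < K → ‖p j k‖ ≤ R)
    (hsq : ‖gridVec J K hx hy fun j k => ((‖ê j k‖ ^ 2 : ℝ) : ℂ)‖ ≤ ‖gridVec J K hx hy ê‖) :
    ‖gridVec J K hx hy fun j k => f (p j k) - f (p' j k)‖
      ≤ (R + 2 + 2 * |Real.log τ|) * ‖gridVec J K hx hy ê‖
        + 6 * (τ ^ 2 * |Real.log τ|) * Real.sqrt ((J * hx) * (K * hy)) := by
  set l := |Real.log τ| with hldef
  set α : ℝ := 1 + 2 * l + R with hα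
  set β : ℝ := 6 * (τ ^ 2 * l) with hβ
  have hα0 : 0 ≤ α := by positivity
  have hβ0 : 0 ≤ β := by positivity
  have h1 : ‖gridVec J K hx hy fun j k => f (p j k) - f (p' j k)‖
      ≤ ‖gridVec J K hx hy ((α : ℂ) • (fun j k => ((‖ê j k‖ : ℝ) : ℂ))
        + (fun j k => ((‖ê j k‖ ^ 2 : ℝ) : ℂ)) + fun _ _ => (β : ℂ))‖ := by
    refine norm_gridVec_le_of_norm_le hx0 hy0 fun j k hj1 hjJ hk1 hkK => ?_
    have h2 := norm_f_sub_le_of_norm_le (pow_pos hτ 2) (hR j k hj1 hjJ hk1 hkK) (z₂ := p' j k)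
    rw [hê, Real.log_pow, abs_mul] at h2
    simp only [Nat.cast_ofNat, Nat.abs_ofNat, ← hldef] at h2
    have e : ((α : ℂ) • (fun j k => ((‖ê j k‖ : ℝ) : ℂ)) + (fun j k => ((‖ê j k‖ ^ 2 : ℝ) : ℂ))
        + (fun _ _ => (β : ℂ)) : ℕ → ℕ → ℂ) j k = ((α * ‖ê j k‖ + ‖ê j k‖ ^ 2 + β : ℝ) : ℂ) := by
      simp
    rw [e, Complex.norm_real, Real.norm_of_nonneg (by positivity)]
    have h3 : τ ^ 2 * 1 ≤ τ ^ 2 * l := by gcongr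
    nlinarith
  have h2 : ‖gridVec J K hx hy fun j k => ((‖ê j k‖ : ℝ) : ℂ)‖ ≤ ‖gridVec J K hx hy ê‖ :=
    norm_gridVec_le_of_norm_le hx0 hy0 fun j k _ _ _ _ => by simp
  have h3 := norm_gridVec_const_le (J := J) (K := K) hx0 hy0 hβ0
  rw [map_add, map_add, map_smul] at h1
  refine h1.trans ((norm_add₃_le).trans ?_)
  rw [norm_smul, Complex.norm_real, Real.norm_of_nonneg hα0]
  nlinarith

/-- Under the error bounds the quadratic part of the nonlinear term is controlled by the linear
part: for `h² ≤ τ` by the `H¹` bound, and for `τ < h²` by an inverse estimate. -/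
lemma norm_gridVec_norm_sq_le_self (hx0 : 0 < hx) (hy0 : 0 < hy) (hJ : 0 < J) (hK : 0 < K)
    (hh : h = max hx hy) {κ : ℝ} (hκ : h ≤ κ * min hx hy) (hτ : 0 < τ) {ê : ℕ → ℕ → ℂ}
    (hê : VanishesOnBoundary J K ê) {Q₀ Q₁ η : ℝ} (hQ₀ : 0 ≤ Q₀) (hQ₁ : 0 ≤ Q₁)
    (hη : η = τ ^ 2 * |Real.log τ| + h ^ 2)
    (h0 : ‖gridVec J K hx hy ê‖ ^ 2 ≤ Q₀ * η ^ 2)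
    (h1 : h1Sq J K hx hy ê ≤ 10 * (Q₁ * η ^ 2 / τ)) (hl : τ * |Real.log τ| ≤ 1)
    (hs1 : 80 * Q₁ * τ ≤ 1) (hs0 : 4 * Q₀ * κ ^ 2 * h ^ 2 ≤ 1) :
    ‖gridVec J K hx hy fun j k => ((‖ê j k‖ ^ 2 : ℝ) : ℂ)‖ ≤ ‖gridVec J K hx hy ê‖ := by
  rw [← sq_le_sq₀ (norm_nonneg _) (norm_nonneg _)]
  set S := ‖gridVec J K hx hy ê‖
  set P := ‖gridVec J K hx hy fun j k => ((‖ê j k‖ ^ 2 : ℝ) : ℂ)‖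
  have hτl : τ ^ 2 * |Real.log τ| ≤ τ := by
    calc τ ^ 2 * |Real.log τ| = τ * (τ * |Real.log τ|) := by ring
      _ ≤ τ * 1 := by gcongr
      _ = τ := mul_one τ
  have hη0 : 0 ≤ η := by rw [hη]; positivity
  have hh0 : 0 < h := hh ▸ hx0.trans_le (le_max_left _ _)
  rcases le_total (h ^ 2) τ with hc | hc
  · have hη2 : η ≤ 2 * τ := by linarith
    have h2 : P ^ 2 ≤ 2 * S ^ 2 * h1Sq J K hx hy ê :=
      norm_gridVec_norm_sq_le_of_h1Sq hx0 hy0 hJ hK hê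
    have h3 : 2 * h1Sq J K hx hy ê ≤ 1 := by
      calc 2 * h1Sq J K hx hy ê ≤ 2 * (10 * (Q₁ * η ^ 2 / τ)) := by linarith
        _ ≤ 2 * (10 * (Q₁ * (2 * τ) ^ 2 / τ)) := by gcongr
        _ = 80 * Q₁ * τ := by field_simp; ring
        _ ≤ 1 := hs1
    nlinarith [sq_nonneg S]
  · have hη2 : η ≤ 2 * h ^ 2 := by linarith
    have h2 : hx * hy * P ^ 2 ≤ S ^ 4 := norm_gridVec_norm_sq_le_of_inverse hx0 hy0
    have hκ0 : 0 < κ := by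
      have : 0 < min hx hy := lt_min hx0 hy0
      by_contra hneg
      nlinarith
    have h3 : h ^ 2 ≤ κ ^ 2 * (hx * hy) := by
      have hm : 0 < min hx hy := lt_min hx0 hy0
      calc h ^ 2 ≤ (κ * min hx hy) ^ 2 := by gcongr
        _ = κ ^ 2 * (min hx hy * min hx hy) := by ring
        _ ≤ κ ^ 2 * (hx * hy) := by
          gcongr
          · exact min_le_left _ _
          · exact min_le_right _ _
    have h4 : S ^ 2 ≤ Q₀ * (2 * h ^ 2) ^ 2 := h0.trans (by gcongr)
    have h5 : h ^ 2 * P ^ 2 ≤ h ^ 2 * S ^ 2 := by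
      calc h ^ 2 * P ^ 2 ≤ κ ^ 2 * (hx * hy) * P ^ 2 := by gcongr
        _ = κ ^ 2 * (hx * hy * P ^ 2) := by ring
        _ ≤ κ ^ 2 * S ^ 4 := by gcongr
        _ = κ ^ 2 * S ^ 2 * S ^ 2 := by ring
        _ ≤ κ ^ 2 * (Q₀ * (2 * h ^ 2) ^ 2) * S ^ 2 := by gcongr
        _ = (4 * Q₀ * κ ^ 2 * h ^ 2) * (h ^ 2 * S ^ 2) := by ring
        _ ≤ 1 * (h ^ 2 * S ^ 2) := by gcongr
        _ = h ^ 2 * S ^ 2 := one_mul _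
    exact le_of_mul_le_mul_left h5 (by positivity)

lemma discreteLaplacian_sub (v w : ℕ → ℕ → ℂ) (j k : ℕ) :
    discreteLaplacian hx hy (v - w) j k
      = discreteLaplacian hx hy v j k - discreteLaplacian hx hy w j k := by
  simp only [discreteLaplacian, Pi.sub_apply]
  ring

lemma VanishesOnBoundary.sub {v w : ℕ → ℕ → ℂ} (hv : VanishesOnBoundary J K v)
    (hw : VanishesOnBoundary J K w) : VanishesOnBoundary J K (v - w) := fun j hj k hk hb => by
  rw [Pi.sub_apply, Pi.sub_apply, hv j hj k hk hb, hw j hj k hk hb, sub_zero]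

lemma VanishesOnBoundary.smul {v : ℕ → ℕ → ℂ} (hv : VanishesOnBoundary J K v) (r : ℂ) :
    VanishesOnBoundary J K (r • v) := fun j hj k hk hb => by
  rw [Pi.smul_apply, Pi.smul_apply, hv j hj k hk hb, smul_zero]

/-- The error equation of the linearized BDF2 scheme. -/
lemma bdf2_error_equation {g₀ g₁ g₂ w₀ w₁ w₂ : ℕ → ℕ → ℂ}
    (hs : ∀ j k, 1 ≤ j → j < J → 1 ≤ k → k < K →
      Complex.I * ((3 * w₂ j k - 4 * w₁ j k + w₀ j k) / (2 * (τ : ℂ)))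
        + discreteLaplacian hx hy w₂ j k = 2 * (lam : ℂ) * f (2 * w₁ j k - w₀ j k)) :
    Complex.I • ((1 / (2 * τ) : ℝ) : ℂ) • ((3 : ℂ) • gridVec J K hx hy (g₂ - w₂)
        - (4 : ℂ) • gridVec J K hx hy (g₁ - w₁) + gridVec J K hx hy (g₀ - w₀))
      + gridVec J K hx hy (discreteLaplacian hx hy (g₂ - w₂))
    = gridVec J K hx hy (fun j k =>
        Complex.I * ((3 * g₂ j k - 4 * g₁ j k + g₀ j k) / (2 * (τ : ℂ)))
          + discreteLaplacian hx hy g₂ j k - 2 * (lam : ℂ) * f (2 * g₁ j k - g₀ j k))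
      + ((2 * lam : ℝ) : ℂ) • gridVec J K hx hy
        (fun j k => f (2 * g₁ j k - g₀ j k) - f (2 * w₁ j k - w₀ j k)) := by
  simp only [← map_smul, ← map_sub, ← map_add]
  refine gridVec_congr fun j k hj1 hjJ hk1 hkK => ?_
  simp only [Pi.add_apply, Pi.smul_apply, discreteLaplacian_sub, Pi.sub_apply, smul_eq_mul]
  push_cast
  linear_combination -hs j k hj1 hjJ hk1 hkK

/-- The error equation of the linearized BDF1 scheme with exact initial values. -/
lemma bdf1_error_equation {g₀ g₁ w₀ w₁ : ℕ → ℕ → ℂ}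
    (hs : ∀ j k, 1 ≤ j → j < J → 1 ≤ k → k < K →
      Complex.I * ((w₁ j k - w₀ j k) / (τ : ℂ)) + discreteLaplacian hx hy w₁ j k
        = 2 * (lam : ℂ) * f (w₀ j k))
    (h0 : ∀ j k, 1 ≤ j → j < J → 1 ≤ k → k < K → w₀ j k = g₀ j k) :
    Complex.I • ((1 / τ : ℝ) : ℂ) • gridVec J K hx hy (g₁ - w₁)
      + gridVec J K hx hy (discreteLaplacian hx hy (g₁ - w₁))
    = gridVec J K hx hy (fun j k => Complex.I * ((g₁ j k - g₀ j k) / (τ : ℂ))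
        + discreteLaplacian hx hy g₁ j k - 2 * (lam : ℂ) * f (g₀ j k)) := by
  simp only [← map_smul, ← map_add]
  refine gridVec_congr fun j k hj1 hjJ hk1 hkK => ?_
  have h1 := hs j k hj1 hjJ hk1 hkK
  rw [h0 j k hj1 hjJ hk1 hkK] at h1
  simp only [Pi.add_apply, Pi.smul_apply, discreteLaplacian_sub, Pi.sub_apply, smul_eq_mul]
  push_cast
  linear_combination -h1

lemma norm_gridVec_le_of_bound (hx0 : 0 < hx) (hy0 : 0 < hy) {r : ℕ → ℕ → ℂ} {β : ℝ} (hβ : 0 ≤ β)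
    (h : ∀ j k, 1 ≤ j → j < J → 1 ≤ k → k < K → ‖r j k‖ ≤ β) :
    ‖gridVec J K hx hy r‖ ≤ β * Real.sqrt ((J * hx) * (K * hy)) :=
  (norm_gridVec_le_of_norm_le hx0 hy0 fun j k h1 h2 h3 h4 => by
    rw [Complex.norm_real, Real.norm_of_nonneg hβ]; exact h j k h1 h2 h3 h4).trans
    (norm_gridVec_const_le hx0 hy0 hβ)

end GridError

lemma IsRegularSolution.mono {Ω : Set (ℝ × ℝ)} {T lam M M' : ℝ} {u : ℝ → ℝ × ℝ → ℂ}
    (hu : IsRegularSolution Ω T lam M u) (h : M ≤ M') : IsRegularSolution Ω T lam M' u := by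
  obtain ⟨h1, h2, v₀, v₂, v₄, h3, h4, h5, h6, h7, h8, h9⟩ := hu
  exact ⟨h1, h2, v₀, v₂, v₄, h3, h4, h5, ⟨h6.1, fun m hm t ht => (h6.2 m hm t ht).trans h⟩,
    ⟨h7.1, fun m hm t ht => (h7.2 m hm t ht).trans h⟩,
    ⟨h8.1, fun m hm t ht => (h8.2 m hm t ht).trans h⟩, h9⟩

lemma IsRegularSolution.vanishesOnBoundary {a b c d T lam M : ℝ} {u : ℝ → ℝ × ℝ → ℂ}
    (hu : IsRegularSolution (rect a b c d) T lam M u) (hab : a < b) (hcd : c < d)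
    {hx hy : ℝ} {J K : ℕ} (hJ : 0 < J) (hK : 0 < K) (hxJ : hx = (b - a) / J)
    (hyK : hy = (d - c) / K) {t : ℝ} (ht : t ∈ Icc 0 T) :
    VanishesOnBoundary J K (gridRestrict a c hx hy (u t)) := by
  intro j hj k hk hb
  have hJ0 : (J : ℝ) ≠ 0 := by exact_mod_cast hJ.ne'
  have hK0 : (K : ℝ) ≠ 0 := by exact_mod_cast hK.ne'
  refine hu.2.1 t ht _ ?_
  rw [frontier, (isOpen_rect a b c d).interior_eq, closure_rect hab hcd]
  refine ⟨⟨node_mem_Icc hab hJ hxJ hj, node_mem_Icc hcd hK hyK hk⟩, ?_⟩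
  rintro ⟨⟨h1, h2⟩, h3, h4⟩
  simp only at h1 h2 h3 h4
  rcases hb with rfl | rfl | rfl | rfl
  · simp at h1
  · rw [hxJ, mul_div_cancel₀ _ hJ0] at h2; linarith
  · simp at h3
  · rw [hyK, mul_div_cancel₀ _ hK0] at h4; linarith

/-! ### Error bounds -/

/-- The constant of the local truncation errors. -/
def truncationConst (m Λ : ℝ) : ℝ := 6 * m + 132 * Λ * m ^ 2

/-- The growth rate of the discrete energy. -/
def growthRate (Λ : ℝ) : ℝ := 2 + 8 * Λ + 64 * Λ ^ 2

/-- The source term in the energy recursion. -/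
def sourceConst (m Λ A : ℝ) : ℝ := (10 * truncationConst m Λ ^ 2 + 2304 * Λ ^ 2) * A

/-- The constant of the squared `L²` error bound. -/
noncomputable def l2Const (m Λ A T : ℝ) : ℝ :=
  Real.exp (growthRate Λ * T) * (5 * (truncationConst m Λ ^ 2 * A) + T * sourceConst m Λ A)

/-- The constant of the squared `H¹` error bound. -/
noncomputable def h1Const (m Λ A T : ℝ) : ℝ :=
  √(l2Const m Λ A T) * (3 * √(l2Const m Λ A T) + truncationConst m Λ * √A
    + 2 * Λ * (√(l2Const m Λ A T) + 6 * √A)) + truncationConst m Λ ^ 2 * A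

lemma truncationConst_nonneg {m Λ : ℝ} (hm : 0 ≤ m) (hΛ : 0 ≤ Λ) : 0 ≤ truncationConst m Λ := by
  unfold truncationConst
  positivity

lemma sourceConst_nonneg {m Λ A : ℝ} (hA : 0 ≤ A) : 0 ≤ sourceConst m Λ A := by
  unfold sourceConst
  positivity

lemma l2Const_nonneg {m Λ A T : ℝ} (hA : 0 ≤ A) (hT : 0 ≤ T) : 0 ≤ l2Const m Λ A T := by
  have := sourceConst_nonneg (m := m) (Λ := Λ) hA
  unfold l2Const
  positivity

lemma h1Const_nonneg {m Λ A T : ℝ} (hm : 0 ≤ m) (hΛ : 0 ≤ Λ) (hA : 0 ≤ A) :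
    0 ≤ h1Const m Λ A T := by
  have := truncationConst_nonneg hm hΛ
  unfold h1Const
  positivity

/-- The energy and the `H¹` seminorm after one step of BDF2, in terms of the constants. -/
lemma bdf2_step_bounds {H : Type*} [NormedAddCommGroup H] [InnerProductSpace ℂ H]
    {e₀ e₁ e₂ L r F : H} {τ lam q m A T l η : ℝ} (hτ : 0 < τ) (hτ1 : τ ≤ 1)
    (hm : 1 ≤ m) (hA : 0 ≤ A) (hT : 0 ≤ T) (hl : 0 ≤ l) (hη : τ ^ 2 * l ≤ η)
    (hsmall : τ * (3 * m + 2 + 2 * l) ^ 2 ≤ 1)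
    (heq : Complex.I • ((1 / (2 * τ) : ℝ) : ℂ) • ((3 : ℂ) • e₂ - (4 : ℂ) • e₁ + e₀) + L
      = r + ((2 * lam : ℝ) : ℂ) • F)
    (hq : inner ℂ e₂ L = -(q : ℂ))
    (hr : ‖r‖ ≤ truncationConst m |lam| * η * √A)
    (hFim : |(inner ℂ ((2 : ℂ) • e₁ - e₀) F).im| ≤ ‖(2 : ℂ) • e₁ - e₀‖ ^ 2)
    (hF : ‖F‖ ≤ (3 * m + 2 + 2 * l) * ‖(2 : ℂ) • e₁ - e₀‖ + 6 * (τ ^ 2 * l) * √A)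
    (hE : ‖e₁‖ ^ 2 + ‖(2 : ℂ) • e₁ - e₀‖ ^ 2 ≤ l2Const m |lam| A T * η ^ 2) :
    ‖e₂‖ ^ 2 + ‖(2 : ℂ) • e₂ - e₁‖ ^ 2
        ≤ (1 + growthRate |lam| * τ) * (‖e₁‖ ^ 2 + ‖(2 : ℂ) • e₁ - e₀‖ ^ 2)
          + τ * (sourceConst m |lam| A * η ^ 2) ∧
      (‖e₂‖ ^ 2 + ‖(2 : ℂ) • e₂ - e₁‖ ^ 2 ≤ l2Const m |lam| A T * η ^ 2 →
        q ≤ h1Const m |lam| A T * η ^ 2 / τ) := by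
  have hΛ : 0 ≤ |lam| := abs_nonneg _
  have hη0 : 0 ≤ η := le_trans (by positivity) hη
  have hC0 := truncationConst_nonneg (by linarith : 0 ≤ m) hΛ
  set Cr := truncationConst m |lam| with hCr
  set x := 3 * m + 2 + 2 * l with hx
  have hx1 : 1 ≤ x := by linarith
  set ê := (2 : ℂ) • e₁ - e₀ with hê
  have hF' : ‖F‖ ≤ x * ‖ê‖ + 6 * η * √A := hF.trans (by gcongr)
  have hAs : √A ^ 2 = A := Real.sq_sqrt hA
  have hr2 : ‖r‖ ^ 2 ≤ Cr ^ 2 * A * η ^ 2 := by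
    calc ‖r‖ ^ 2 ≤ (Cr * η * √A) ^ 2 := by gcongr
      _ = Cr ^ 2 * √A ^ 2 * η ^ 2 := by ring
      _ = _ := by rw [hAs]
  -- The spare factor τ swallows the squared logarithm in x², by `hsmall`.
  have hF2 : τ * ‖F‖ ^ 2 ≤ 2 * ‖ê‖ ^ 2 + 72 * A * η ^ 2 := by
    have h1 : ‖F‖ ^ 2 ≤ 2 * (x ^ 2 * ‖ê‖ ^ 2) + 72 * A * η ^ 2 := by
      calc ‖F‖ ^ 2 ≤ (x * ‖ê‖ + 6 * η * √A) ^ 2 := by gcongr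
        _ ≤ 2 * (x * ‖ê‖) ^ 2 + 2 * (6 * η * √A) ^ 2 := by
          nlinarith [sq_nonneg (x * ‖ê‖ - 6 * η * √A)]
        _ = 2 * (x ^ 2 * ‖ê‖ ^ 2) + 72 * √A ^ 2 * η ^ 2 := by ring
        _ = _ := by rw [hAs]
    calc τ * ‖F‖ ^ 2 ≤ τ * (2 * (x ^ 2 * ‖ê‖ ^ 2) + 72 * A * η ^ 2) := by gcongr
      _ = 2 * ((τ * x ^ 2) * ‖ê‖ ^ 2) + τ * (72 * A * η ^ 2) := by ring
      _ ≤ 2 * (1 * ‖ê‖ ^ 2) + 1 * (72 * A * η ^ 2) := by gcongr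
      _ = _ := by ring
  constructor
  · have h1 := bdf2_energy_le hτ heq hq hτ1 hFim
    refine h1.trans ?_
    have h2 : ‖ê‖ ^ 2 ≤ ‖e₁‖ ^ 2 + ‖ê‖ ^ 2 := le_add_of_nonneg_left (by positivity)
    have h3 : (2 + 8 * |lam|) * ‖ê‖ ^ 2 + 10 * ‖r‖ ^ 2 + 32 * |lam| ^ 2 * (τ * ‖F‖ ^ 2)
        ≤ growthRate |lam| * (‖e₁‖ ^ 2 + ‖ê‖ ^ 2) + sourceConst m |lam| A * η ^ 2 := by
      calc _ ≤ (2 + 8 * |lam|) * ‖ê‖ ^ 2 + 10 * (Cr ^ 2 * A * η ^ 2)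
            + 32 * |lam| ^ 2 * (2 * ‖ê‖ ^ 2 + 72 * A * η ^ 2) := by gcongr
        _ = growthRate |lam| * ‖ê‖ ^ 2 + sourceConst m |lam| A * η ^ 2 := by
          rw [growthRate, sourceConst, ← hCr]
          ring
        _ ≤ _ := by
          have : 0 ≤ growthRate |lam| := by unfold growthRate; positivity
          gcongr
    calc _ ≤ ‖e₁‖ ^ 2 + ‖ê‖ ^ 2 + τ * (growthRate |lam| * (‖e₁‖ ^ 2 + ‖ê‖ ^ 2)
          + sourceConst m |lam| A * η ^ 2) := by gcongr
      _ = _ := by ring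
  · intro hE2
    have hK := l2Const_nonneg (m := m) (Λ := |lam|) hA hT
    set σ := √(l2Const m |lam| A T) with hσ
    have hσ2 : σ ^ 2 = l2Const m |lam| A T := Real.sq_sqrt hK
    have hσ0 : 0 ≤ σ := Real.sqrt_nonneg _
    have hle : ∀ y : ℝ, 0 ≤ y → y ^ 2 ≤ l2Const m |lam| A T * η ^ 2 → y ≤ σ * η := fun y hy h => by
      rw [← sq_le_sq₀ hy (by positivity), mul_pow, hσ2]
      exact h
    have b2 : ‖e₂‖ ≤ σ * η :=
      hle _ (norm_nonneg _) (le_trans (le_add_of_nonneg_right (by positivity)) hE2)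
    have b1 : ‖e₁‖ ≤ σ * η :=
      hle _ (norm_nonneg _) (le_trans (le_add_of_nonneg_right (by positivity)) hE)
    have b0 : ‖ê‖ ≤ σ * η :=
      hle _ (norm_nonneg _) (le_trans (le_add_of_nonneg_left (by positivity)) hE)
    -- Since x ≥ 1, τx ≤ τx².
    have hτx : τ * x ≤ 1 := by
      refine le_trans ?_ hsmall
      gcongr
      nlinarith
    have hFb : τ * ‖F‖ ≤ (σ + 6 * √A) * η := by
      calc τ * ‖F‖ ≤ τ * (x * (σ * η) + 6 * η * √A) := by
            refine mul_le_mul_of_nonneg_left (hF'.trans ?_) hτ.le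
            gcongr
        _ = (τ * x) * (σ * η) + τ * (6 * η * √A) := by ring
        _ ≤ 1 * (σ * η) + 1 * (6 * η * √A) := by gcongr
        _ = _ := by ring
    have hrb : τ * ‖r‖ ≤ Cr * √A * η := by
      calc τ * ‖r‖ ≤ 1 * (Cr * η * √A) := by gcongr
        _ = _ := by ring
    have h1 := bdf2_h1_le hτ heq hq
    rw [le_div_iff₀ hτ]
    calc q * τ ≤ ‖e₂‖ * ((3 * ‖e₂‖ + 2 * ‖e₁‖ + ‖ê‖) / (2 * τ) + ‖r‖ + 2 * |lam| * ‖F‖) * τ := by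
          gcongr
      _ = ‖e₂‖ * ((3 * ‖e₂‖ + 2 * ‖e₁‖ + ‖ê‖) / 2 + τ * ‖r‖ + 2 * |lam| * (τ * ‖F‖)) := by
          field_simp
      _ ≤ (σ * η) * ((3 * (σ * η) + 2 * (σ * η) + σ * η) / 2 + Cr * √A * η
          + 2 * |lam| * ((σ + 6 * √A) * η)) := by gcongr
      _ = σ * (3 * σ + Cr * √A + 2 * |lam| * (σ + 6 * √A)) * η ^ 2 := by ring
      _ ≤ h1Const m |lam| A T * η ^ 2 := by
          rw [h1Const, ← hCr, ← hσ]
          gcongr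
          exact le_add_of_nonneg_right (by positivity)

variable {a b c d T lam m : ℝ} {u : ℝ → ℝ × ℝ → ℂ}

set_option maxHeartbeats 1000000 in
/-- Error bounds under explicit smallness conditions on `τ` and `h`. -/
theorem error_bounds (hT : 0 < T) (hm : 1 ≤ m)
    (hu : IsRegularSolution (rect a b c d) T lam m u) (hab : a < b) (hcd : c < d)
    {J K N : ℕ} (hJ : 3 ≤ J) (hK : 3 ≤ K) {hx hy h τ κ A : ℝ} (hxJ : hx = (b - a) / J)
    (hyK : hy = (d - c) / K) (hh : h = max hx hy) (hτN : N * τ = T) (hτ : 0 < τ)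
    (hκ : h ≤ κ * min hx hy) (hA : (b - a) * (d - c) = A)
    (hτ1 : τ ≤ 1) (hl : 1 ≤ |Real.log τ|) (hsmall : τ * (3 * m + 2 + 2 * |Real.log τ|) ^ 2 ≤ 1)
    (hs1 : 80 * h1Const m |lam| A T * τ ≤ 1) (hs0 : 4 * l2Const m |lam| A T * κ ^ 2 * h ^ 2 ≤ 1)
    {w : ℕ → ℕ → ℕ → ℂ} (hw : IsBDF2Solution J K N hx hy τ lam (gridRestrict a c hx hy (u 0)) w)
    {η : ℝ} (hη : η = τ ^ 2 * |Real.log τ| + h ^ 2) {n : ℕ} (hn : 1 ≤ n) (hnN : n ≤ N) :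
    ‖gridVec J K hx hy (gridRestrict a c hx hy (u (n * τ)) - w n)‖ ^ 2
        ≤ l2Const m |lam| A T * η ^ 2 ∧
      h1Sq J K hx hy (gridRestrict a c hx hy (u (n * τ)) - w n)
        ≤ h1Const m |lam| A T * η ^ 2 / τ := by
  have hx0 : 0 < hx := hxJ ▸ div_pos (by linarith) (by exact_mod_cast (by omega : 0 < J))
  have hy0 : 0 < hy := hyK ▸ div_pos (by linarith) (by exact_mod_cast (by omega : 0 < K))
  have hJx : (J : ℝ) * hx = b - a := by
    have : (J : ℝ) ≠ 0 := by exact_mod_cast (by omega : J ≠ 0)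
    rw [hxJ]; field_simp
  have hKy : (K : ℝ) * hy = d - c := by
    have : (K : ℝ) ≠ 0 := by exact_mod_cast (by omega : K ≠ 0)
    rw [hyK]; field_simp
  have hJK : ((J * hx) * (K * hy) : ℝ) = A := by rw [hJx, hKy, hA]
  have hA0 : 0 ≤ A := by rw [← hJK]; positivity
  have hΛ : 0 ≤ |lam| := abs_nonneg _
  have hη0 : 0 ≤ η := by rw [hη]; positivity
  have hητ : τ ^ 2 * |Real.log τ| ≤ η := by rw [hη]; exact le_add_of_nonneg_right (by positivity)
  have hC0 := truncationConst_nonneg (by linarith : 0 ≤ m) hΛ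
  have hsrc0 := sourceConst_nonneg (m := m) (Λ := |lam|) hA0
  have hl20 := l2Const_nonneg (m := m) (Λ := |lam|) hA0 hT.le
  have hh10 := h1Const_nonneg (T := T) (by linarith : 0 ≤ m) hΛ hA0
  have htime : ∀ n ≤ N, (n : ℝ) * τ ∈ Icc 0 T := fun n hn => by
    have : (n : ℝ) ≤ N := by exact_mod_cast hn
    exact ⟨by positivity, hτN ▸ by gcongr⟩
  let g : ℕ → ℕ → ℕ → ℂ := fun n => gridRestrict a c hx hy (u (n * τ))
  let e : ℕ → ℕ → ℕ → ℂ := fun n => g n - w n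
  let v : ℕ → EuclideanSpace ℂ ↥(interiorNodes J K) := fun n => gridVec J K hx hy (e n)
  have hbd : ∀ n ≤ N, VanishesOnBoundary J K (e n) := fun n hn =>
    (hu.vanishesOnBoundary hab hcd (by omega) (by omega) hxJ hyK (htime n hn)).sub (hw.boundary n hn)
  have hinit : ∀ j ≤ J, ∀ k ≤ K, w 0 j k = g 0 j k := fun j hj k hk => by
    simpa [g] using hw.initial j hj k hk
  have hz : ∀ j ≤ J, ∀ k ≤ K, e 0 j k = 0 := fun j hj k hk => by
    simp only [e, Pi.sub_apply, hinit j hj k hk, sub_self]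
  have hq0 : h1Sq J K hx hy (e 0) = 0 := h1Sq_eq_zero hz
  have hv0 : v 0 = 0 := norm_eq_zero.1 (norm_gridVec_eq_zero hz)
  have hinner : ∀ n ≤ N, inner ℂ (v n) (gridVec J K hx hy (discreteLaplacian hx hy (e n)))
      = -((h1Sq J K hx hy (e n) : ℝ) : ℂ) := fun n hn =>
    inner_discreteLaplacian hx0 hy0 (by omega) (by omega) (hbd n hn)
  have hN1 : 1 ≤ N := hn.trans hnN
  have hfirst := bdf1_energy_le hτ (hinner 1 hN1) (bdf1_error_equation (g₀ := g 0) (g₁ := g 1)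
    (fun j k h1 h2 h3 h4 => hw.first_step j k h1 h2 h3 h4)
    (fun j k h1 h2 h3 h4 => hinit j h2.le k h4.le))
  have hr1 : τ * ‖gridVec J K hx hy (fun j k => Complex.I * ((g 1 j k - g 0 j k) / (τ : ℂ))
        + discreteLaplacian hx hy (g 1) j k - 2 * (lam : ℂ) * f (g 0 j k))‖
      ≤ truncationConst m |lam| * η * √A := by
    have := norm_gridVec_le_of_bound (J := J) (K := K) hx0 hy0
      (r := fun j k => Complex.I * ((g 1 j k - g 0 j k) / (τ : ℂ))
        + discreteLaplacian hx hy (g 1) j k - 2 * (lam : ℂ) * f (g 0 j k))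
      (β := truncationConst m |lam| * η / τ) (by positivity) (fun j k h1 h2 h3 h4 => by
        have ht : ((1 : ℕ) : ℝ) * τ - τ = ((0 : ℕ) : ℝ) * τ := by push_cast; ring
        have := norm_bdf1_truncation_le hT hm hu hab hcd hJ hK hxJ hyK hh hτ hτ1 hl
          (htime 1 hN1).2 h1 h2 h3 h4 (by rw [ht]; exact (htime 0 (by omega)).1)
        rw [ht, ← hη] at this
        rw [le_div_iff₀' hτ]
        exact this)
    rw [hJK] at this
    calc _ ≤ τ * (truncationConst m |lam| * η / τ * √A) := by gcongr
      _ = _ := by field_simp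
  -- As v 0 = 0, the energy at level 1 is ‖v 1‖² + ‖2 v 1‖², whence the factor 5.
  have hE1 : ‖v 1‖ ^ 2 + ‖(2 : ℂ) • v 1 - v (1 - 1)‖ ^ 2
      ≤ 5 * (truncationConst m |lam| ^ 2 * A) * η ^ 2 := by
    rw [Nat.sub_self, hv0, sub_zero, norm_smul, Complex.norm_ofNat]
    have h1 : ‖v 1‖ ^ 2 ≤ (truncationConst m |lam| * η * √A) ^ 2 := by
      gcongr
      exact hfirst.1.trans hr1
    rw [mul_pow, mul_pow, Real.sq_sqrt hA0] at h1
    nlinarith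
  have hq1 : h1Sq J K hx hy (e 1) ≤ h1Const m |lam| A T * η ^ 2 / τ := by
    refine hfirst.2.trans ?_
    gcongr
    calc _ ≤ (truncationConst m |lam| * η * √A) ^ 2 := by gcongr
      _ = truncationConst m |lam| ^ 2 * A * η ^ 2 := by
        rw [mul_pow, mul_pow, Real.sq_sqrt hA0]; ring
      _ ≤ h1Const m |lam| A T * η ^ 2 := by
        -- The last summand of `h1Const` is there for the first step.
        rw [h1Const]
        gcongr
        exact le_add_of_nonneg_left (by positivity)
  -- The threshold `Emax` is exactly what Gronwall's inequality yields over [0, T], as Nτ = T; the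
  -- constant is therefore not enlarged by the bootstrap.
  have key := gronwall_bootstrap (E := fun n => ‖v n‖ ^ 2 + ‖(2 : ℂ) • v n - v (n - 1)‖ ^ 2)
    (q := fun n => h1Sq J K hx hy (e n)) (N := N) (τ := τ) (C := growthRate |lam|)
    (X := sourceConst m |lam| A * η ^ 2) (Y := 5 * (truncationConst m |lam| ^ 2 * A) * η ^ 2)
    (Q := h1Const m |lam| A T * η ^ 2 / τ) (Emax := l2Const m |lam| A T * η ^ 2)
    hτ.le (by unfold growthRate; positivity) (by positivity) (by positivity)
    (by rw [hτN, l2Const]; exact le_of_eq (by ring)) hE1 (by rw [hq0]; positivity) hq1 ?_ hn hnN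
  · exact ⟨le_trans (le_add_of_nonneg_right (by positivity)) key.1, key.2⟩
  intro n hn hnN hE hqa hqb
  obtain ⟨i, rfl⟩ : ∃ i, n = i + 1 := ⟨n - 1, by omega⟩
  simp only [Nat.add_sub_cancel] at hE hqa hqb ⊢
  have ht1 : ((i + 1 + 1 : ℕ) : ℝ) * τ - τ = ((i + 1 : ℕ) : ℝ) * τ := by push_cast; ring
  have ht2 : ((i + 1 + 1 : ℕ) : ℝ) * τ - 2 * τ = (i : ℝ) * τ := by push_cast; ring
  have hê : (2 : ℂ) • v (i + 1) - v i = gridVec J K hx hy ((2 : ℂ) • e (i + 1) - e i) := by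
    rw [map_sub, map_smul]
  have hêsub : ∀ j k, (2 * g (i + 1) j k - g i j k) - (2 * w (i + 1) j k - w i j k)
      = ((2 : ℂ) • e (i + 1) - e i) j k := fun j k => by
    simp only [e, Pi.sub_apply, Pi.smul_apply, smul_eq_mul]
    ring
  have hr : ‖gridVec J K hx hy (fun j k => Complex.I * ((3 * g (i + 1 + 1) j k
        - 4 * g (i + 1) j k + g i j k) / (2 * (τ : ℂ)))
        + discreteLaplacian hx hy (g (i + 1 + 1)) j k
        - 2 * (lam : ℂ) * f (2 * g (i + 1) j k - g i j k))‖
      ≤ truncationConst m |lam| * η * √A := by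
    rw [← hJK]
    refine norm_gridVec_le_of_bound hx0 hy0 (by positivity) fun j k h1 h2 h3 h4 => ?_
    have := norm_bdf2_truncation_le hT hm hu hab hcd hJ hK hxJ hyK hh hτ hτ1 hl
      (htime (i + 1 + 1) hnN).2 h1 h2 h3 h4 (by rw [ht2]; exact (htime i (by omega)).1)
    rw [ht1, ht2, ← hη] at this
    exact this
  have hFim := abs_im_inner_gridVec_le (J := J) (K := K) hx0 hy0 (v := (2 : ℂ) • e (i + 1) - e i)
    (w := fun j k => f (2 * g (i + 1) j k - g i j k) - f (2 * w (i + 1) j k - w i j k))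
    (fun j k => by
      rw [← hêsub]
      exact abs_im_conj_mul_f_sub_le _ _)
  have hτl : τ * |Real.log τ| ≤ 1 := by
    refine le_trans ?_ hsmall
    gcongr
    nlinarith
  -- The only use of the bootstrap hypotheses on `h1Sq`. The factor 10 = 8 + 2 comes from the
  -- extrapolation of two levels.
  have hsq := norm_gridVec_norm_sq_le_self hx0 hy0 (by omega) (by omega) hh hκ hτ
    (((hbd (i + 1) (by omega)).smul 2).sub (hbd i (by omega))) hl20 hh10 hη
    (by rw [← hê]; exact le_trans (le_add_of_nonneg_left (by positivity)) hE)
    (by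
      have := h1Sq_extrapolation_le (J := J) (K := K) (v := e (i + 1)) (w := e i) hx0 hy0
      linarith) hτl hs1 hs0
  -- The extrapolated exact solution is bounded by 2m + m = 3m.
  have hF := norm_gridVec_f_sub_le hx0 hy0 hτ hl (R := 3 * m) (by linarith) hêsub
    (fun j k h1 h2 h3 h4 => by
      have hz : ((a + j * hx, c + k * hy) : ℝ × ℝ) ∈ closure (rect a b c d) := by
        rw [closure_rect hab hcd]
        exact ⟨node_mem_Icc hab (by omega) hxJ h2.le, node_mem_Icc hcd (by omega) hyK h4.le⟩
      have n1 : ‖g (i + 1) j k‖ ≤ m := hu.norm_le (htime (i + 1) (by omega)) hz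
      have n2 : ‖g i j k‖ ≤ m := hu.norm_le (htime i (by omega)) hz
      have := norm_sub_le (2 * g (i + 1) j k) (g i j k)
      rw [norm_mul, Complex.norm_ofNat] at this
      linarith) hsq
  rw [hJK, ← hê] at hF
  rw [← hê] at hFim
  have heq := bdf2_error_equation (J := J) (K := K) (hx := hx) (hy := hy) (τ := τ) (lam := lam)
    (g₀ := g i) (g₁ := g (i + 1)) (g₂ := g (i + 1 + 1)) (w₀ := w i) (w₁ := w (i + 1))
    (w₂ := w (i + 1 + 1)) (fun j k h1 h2 h3 h4 => by
      have := hw.step (i + 1) (by omega) hnN j k h1 h2 h3 h4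
      rwa [Nat.add_sub_cancel] at this)
  exact bdf2_step_bounds hτ hτ1 hm hA0 hT.le (abs_nonneg _) hητ hsmall heq
    (hinner (i + 1 + 1) hnN) hr hFim hF hE

lemma three_le_of_step_le {L hx : ℝ} {J : ℕ} (hL : 0 < L) (hJ : 0 < J) (hxJ : hx = L / J)
    (h : hx ≤ L / 3) : 3 ≤ J := by
  have hJ0 : (0 : ℝ) < J := by exact_mod_cast hJ
  rw [hxJ, div_le_div_iff_of_pos_left hL hJ0 (by norm_num)] at h
  exact_mod_cast h

lemma mul_sq_le_one_of_le {x h : ℝ} (hx : 0 ≤ x) (h0 : 0 ≤ h) (hh : h ≤ 1 / (1 + x)) :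
    x * h ^ 2 ≤ 1 := by
  have h1 : h * (1 + x) ≤ 1 := by rwa [le_div_iff₀ (by positivity)] at hh
  have h2 : 0 ≤ h * x := by positivity
  nlinarith

end LogSE

/-- Error estimates of the linearized BDF2 scheme. The constant `C` depends only on `|λ|`, `|Ω|`,
`T` and a bound `M` of the norms of `u`. The hypothesis `h ≲ h_min` is `h ≤ κ h_min`. -/
theorem theorem3p2 (Λ A T M : ℝ) (hΛ : 0 < Λ) (hA : 0 < A) (hT : 0 < T) :
    ∃ C : ℝ, 0 < C ∧
      ∀ (a b c d lam : ℝ), a < b → c < d → (b - a) * (d - c) = A → |lam| = Λ →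
      ∀ u : ℝ → ℝ × ℝ → ℂ, LogSE.IsRegularSolution (LogSE.rect a b c d) T lam M u →
      ∀ κ : ℝ, 0 < κ →
      ∃ h₀ τ₀ : ℝ, 0 < h₀ ∧ 0 < τ₀ ∧
        ∀ (J K N : ℕ), 0 < J → 0 < K → 0 < N →
        ∀ (hx hy h τ : ℝ), hx = (b - a) / J → hy = (d - c) / K → h = max hx hy → τ = T / N →
          h ≤ κ * min hx hy → h ≤ h₀ → τ ≤ τ₀ →
        ∀ w : ℕ → ℕ → ℕ → ℂ,
          LogSE.IsBDF2Solution J K N hx hy τ lam (LogSE.gridRestrict a c hx hy (u 0)) w →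
        ∀ n ≤ N,
          LogSE.l2Norm J K hx hy
              (fun j k => LogSE.gridRestrict a c hx hy (u (n * τ)) j k - w n j k)
            ≤ C * (τ ^ 2 * |Real.log τ| + h ^ 2) ∧
          LogSE.h1Seminorm J K hx hy
              (fun j k => LogSE.gridRestrict a c hx hy (u (n * τ)) j k - w n j k)
            ≤ C * τ ^ (-(1 / 2) : ℝ) * (τ ^ 2 * |Real.log τ| + h ^ 2) := by
  -- A bound of at least 1 lets lower powers of m be absorbed into m² in the truncation constants.
  set m := max M 1 with hmdef
  have hm : 1 ≤ m := le_max_right _ _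
  have hP := LogSE.l2Const_nonneg (m := m) (Λ := Λ) hA.le hT.le
  have hQ := LogSE.h1Const_nonneg (T := T) (by linarith : 0 ≤ m) hΛ.le hA.le
  set P := LogSE.l2Const m Λ A T with hPdef
  set Q := LogSE.h1Const m Λ A T with hQdef
  -- The constant is fixed before κ; only the threshold on h below depends on κ.
  refine ⟨1 + √P + √Q, by positivity, ?_⟩
  intro a b c d lam hab hcd hArea hlam u hu κ hκ
  obtain ⟨τ₁, hτ₁, hstep⟩ := LogSE.exists_small_step (3 * m + 2) (by linarith)
  -- The thirds force J, K ≥ 3. The second bound on h yields 4Pκ²h² ≤ 1 for the inverse estimate,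
  -- and the second bound on τ yields 80Qτ ≤ 1 for the H¹ regime.
  refine ⟨min (min ((b - a) / 3) ((d - c) / 3)) (1 / (1 + 4 * P * κ ^ 2)),
    min τ₁ (1 / (1 + 80 * Q)), ?_, ?_, ?_⟩
  · exact lt_min (lt_min (by linarith) (by linarith)) (by positivity)
  · exact lt_min hτ₁ (by positivity)
  intro J K N hJ hK hN hx hy h τ hxJ hyK hh hτN hκh hh₀ hττ₀ w hw n hnN
  have hJ0 : (0 : ℝ) < J := by exact_mod_cast hJ
  have hK0 : (0 : ℝ) < K := by exact_mod_cast hK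
  have hN0 : (0 : ℝ) < N := by exact_mod_cast hN
  have hx0 : 0 < hx := hxJ ▸ div_pos (by linarith) hJ0
  have hy0 : 0 < hy := hyK ▸ div_pos (by linarith) hK0
  have hτ : 0 < τ := hτN ▸ div_pos hT hN0
  have hxh : hx ≤ h := hh ▸ le_max_left _ _
  have hyh : hy ≤ h := hh ▸ le_max_right _ _
  have hJ3 : 3 ≤ J := LogSE.three_le_of_step_le (sub_pos.2 hab) hJ hxJ
    (hxh.trans (hh₀.trans ((min_le_left _ _).trans (min_le_left _ _))))
  have hK3 : 3 ≤ K := LogSE.three_le_of_step_le (sub_pos.2 hcd) hK hyK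
    (hyh.trans (hh₀.trans ((min_le_left _ _).trans (min_le_right _ _))))
  obtain ⟨hτ1, hl, hsmall⟩ := hstep τ hτ (hττ₀.trans (min_le_left _ _))
  have hs0 : 4 * P * κ ^ 2 * h ^ 2 ≤ 1 := LogSE.mul_sq_le_one_of_le (by positivity)
    (hx0.le.trans hxh) (hh₀.trans (min_le_right _ _))
  have hs1 : 80 * Q * τ ≤ 1 := by
    have := hττ₀.trans (min_le_right _ _)
    rw [le_div_iff₀ (by positivity)] at this
    nlinarith
  have hη0 : 0 ≤ τ ^ 2 * |Real.log τ| + h ^ 2 := by positivity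
  set η := τ ^ 2 * |Real.log τ| + h ^ 2 with hη
  have hτT : N * τ = T := by rw [hτN]; field_simp
  rw [LogSE.l2Norm_eq hx0 hy0, LogSE.h1Seminorm_eq]
  have hbounds : ‖LogSE.gridVec J K hx hy (LogSE.gridRestrict a c hx hy (u (n * τ)) - w n)‖ ^ 2
        ≤ P * η ^ 2 ∧
      LogSE.h1Sq J K hx hy (LogSE.gridRestrict a c hx hy (u (n * τ)) - w n) ≤ Q * η ^ 2 / τ := by
    -- The energy involves two time levels and starts at n = 1; at n = 0 the error is zero.
    rcases Nat.eq_zero_or_pos n with rfl | hn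
    · have hz : ∀ j ≤ J, ∀ k ≤ K, (LogSE.gridRestrict a c hx hy (u ((0 : ℕ) * τ)) - w 0) j k = 0 :=
        fun j hj k hk => by
          rw [Pi.sub_apply, Pi.sub_apply, hw.initial j hj k hk, Nat.cast_zero, zero_mul, sub_self]
      rw [LogSE.norm_gridVec_eq_zero hz, LogSE.h1Sq_eq_zero hz]
      exact ⟨by rw [zero_pow two_ne_zero]; positivity, by positivity⟩
    · have := LogSE.error_bounds hT hm (hu.mono (le_max_left _ _)) hab hcd hJ3 hK3 hxJ hyK hh hτT
        hτ hκh hArea hτ1 hl hsmall (by rw [hlam]; exact hs1) (by rw [hlam]; exact hs0) hw hη hn hnN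
      rwa [hlam] at this
  have hτr : τ ^ (-(1 / 2) : ℝ) = (√τ)⁻¹ := by
    rw [Real.rpow_neg hτ.le, ← Real.sqrt_eq_rpow]
  constructor
  · refine le_trans (Real.le_sqrt_of_sq_le hbounds.1) ?_
    rw [Real.sqrt_mul hP, Real.sqrt_sq hη0]
    gcongr
    linarith [Real.sqrt_nonneg Q]
  · refine le_trans (Real.sqrt_le_sqrt hbounds.2) ?_
    rw [Real.sqrt_div (by positivity), Real.sqrt_mul hQ, Real.sqrt_sq hη0, hτr, div_eq_mul_inv,
      mul_right_comm]
    gcongr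
    linarith [Real.sqrt_nonneg P]
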